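/- **Setting.** Let $\lambda>0$, $k\ge 2$, and let $\mathbf x^1,\dots,\mathbf x^k\in\mathbb R^2$ have the same second coordinate. Write $\mathbf y(i)$ for the $i$-th coordinate of $\mathbf y$, $\mathbb H^+(r)=\{\mathbf y:\mathbf y(2)>r\}$, and $B^+(\mathbf x,r)=\{\mathbf y:\|\mathbf y-\mathbf x\|_\infty<r\}\cap\mathbb H^+(\mathbf x(2))$. For a point set $M\subset\mathbb R^2$ let $h(\mathbf x,M)$ be the point of $M\cap\mathbb H^+(\mathbf x(2))$ nearest to $\mathbf x$ in $\ell_\infty$ distance. Let $\mathcal N_1,\mathcal N_2,\dots$ be independent homogeneous Poisson point processes of intensity $\lambda$ on $\mathbb R^2$. The joint exploration process of $k$ $\ell_\infty$ DSF (directed spanning forest) paths, in its version with resampling outside the history set, is $(g_n(\mathbf x^1),\dots,g_n(\mathbf x^k),H_n)_{n\ge 0}$, defined as follows. Put $g_0(\mathbf x^i)=\mathbf x^i$ and $H_0=\emptyset$. Given step $n$, let $r_n=\min_i g_n(\mathbf x^i)(2)$, let $W_n^{\mathrm{move}}$ be the set of the points $g_n(\mathbf x^i)$ of height $r_n$ (for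 $n\ge1$ almost surely a single point), and let $W_n^{\mathrm{stay}}=\{g_n(\mathbf x^1),\dots,g_n(\mathbf x^k)\}\setminus W_n^{\mathrm{move}}$. With $\tilde h(\mathbf w)=h\bigl(\mathbf w,(\mathcal N_{n+1}\setminus H_n)\cup W_n^{\mathrm{stay}}\bigr)$, put $g_{n+1}(\mathbf x^i)=\tilde h(g_n(\mathbf x^i))$ if $g_n(\mathbf x^i)\in W_n^{\mathrm{move}}$ and $g_{n+1}(\mathbf x^i)=g_n(\mathbf x^i)$ otherwise, and $$H_{n+1}=\Bigl(H_n\cup\bigcup_{\mathbf w\in W_n^{\mathrm{move}}}B^+\bigl(\mathbf w,\|\mathbf w-\tilde h(\mathbf w)\|_\infty\bigr)\Bigr)\cap\mathbb H^+(r_{n+1}).$$ Let $\mathcal F_n=\sigma\bigl(g_l(\mathbf x^1),\dots,g_l(\mathbf x^k):0\le l\le n\bigr)$. Let $L_n=\sup\{\mathbf y(2)-\mathbf x(2):\mathbf x,\mathbf y\in H_n\}$ (with $L_n=0$ if $H_n=\emptyset$) and $G_n=L_n+2\,\#W_n^{\mathrm{stay}}$. Fix $\kappa>2(k-1)+1$,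 put $\tau_0=0$, and for $j\ge1$ let $$\tau_j=\inf\{nk>\tau_{j-1}:\ G_{nk}\le\kappa,\ r_{nk}>r_{\tau_{j-1}}+\kappa+1\},$$ where $r_m$ is the height of the moving vertex at step $m$, $\inf\emptyset=\infty$, and $\tau_j=\infty$ if $\tau_{j-1}=\infty$. **Proposition 4.1.** There exist constants $c_0,c_1>0$, depending only on $\lambda$, $k$ and $\kappa$ (in particular not on $\mathbf x^1,\dots,\mathbf x^k$), such that the following holds. The $\tau_j$ are stopping times with respect to $(\mathcal F_n)_{n\ge0}$, almost surely $\tau_j<\infty$ for all $j$, and for all $j\ge1$ and $n\in\mathbb N$, $$\mathbb P\bigl(\tau_{j+1}-\tau_j>n\mid\mathcal F_{\tau_j}\bigr)\le c_0\,e^{-c_1n}\quad\text{almost surely.}$$ -/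

import Mathlib

open MeasureTheory ProbabilityTheory Set
open scoped NNReal ENNReal

noncomputable section

namespace DSF

/-- The plane. The distance Mathlib puts on `ℝ × ℝ` is the `ℓ∞` distance, its canonical measure is
Lebesgue measure. For `x : Plane` the two coordinates are `x.1` and `x.2`. -/
abbrev Plane : Type := ℝ × ℝ

/-- The number of points of a random point set `N` in `A`. -/
def count {Ω : Type*} (N : Ω → Set Plane) (A : Set Plane) (ω : Ω) : ℕ∞ := (N ω ∩ A).encard

/-- `N` is a homogeneous Poisson point process of intensity `lam` on the plane: a random locally
finite set whose counts in Borel sets are random variables, are Poisson distributed with mean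
`lam` times the area, and are independent on disjoint sets. -/
structure IsPoissonProcess {Ω : Type*} [MeasurableSpace Ω] (P : Measure Ω) (lam : ℝ≥0)
    (N : Ω → Set Plane) : Prop where
  locallyFinite : ∀ ω, ∀ A : Set Plane, Bornology.IsBounded A → (N ω ∩ A).Finite
  measurable_count : ∀ A : Set Plane, MeasurableSet A → Measurable (count N A)
  law_count : ∀ A : Set Plane, MeasurableSet A → volume A < ∞ →
    P.map (count N A) =
      (poissonMeasure (lam * (volume A).toNNReal)).map (fun m : ℕ => (m : ℕ∞))
  indep_count : ∀ (m : ℕ) (A : Fin m → Set Plane), (∀ i, MeasurableSet (A i)) →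
    Pairwise (fun i j => Disjoint (A i) (A j)) → iIndepFun (fun i => count N (A i)) P

/-- The σ-algebra generated by a random point set (through its counts in Borel sets). -/
@[reducible] def pointSigma {Ω : Type*} (N : Ω → Set Plane) : MeasurableSpace Ω :=
  ⨆ (A : Set Plane) (_ : MeasurableSet A), MeasurableSpace.comap (count N A) inferInstance

/-- `y` is a point of `M` strictly above `x` that is nearest to `x` in `ℓ∞` distance among all
points of `M` strictly above `x`. -/
def IsNearestAbove (M : Set Plane) (x y : Plane) : Prop :=
  y ∈ M ∧ x.2 < y.2 ∧ ∀ z ∈ M, x.2 < z.2 → dist x y ≤ dist x z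

open Classical in
/-- The ancestor `h(x, M)`: the nearest point of `M` strictly above `x`. In the exploration process
below this nearest point almost surely exists and is unique; otherwise the value is `x`. -/
def ancestor (M : Set Plane) (x : Plane) : Plane :=
  if h : ∃! y, IsNearestAbove M x y then h.choose else x

/-- The open upper half-plane above height `r`. -/
def upperHalf (r : ℝ) : Set Plane := {y | r < y.2}

/-- `B⁺(x, r)`, the upper half of the open `ℓ∞` ball of radius `r` around `x`. -/
def upperBall (x : Plane) (r : ℝ) : Set Plane := Metric.ball x r ∩ upperHalf x.2

/-- The height `L(H)` of a bounded set (`sSup ∅ = 0`, so the empty set has height `0`). -/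
def height (H : Set Plane) : ℝ := sSup {t | ∃ x ∈ H, ∃ y ∈ H, t = y.2 - x.2}

/-- A state of the joint exploration process of `k` paths: the current positions of the paths and
the history set. -/
structure State (k : ℕ) where
  pos : Fin k → Plane
  hist : Set Plane

namespace State

variable {k : ℕ}

/-- The lowest height of the current positions, that is, the height of the moving vertex. -/
def level (s : State k) : ℝ := ⨅ i, (s.pos i).2

/-- The set of current positions of least height. -/
def moveSet (s : State k) : Set Plane := {w | w ∈ range s.pos ∧ w.2 = s.level}

/-- The set of the other current positions. -/
def staySet (s : State k) : Set Plane := range s.pos \ s.moveSet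

/-- `G = L(H) + 2 · #(stay set)`. -/
def G (s : State k) : ℝ := height s.hist + 2 * (s.staySet.ncard : ℝ)

/-- The point set that the moving vertices see when the (fresh) points are `N`: the points of `N`
outside the history set, and the stay vertices. -/
def visible (N : Set Plane) (s : State k) : Set Plane := (N \ s.hist) ∪ s.staySet

open Classical in
/-- The positions after one step: vertices of least height move to their ancestor, all others
stay. -/
def nextPos (N : Set Plane) (s : State k) (i : Fin k) : Plane :=
  if s.pos i ∈ s.moveSet then ancestor (s.visible N) (s.pos i) else s.pos i

/-- One step of the joint exploration process: the history set gains the upper half-balls explored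
by the moving vertices, and is cut off at the new least height. -/
def next (N : Set Plane) (s : State k) : State k where
  pos := s.nextPos N
  hist := (s.hist ∪ ⋃ w ∈ s.moveSet, upperBall w (dist w (ancestor (s.visible N) w))) ∩
    upperHalf (⨅ i, (s.nextPos N i).2)

end State

/-- The joint exploration process `(g_n(x¹), …, g_n(xᵏ), H_n)` started from `x` with empty history;
the step from time `n` to time `n + 1` uses the point set `N n`. -/
def explore {k : ℕ} (x : Fin k → Plane) (N : ℕ → Set Plane) : ℕ → State k
  | 0 => ⟨x, ∅⟩
  | n + 1 => (explore x N n).next (N n)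

/-- The first time after `t` among the multiples `n * k` at which `G ≤ κ` and the moving vertex is
more than `κ + 1` above its height at time `t` (`⊤` if there is no such time). -/
def nextGood {k : ℕ} (κ : ℝ) (s : ℕ → State k) (t : ℕ) : WithTop ℕ :=
  sInf {m : WithTop ℕ | ∃ n : ℕ, m = ((n * k : ℕ) : WithTop ℕ) ∧ t < n * k ∧
    (s (n * k)).G ≤ κ ∧ (s t).level + κ + 1 < (s (n * k)).level}

/-- The good steps `τ_0 = 0 < τ_1 < τ_2 < …` along a trajectory `s` (`⊤` from the point on where
there are no further ones). -/
def goodStep {k : ℕ} (κ : ℝ) (s : ℕ → State k) : ℕ → WithTop ℕ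
  | 0 => 0
  | j + 1 => match goodStep κ s j with
    | (t : ℕ) => nextGood κ s t
    | ⊤ => ⊤

/-- The positions `(g_n(x¹), …, g_n(xᵏ))` as random variables. -/
def position {Ω : Type*} {k : ℕ} (x : Fin k → Plane) (N : ℕ → Ω → Set Plane) (n : ℕ) (ω : Ω) :
    Fin k → Plane :=
  (explore x (fun m => N m ω) n).pos

/-- The good steps `τ_j` as random times. -/
def goodTime {Ω : Type*} {k : ℕ} (κ : ℝ) (x : Fin k → Plane) (N : ℕ → Ω → Set Plane) (j : ℕ)
    (ω : Ω) : WithTop ℕ :=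
  goodStep κ (explore x (fun m => N m ω)) j

end DSF

end

noncomputable section

namespace DSF

/-! ### Deterministic properties of the exploration process -/

/-! The proof is a Foster–Lyapunov argument. Let `top` be the upper end of the history. The
potential of a state is the sum over all paths of their depth below `top`, plus a quarter of the
number of ordered pairs of paths at different positions; put V = exp(potential).

Drift. A step that raises `top` by Z raises the potential by at most kZ. When the history has height
L, raising `top` by more than z forces a rectangle of area at least 2Lz above the history to be
empty, so Z has an exponential tail of rate 2λL and E exp(kZ) is close to 1 for large L. On the
other hand, with a probability bounded below the moving vertex rises by 1/4 or lands on another path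
(`exists_progress_event`), and either event lowers the potential by 1/4. Hence E V' ≤ (1 - ε) V + b
for one step from any state with a single moving vertex (`lintegral_exp_potential_next_le`).

Success. From a history of bounded height, k favourable jumps in a row carry all paths above a
prescribed height while the history stays at most 1 above that height. Such a block of k steps ends
at a time that qualifies as a good step, with a probability bounded below (`measure_success_ge`).

Combination. For a large constant A, the expectation of V + A after a block, restricted to failure
of the block, is at most ρ (V + A) with ρ < 1: for small V because failure has probability bounded
away from 1, for large V because of the drift (`setLIntegral_fail_le`). Iteration gives geometric
decay of the probability that many blocks fail (`measure_failSet_le`), and at a good step V is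
bounded by a constant since G ≤ κ there.

Two points make this rigorous. The one-step bounds are proved for a frozen state and transferred by
independence of the fresh point set from the `past` (`setLIntegral_next_le`); ties are excluded
almost surely along the trajectory (`ae_generalPosition`). And `top` obeys a recursion in the
positions alone (`top_explore_succ`), so that G, and with it every good step, is adapted to the
filtration of the positions. -/

theorem isNearestAbove_ancestor {M : Set Plane} {x : Plane} (h : ancestor M x ≠ x) :
    IsNearestAbove M x (ancestor M x) := by
  unfold ancestor at h ⊢
  split_ifs at h ⊢ with h'
  · exact h'.choose_spec.1
  · exact absurd rfl h

theorem ancestor_eq {M : Set Plane} {x y : Plane} (h : ∃! y, IsNearestAbove M x y)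
    (hy : IsNearestAbove M x y) : ancestor M x = y := by
  unfold ancestor
  rw [dif_pos h]
  exact h.unique h.choose_spec.1 hy

theorem ancestor_ne_iff {M : Set Plane} {x : Plane} :
    ancestor M x ≠ x ↔ ∃! y, IsNearestAbove M x y := by
  constructor
  · intro h
    by_contra h'
    exact h (by unfold ancestor; rw [dif_neg h'])
  · intro h h'
    obtain ⟨y, hy, -⟩ := id h
    rw [ancestor_eq h hy] at h'
    have := hy.2.1
    rw [h'] at this
    exact lt_irrefl _ this

theorem le_ancestor (M : Set Plane) (x : Plane) : x.2 ≤ (ancestor M x).2 := by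
  by_cases h : ancestor M x = x
  · rw [h]
  · exact (isNearestAbove_ancestor h).2.1.le

theorem snd_le_add_dist (x y : Plane) : y.2 ≤ x.2 + dist x y := by
  have h : dist x.2 y.2 ≤ dist x y := by rw [Prod.dist_eq]; exact le_max_right _ _
  rw [Real.dist_eq] at h
  linarith [neg_abs_le (x.2 - y.2)]

theorem mem_upperBall {x z : Plane} {r : ℝ} :
    z ∈ upperBall x r ↔ |z.1 - x.1| < r ∧ x.2 < z.2 ∧ z.2 < x.2 + r := by
  simp only [upperBall, upperHalf, mem_inter_iff, Metric.mem_ball, Prod.dist_eq, sup_lt_iff,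
    Real.dist_eq, mem_ofPred_eq]
  constructor
  · rintro ⟨⟨h1, h2⟩, h3⟩
    exact ⟨h1, h3, by linarith [le_abs_self (z.2 - x.2)]⟩
  · rintro ⟨h1, h2, h3⟩
    exact ⟨⟨h1, by rw [abs_lt]; constructor <;> linarith⟩, h2⟩

theorem dist_lt_of_mem_upperBall {x z : Plane} {r : ℝ} (h : z ∈ upperBall x r) :
    dist x z < r := by
  rw [dist_comm]; exact h.1

namespace State

variable {k : ℕ}

theorem mem_moveSet (s : State k) (i : Fin k) :
    s.pos i ∈ s.moveSet ↔ (s.pos i).2 = s.level := by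
  simp [moveSet]

theorem level_le (s : State k) (i : Fin k) : s.level ≤ (s.pos i).2 :=
  ciInf_le (Set.finite_range fun i => (s.pos i).2).bddBelow i

theorem exists_mem_moveSet [NeZero k] (s : State k) : ∃ i, s.pos i ∈ s.moveSet := by
  obtain ⟨i, hi⟩ := exists_eq_ciInf_of_finite (f := fun i => (s.pos i).2)
  exact ⟨i, (s.mem_moveSet i).2 hi⟩

theorem mem_staySet (s : State k) (v : Plane) :
    v ∈ s.staySet ↔ ∃ i, s.pos i = v ∧ s.level < v.2 := by
  simp only [staySet, moveSet, mem_sdiff, mem_range, mem_ofPred_eq, not_and]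
  constructor
  · rintro ⟨⟨i, rfl⟩, h⟩
    exact ⟨i, rfl, lt_of_le_of_ne (s.level_le i) (fun h' => h ⟨i, rfl⟩ h'.symm)⟩
  · rintro ⟨i, rfl, h⟩
    exact ⟨⟨i, rfl⟩, fun _ h' => h.ne' h'⟩

variable (N : Set Plane) (s : State k)

theorem next_pos_of_mem {i : Fin k} (h : s.pos i ∈ s.moveSet) :
    (s.next N).pos i = ancestor (s.visible N) (s.pos i) := if_pos h

theorem next_pos_of_notMem {i : Fin k} (h : s.pos i ∉ s.moveSet) :
    (s.next N).pos i = s.pos i := if_neg h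

theorem pos_le_next (i : Fin k) : (s.pos i).2 ≤ ((s.next N).pos i).2 := by
  by_cases h : s.pos i ∈ s.moveSet
  · rw [next_pos_of_mem N s h]; exact le_ancestor _ _
  · rw [next_pos_of_notMem N s h]

theorem level_le_next [NeZero k] : s.level ≤ (s.next N).level :=
  le_ciInf fun i => (s.level_le i).trans (s.pos_le_next N i)

theorem mem_next_hist (z : Plane) :
    z ∈ (s.next N).hist ↔ (z ∈ s.hist ∨ ∃ i, s.pos i ∈ s.moveSet ∧
      z ∈ upperBall (s.pos i) (dist (s.pos i) ((s.next N).pos i))) ∧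
      (s.next N).level < z.2 := by
  have hlev : (⨅ i, (s.nextPos N i).2) = (s.next N).level := rfl
  have hh : (s.next N).hist = (s.hist ∪ ⋃ w ∈ s.moveSet,
      upperBall w (dist w (ancestor (s.visible N) w))) ∩ upperHalf (s.next N).level := rfl
  rw [hh]
  simp only [upperHalf, mem_inter_iff, mem_union, mem_iUnion, mem_ofPred_eq, exists_prop]
  refine and_congr_left fun _ => or_congr_right ?_
  constructor
  · rintro ⟨w, hw, h⟩
    obtain ⟨i, rfl⟩ := hw.1
    exact ⟨i, hw, by rwa [next_pos_of_mem N s hw]⟩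
  · rintro ⟨i, hi, h⟩
    exact ⟨_, hi, by rwa [next_pos_of_mem N s hi] at h⟩

/-- The greatest height reached by the half-balls explored between `s` and `s'`. -/
def reach (s s' : State k) : ℝ :=
  ⨆ i, if (s.pos i).2 = s.level then (s.pos i).2 + dist (s.pos i) (s'.pos i) else s.level

theorem le_reach (s s' : State k) {i : Fin k} (h : s.pos i ∈ s.moveSet) :
    (s.pos i).2 + dist (s.pos i) (s'.pos i) ≤ s.reach s' := by
  have := le_ciSup (Set.finite_range fun i => if (s.pos i).2 = s.level then
    (s.pos i).2 + dist (s.pos i) (s'.pos i) else s.level).bddAbove i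
  rwa [if_pos ((s.mem_moveSet i).1 h)] at this

theorem exists_reach_eq [NeZero k] (s s' : State k) : ∃ i, s.pos i ∈ s.moveSet ∧
    s.reach s' = (s.pos i).2 + dist (s.pos i) (s'.pos i) := by
  obtain ⟨i, hi⟩ := exists_eq_ciSup_of_finite (f := fun i => if (s.pos i).2 = s.level then
    (s.pos i).2 + dist (s.pos i) (s'.pos i) else s.level)
  have hi' : (if (s.pos i).2 = s.level then
    (s.pos i).2 + dist (s.pos i) (s'.pos i) else s.level) = s.reach s' := hi
  split_ifs at hi' with h
  · exact ⟨i, (s.mem_moveSet i).2 h, hi'.symm⟩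
  · obtain ⟨j, hj⟩ := s.exists_mem_moveSet
    refine ⟨j, hj, le_antisymm ?_ (s.le_reach s' hj)⟩
    rw [← hi', (s.mem_moveSet j).1 hj]
    linarith [dist_nonneg (x := s.pos j) (y := s'.pos j)]

/-- The shape of the states along the exploration process: the history lies between the level and
the height `T`, reaches all heights in between, and contains with a point also the points below it
down to the level. -/
structure WellFormed (s : State k) (T : ℝ) : Prop where
  level_le_top : s.level ≤ T
  pos_le_top : ∀ i, (s.pos i).2 ≤ T
  level_lt : ∀ z ∈ s.hist, s.level < z.2
  le_top : ∀ z ∈ s.hist, z.2 ≤ T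
  down : ∀ z ∈ s.hist, ∀ t, s.level < t → t ≤ z.2 → (z.1, t) ∈ s.hist
  fill : ∀ t, s.level < t → t < T → ∃ z ∈ s.hist, z.2 = t

theorem WellFormed.height_eq {s : State k} {T : ℝ} (h : s.WellFormed T) :
    height s.hist = T - s.level := by
  unfold height
  rcases h.level_le_top.eq_or_lt with heq | hlt
  · have : s.hist = ∅ := by
      ext z
      simp only [mem_empty_iff_false, iff_false]
      intro hz
      linarith [h.level_lt z hz, h.le_top z hz]
    simp [this, heq]
  · apply csSup_eq_of_forall_le_of_forall_lt_exists_gt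
    · obtain ⟨z, hz, -⟩ := h.fill ((s.level + T) / 2) (by linarith) (by linarith)
      exact ⟨0, z, hz, z, hz, by ring⟩
    · rintro _ ⟨x, hx, y, hy, rfl⟩
      linarith [h.level_lt x hx, h.le_top y hy]
    -- With e at most a third of the gap, heights `level + e` and `T - e` still differ by more than
    -- w; e ≤ (T - level)/2 keeps both in the range of `fill`.
    · intro w hw
      set e := min ((T - s.level - w) / 3) ((T - s.level) / 2) with he
      have he0 : 0 < e := lt_min (by linarith) (by linarith)
      have he1 : e ≤ (T - s.level - w) / 3 := min_le_left _ _
      have he2 : e ≤ (T - s.level) / 2 := min_le_right _ _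
      obtain ⟨x, hx, hx'⟩ := h.fill (s.level + e) (by linarith) (by linarith)
      obtain ⟨y, hy, hy'⟩ := h.fill (T - e) (by linarith) (by linarith)
      exact ⟨_, ⟨x, hx, y, hy, rfl⟩, by rw [hx', hy']; linarith⟩

/-- The new half-balls stand on the old level, so cutting them off at the higher new level keeps
`down`. Heights from T on are filled by the vertical segment above the moving vertex whose half-ball
reaches highest. -/
theorem WellFormed.next [NeZero k] {s : State k} {T : ℝ} (h : s.WellFormed T) (N : Set Plane) :
    (s.next N).WellFormed (max T (s.reach (s.next N))) := by
  have hpos : ∀ i, ((s.next N).pos i).2 ≤ max T (s.reach (s.next N)) := by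
    intro i
    by_cases hi : s.pos i ∈ s.moveSet
    · exact le_max_of_le_right ((snd_le_add_dist _ _).trans (s.le_reach _ hi))
    · rw [s.next_pos_of_notMem N hi]
      exact le_max_of_le_left (h.pos_le_top i)
  have hlev := s.level_le_next N
  refine ⟨((s.next N).level_le 0).trans (hpos 0), hpos, ?_, ?_, ?_, ?_⟩
  · intro z hz
    exact ((s.mem_next_hist N z).1 hz).2
  · intro z hz
    rcases ((s.mem_next_hist N z).1 hz).1 with hz' | ⟨i, hi, hz'⟩
    · exact le_max_of_le_left (h.le_top z hz')
    · exact le_max_of_le_right ((mem_upperBall.1 hz').2.2.le.trans (s.le_reach _ hi))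
  · intro z hz t ht htz
    rw [s.mem_next_hist N] at hz ⊢
    refine ⟨?_, ht⟩
    rcases hz.1 with hz' | ⟨i, hi, hz'⟩
    · exact Or.inl (h.down z hz' t (hlev.trans_lt ht) htz)
    · refine Or.inr ⟨i, hi, ?_⟩
      rw [mem_upperBall] at hz' ⊢
      refine ⟨hz'.1, ?_, htz.trans_lt hz'.2.2⟩
      rw [(s.mem_moveSet i).1 hi]
      exact hlev.trans_lt ht
  · intro t ht htT
    by_cases htT' : t < T
    · obtain ⟨z, hz, rfl⟩ := h.fill t (hlev.trans_lt ht) htT'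
      exact ⟨z, (s.mem_next_hist N z).2 ⟨Or.inl hz, ht⟩, rfl⟩
    · obtain ⟨i, hi, hr⟩ := s.exists_reach_eq (s.next N)
      have htr : t < s.reach (s.next N) := by
        rcases lt_max_iff.1 htT with h' | h'
        · exact absurd h' htT'
        · exact h'
      have hit : (s.pos i).2 < t := by
        rw [(s.mem_moveSet i).1 hi]; exact hlev.trans_lt ht
      refine ⟨((s.pos i).1, t), (s.mem_next_hist N _).2 ⟨Or.inr ⟨i, hi, ?_⟩, ht⟩, rfl⟩
      rw [mem_upperBall]
      rw [hr] at htr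
      refine ⟨?_, hit, htr⟩
      simp only [sub_self, abs_zero]
      linarith

/-- The height of the upper end of the history, the level if the history is empty. -/
def top (s : State k) : ℝ := s.level + height s.hist

theorem WellFormed.top_eq {s : State k} {T : ℝ} (h : s.WellFormed T) : s.top = T := by
  rw [top, h.height_eq]; ring

end State

variable {k : ℕ}

/-- This is where the common starting height enters: for an empty history `fill` forces the top down
to the level, while the top must dominate all positions. -/
theorem wellFormed_init (x : Fin k → Plane) (hx : ∀ i i', (x i).2 = (x i').2) [NeZero k] :
    (State.mk x ∅ : State k).WellFormed (x 0).2 := by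
  have hl : (State.mk x ∅ : State k).level = (x 0).2 := by
    unfold State.level
    rw [show (fun i => ((State.mk x ∅ : State k).pos i).2) = fun _ => (x 0).2 from
      funext fun i => hx i 0]
    exact ciInf_const
  refine ⟨hl.le, fun i => (hx i 0).le, ?_, ?_, ?_, ?_⟩
  · intro z hz; exact absurd hz (notMem_empty z)
  · intro z hz; exact absurd hz (notMem_empty z)
  · intro z hz; exact absurd hz (notMem_empty z)
  · intro t ht ht'; linarith

theorem wellFormed_explore (x : Fin k → Plane) (hx : ∀ i i', (x i).2 = (x i').2) [NeZero k]
    (N : ℕ → Set Plane) (n : ℕ) : (explore x N n).WellFormed (explore x N n).top := by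
  induction n with
  | zero =>
    have h := wellFormed_init x hx
    have h' := h.top_eq
    rw [← h'] at h
    exact h
  | succ n ih =>
    have h := ih.next (N n)
    have h' := h.top_eq
    rw [← h'] at h
    exact h

/-- `reach` depends on positions only, so this recursion recovers the height of the history from the
positions, without reference to the point sets. -/
theorem top_explore_succ (x : Fin k → Plane) (hx : ∀ i i', (x i).2 = (x i').2) [NeZero k]
    (N : ℕ → Set Plane) (n : ℕ) : (explore x N (n + 1)).top =
      max (explore x N n).top ((explore x N n).reach (explore x N (n + 1))) :=
  ((wellFormed_explore x hx N n).next (N n)).top_eq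

theorem top_explore_zero (x : Fin k → Plane) (hx : ∀ i i', (x i).2 = (x i').2) [NeZero k]
    (N : ℕ → Set Plane) : (explore x N 0).top = (x 0).2 :=
  (wellFormed_init x hx).top_eq

theorem level_explore_mono [NeZero k] (x : Fin k → Plane) (N : ℕ → Set Plane) :
    Monotone fun n => (explore x N n).level :=
  monotone_nat_of_le_succ fun n => (explore x N n).level_le_next (N n)

/-! ### One step of a state with a single moving vertex -/

namespace State

variable {k : ℕ}

/-- The number of pairs of paths that are at the same position. -/
def equalPairs (s : State k) : ℕ :=
  (Finset.univ.filter fun p : Fin k × Fin k => s.pos p.1 = s.pos p.2).card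

/-- The Lyapunov exponent of a state. -/
def potential (s : State k) : ℝ :=
  ∑ i, (s.top - (s.pos i).2) + (1 / 4) * ((k : ℝ) ^ 2 - s.equalPairs)

/-- The current positions of height at most `t`. -/
def lowSet (s : State k) (t : ℝ) : Set Plane := {v | v ∈ range s.pos ∧ v.2 ≤ t}

theorem equalPairs_le (s : State k) : (s.equalPairs : ℝ) ≤ (k : ℝ) ^ 2 := by
  have h : s.equalPairs ≤ k ^ 2 := by
    refine (Finset.card_filter_le _ _).trans ?_
    simp [sq]
  exact_mod_cast h

/-- With `potential_le` this makes the potential comparable with the height of the history. The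
moving vertex alone already contributes `top - level`. -/
theorem WellFormed.top_sub_level_le_potential [NeZero k] {s : State k}
    (h : s.WellFormed s.top) : s.top - s.level ≤ s.potential := by
  obtain ⟨i, hi⟩ := s.exists_mem_moveSet
  have h1 : s.top - (s.pos i).2 ≤ ∑ i, (s.top - (s.pos i).2) :=
    Finset.single_le_sum (f := fun i => s.top - (s.pos i).2)
      (fun j _ => sub_nonneg.2 (h.pos_le_top j)) (Finset.mem_univ i)
  rw [(s.mem_moveSet i).1 hi] at h1
  have := s.equalPairs_le
  unfold potential
  linarith

theorem potential_le (s : State k) :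
    s.potential ≤ k * (s.top - s.level) + (k : ℝ) ^ 2 / 4 := by
  have h1 : ∑ i, (s.top - (s.pos i).2) ≤ ∑ _i : Fin k, (s.top - s.level) :=
    Finset.sum_le_sum fun i _ => by linarith [s.level_le i]
  rw [Finset.sum_const, Finset.card_univ, Fintype.card_fin, nsmul_eq_mul] at h1
  have : (0 : ℝ) ≤ s.equalPairs := Nat.cast_nonneg _
  unfold potential
  linarith

/-- At least one position moves, so at most k - 1 stay. A history of height at most 1 therefore
yields G ≤ 2(k - 1) + 1 < κ. -/
theorem G_le [NeZero k] (s : State k) : s.G ≤ (s.top - s.level) + 2 * ((k : ℝ) - 1) := by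
  obtain ⟨i, hi⟩ := s.exists_mem_moveSet
  have h1 : s.staySet.ncard < (range s.pos).ncard := by
    refine Set.ncard_lt_ncard ⟨sdiff_subset, fun h => ?_⟩ (Set.finite_range _)
    exact (h ⟨i, rfl⟩).2 hi
  have h2 : (range s.pos).ncard ≤ k := by
    rw [← Set.image_univ]
    exact (Set.ncard_image_le Set.finite_univ).trans (by simp [Set.ncard_univ])
  have h3 : (s.staySet.ncard : ℝ) + 1 ≤ k := by exact_mod_cast (by omega)
  have h4 : s.top - s.level = height s.hist := by rw [top]; ring
  rw [G, h4]
  linarith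

theorem height_le_G (s : State k) : s.top - s.level ≤ s.G := by
  have : (0 : ℝ) ≤ s.staySet.ncard := Nat.cast_nonneg _
  rw [G, top]
  linarith

variable {N : Set Plane} {s : State k} {w : Plane}

theorem pos_eq_of_mem (hw : s.moveSet = {w}) {i : Fin k} (hi : s.pos i ∈ s.moveSet) :
    s.pos i = w := by rw [hw] at hi; exact hi

theorem snd_eq_level (hw : s.moveSet = {w}) : w.2 = s.level :=
  ((hw ▸ mem_singleton w : w ∈ s.moveSet)).2

theorem exists_pos_eq (hw : s.moveSet = {w}) : ∃ i, s.pos i = w :=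
  ((hw ▸ mem_singleton w : w ∈ s.moveSet)).1

theorem reach_next_eq [NeZero k] (hw : s.moveSet = {w}) :
    s.reach (s.next N) = s.level + dist w (ancestor (s.visible N) w) := by
  obtain ⟨i, hi, h⟩ := s.exists_reach_eq (s.next N)
  rw [h, s.next_pos_of_mem N hi, (s.mem_moveSet i).1 hi, pos_eq_of_mem hw hi]

theorem next_pos_congr (N : Set Plane) {i j : Fin k} (h : s.pos i = s.pos j) :
    (s.next N).pos i = (s.next N).pos j := by
  change s.nextPos N i = s.nextPos N j
  unfold nextPos
  rw [h]

theorem equalPairs_le_next : s.equalPairs ≤ (s.next N).equalPairs := by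
  refine Finset.card_le_card fun p hp => ?_
  simp only [Finset.mem_filter, Finset.mem_univ, true_and] at hp ⊢
  exact next_pos_congr N hp

theorem equalPairs_lt_next (hw : s.moveSet = {w})
    (hy : ancestor (s.visible N) w ∈ s.staySet) :
    s.equalPairs + 1 ≤ (s.next N).equalPairs := by
  refine Nat.succ_le_of_lt (Finset.card_lt_card ⟨fun p hp => ?_, fun h => ?_⟩)
  · simp only [Finset.mem_filter, Finset.mem_univ, true_and] at hp ⊢
    exact next_pos_congr N hp
  · obtain ⟨i, hi⟩ := exists_pos_eq hw
    obtain ⟨j, hj⟩ := hy.1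
    have hi' : s.pos i ∈ s.moveSet := by rw [hi, hw]; rfl
    have hj' : s.pos j ∉ s.moveSet := by rw [hj]; exact hy.2
    have hm : ((i, j) : Fin k × Fin k) ∈ Finset.univ.filter fun p : Fin k × Fin k =>
        (s.next N).pos p.1 = (s.next N).pos p.2 := by
      simp only [Finset.mem_filter, Finset.mem_univ, true_and]
      rw [s.next_pos_of_mem N hi', s.next_pos_of_notMem N hj', hi, hj]
    have hm' := h hm
    simp only [Finset.mem_filter, Finset.mem_univ, true_and] at hm'
    exact hj' (hm' ▸ hi')

/-- Each of the k depths grows by at most Z since positions never descend, and paths that have met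
stay together. -/
theorem potential_next_le {Z : ℝ} (hZ : (s.next N).top ≤ s.top + Z) :
    (s.next N).potential ≤ s.potential + k * Z := by
  have h1 : ∑ i, ((s.next N).top - ((s.next N).pos i).2) ≤
      ∑ i, (s.top - (s.pos i).2 + Z) :=
    Finset.sum_le_sum fun i _ => by linarith [s.pos_le_next N i]
  rw [Finset.sum_add_distrib, Finset.sum_const, Finset.card_univ, Fintype.card_fin,
    nsmul_eq_mul] at h1
  have h2 : (s.equalPairs : ℝ) ≤ (s.next N).equalPairs := by exact_mod_cast equalPairs_le_next
  unfold potential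
  linarith

/-- The weight 1/4 of a pair in the potential matches the rise by 1/4: meeting a path creates at
least one new equal pair, rising reduces the depth of a moving path. -/
theorem potential_next_le_sub (hw : s.moveSet = {w}) {Z : ℝ}
    (hZ : (s.next N).top ≤ s.top + Z)
    (hy : ancestor (s.visible N) w ∈ s.staySet ∨
      s.level + 1 / 4 ≤ (ancestor (s.visible N) w).2) :
    (s.next N).potential ≤ s.potential + k * Z - 1 / 4 := by
  rcases hy with hy | hy
  · have h1 : ∑ i, ((s.next N).top - ((s.next N).pos i).2) ≤
        ∑ i, (s.top - (s.pos i).2 + Z) :=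
      Finset.sum_le_sum fun i _ => by linarith [s.pos_le_next N i]
    rw [Finset.sum_add_distrib, Finset.sum_const, Finset.card_univ, Fintype.card_fin,
      nsmul_eq_mul] at h1
    have h2 : (s.equalPairs : ℝ) + 1 ≤ (s.next N).equalPairs := by
      exact_mod_cast equalPairs_lt_next hw hy
    unfold potential
    linarith
  · obtain ⟨i, hi⟩ := exists_pos_eq hw
    have hi' : s.pos i ∈ s.moveSet := by rw [hi, hw]; rfl
    have h1 : ∑ j, ((s.next N).top - ((s.next N).pos j).2) ≤
        ∑ j, (s.top - (s.pos j).2 + Z - if j = i then 1 / 4 else 0) := by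
      refine Finset.sum_le_sum fun j _ => ?_
      split_ifs with hji
      · subst hji
        rw [s.next_pos_of_mem N hi', (s.mem_moveSet j).1 hi', hi]
        linarith
      · linarith [s.pos_le_next N j]
    have h3 : ∑ j, (s.top - (s.pos j).2 + Z - if j = i then (1 / 4 : ℝ) else 0) =
        ∑ j, (s.top - (s.pos j).2) + k * Z - 1 / 4 := by
      rw [Finset.sum_sub_distrib, Finset.sum_add_distrib, Finset.sum_const, Finset.card_univ,
        Fintype.card_fin, nsmul_eq_mul, Finset.sum_ite_eq' Finset.univ i,
        if_pos (Finset.mem_univ i)]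
    rw [h3] at h1
    have h2 : (s.equalPairs : ℝ) ≤ (s.next N).equalPairs := by exact_mod_cast equalPairs_le_next
    unfold potential
    linarith

theorem lowSet_finite (s : State k) (t : ℝ) : (s.lowSet t).Finite :=
  (Set.finite_range s.pos).subset fun _ h => h.1

theorem ncard_lowSet_le (s : State k) (t : ℝ) : (s.lowSet t).ncard ≤ k := by
  refine (Set.ncard_le_ncard (fun _ h => h.1) (Set.finite_range s.pos)).trans ?_
  rw [← Set.image_univ]
  exact (Set.ncard_image_le Set.finite_univ).trans (by simp [Set.ncard_univ])

/-- All paths at `w` leave it together, either onto a position already counted or above t, and the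
other positions do not change. -/
theorem ncard_lowSet_next_le (hw : s.moveSet = {w}) {t : ℝ} {m : ℕ}
    (hm : (s.lowSet t).ncard ≤ m)
    (hy : ancestor (s.visible N) w ∈ s.staySet ∨ t < (ancestor (s.visible N) w).2) :
    ((s.next N).lowSet t).ncard ≤ m - 1 := by
  have hsub : (s.next N).lowSet t ⊆ s.lowSet t \ {w} := by
    rintro _ ⟨⟨i, rfl⟩, hi⟩
    by_cases h : s.pos i ∈ s.moveSet
    · rw [s.next_pos_of_mem N h, pos_eq_of_mem hw h] at hi ⊢
      rcases hy with hy | hy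
      · refine ⟨⟨hy.1, hi⟩, fun h' => hy.2 ?_⟩
        rw [hw]
        exact h'
      · exact absurd hi (not_le.2 hy)
    · rw [s.next_pos_of_notMem N h] at hi ⊢
      exact ⟨⟨⟨i, rfl⟩, hi⟩, fun h' => h (by rw [hw]; exact h')⟩
  have h1 := Set.ncard_le_ncard hsub ((s.lowSet_finite t).sdiff)
  refine h1.trans ?_
  by_cases hwl : w ∈ s.lowSet t
  · rw [Set.ncard_sdiff_singleton_of_mem hwl]
    omega
  -- If the lowest vertex is already above t, so are all others.
  · have : s.lowSet t = ∅ := by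
      ext v
      simp only [mem_empty_iff_false, iff_false]
      rintro ⟨⟨i, rfl⟩, hi⟩
      refine hwl ⟨exists_pos_eq hw, ?_⟩
      rw [snd_eq_level hw]
      exact (s.level_le i).trans hi
    simp [this]

theorem lt_level_of_ncard_lowSet [NeZero k] {t : ℝ} (h : (s.lowSet t).ncard = 0) :
    t < s.level := by
  rw [Set.ncard_eq_zero (s.lowSet_finite t)] at h
  obtain ⟨i, hi⟩ := s.exists_mem_moveSet
  rw [← (s.mem_moveSet i).1 hi]
  by_contra h'
  have : s.pos i ∈ s.lowSet t := ⟨⟨i, rfl⟩, not_lt.1 h'⟩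
  rw [h] at this
  exact this

end State

/-! ### Measurability -/

section Measurability

variable {Ω : Type*} [MeasurableSpace Ω]

/-- A locally finite random set whose counts in Borel sets are random variables. -/
structure IsRandomPoints (N : Ω → Set Plane) : Prop where
  locallyFinite : ∀ ω, ∀ A : Set Plane, Bornology.IsBounded A → (N ω ∩ A).Finite
  measurable_count : ∀ A : Set Plane, MeasurableSet A → Measurable (count N A)

theorem IsRandomPoints.comp {Ω' : Type*} [MeasurableSpace Ω'] {N : Ω → Set Plane}
    (hN : IsRandomPoints N) {f : Ω' → Ω} (hf : Measurable f) :
    IsRandomPoints (fun ω => N (f ω)) :=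
  ⟨fun ω => hN.locallyFinite (f ω), fun A hA => (hN.measurable_count A hA).comp hf⟩

variable {N : Ω → Set Plane} {A : Set Plane}

theorem IsRandomPoints.restrict_count_apply (hN : IsRandomPoints N)
    (hAb : Bornology.IsBounded A) (ω : Ω) {E : Set Plane} (hE : MeasurableSet E) :
    (Measure.count.restrict (N ω ∩ A)) E = ((count N (A ∩ E) ω : ℕ∞) : ℝ≥0∞) := by
  have hm : MeasurableSet (E ∩ (N ω ∩ A)) :=
    (((hN.locallyFinite ω A hAb).subset inter_subset_right)).measurableSet
  rw [Measure.restrict_apply hE, Measure.count_apply hm, count,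
    show E ∩ (N ω ∩ A) = N ω ∩ (A ∩ E) by ext z; simp only [mem_inter_iff]; tauto]

/-- The counting measure of a point process on a bounded set, as a kernel. -/
def pointKernel (hN : IsRandomPoints N) (hA : MeasurableSet A) (hAb : Bornology.IsBounded A) :
    Kernel Ω Plane where
  toFun ω := Measure.count.restrict (N ω ∩ A)
  measurable' := by
    refine Measure.measurable_of_measurable_coe _ fun E hE => ?_
    simp_rw [hN.restrict_count_apply hAb _ hE]
    exact (measurable_of_countable _).comp (hN.measurable_count _ (hA.inter hE))

theorem pointKernel_apply (hN : IsRandomPoints N) (hA : MeasurableSet A)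
    (hAb : Bornology.IsBounded A) (ω : Ω) {E : Set Plane} (hE : MeasurableSet E) :
    pointKernel hN hA hAb ω E = ((count N (A ∩ E) ω : ℕ∞) : ℝ≥0∞) :=
  hN.restrict_count_apply hAb ω hE

-- The number of points is finite for each ω but not uniformly bounded; splitting according to its
-- value exhibits the kernel as a countable sum of finite kernels. This is what gives measurability
-- for ω-dependent sections.
open Classical in
instance (hN : IsRandomPoints N) (hA : MeasurableSet A) (hAb : Bornology.IsBounded A) :
    IsSFiniteKernel (pointKernel hN hA hAb) := by
  have hs : ∀ n : ℕ, MeasurableSet {ω | count N A ω = n} := fun n =>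
    hN.measurable_count A hA (measurableSet_singleton _)
  have hfin : ∀ n : ℕ, IsFiniteKernel (Kernel.piecewise (hs n) (pointKernel hN hA hAb) 0) := by
    intro n
    refine ⟨⟨n, ENNReal.natCast_lt_top n, fun ω => ?_⟩⟩
    rw [Kernel.piecewise_apply]
    split_ifs with h
    · rw [pointKernel_apply hN hA hAb ω MeasurableSet.univ, inter_univ,
        show count N A ω = n from h]
      simp
    · simp
  refine ⟨⟨fun n => Kernel.piecewise (hs n) (pointKernel hN hA hAb) 0, hfin, ?_⟩⟩
  ext ω E hE
  rw [Kernel.sum_apply' _ _ hE]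
  obtain ⟨n, hn⟩ : ∃ n : ℕ, count N A ω = n := by
    have : count N A ω ≠ ⊤ := by
      rw [count, Set.encard_ne_top_iff]
      exact hN.locallyFinite ω A hAb
    exact ⟨_, (ENat.natCast_toNat this).symm⟩
  rw [tsum_eq_single n]
  · rw [Kernel.piecewise_apply, if_pos (show ω ∈ {ω | count N A ω = n} from hn)]
  · intro m hm
    rw [Kernel.piecewise_apply, if_neg]
    · simp
    · intro (h : count N A ω = m)
      rw [hn] at h
      exact hm (by exact_mod_cast h.symm)

/-- Whether a point process hits a random measurable set is an event. -/
theorem IsRandomPoints.measurableSet_hit (hN : IsRandomPoints N) {T : Set (Ω × Plane)}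
    (hT : MeasurableSet T) : MeasurableSet {ω | ∃ z ∈ N ω, (ω, z) ∈ T} := by
  have h : ∀ n : ℕ, MeasurableSet {ω | ∃ z ∈ N ω ∩ Metric.closedBall 0 n, (ω, z) ∈ T} := by
    intro n
    have hA : MeasurableSet (Metric.closedBall (0 : Plane) n) := Metric.isClosed_closedBall.measurableSet
    have hAb : Bornology.IsBounded (Metric.closedBall (0 : Plane) n) := Metric.isBounded_closedBall
    have hm : Measurable fun ω => pointKernel hN hA hAb ω (Prod.mk ω ⁻¹' T) :=
      Kernel.measurable_kernel_prodMk_left hT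
    have : {ω | ∃ z ∈ N ω ∩ Metric.closedBall 0 n, (ω, z) ∈ T} =
        {ω | pointKernel hN hA hAb ω (Prod.mk ω ⁻¹' T) = 0}ᶜ := by
      ext ω
      have hE : MeasurableSet (Prod.mk ω ⁻¹' T) := measurable_prodMk_left hT
      simp only [mem_compl_iff, mem_ofPred_eq, pointKernel_apply hN hA hAb ω hE]
      have hz : ((count N (Metric.closedBall 0 n ∩ Prod.mk ω ⁻¹' T) ω : ℕ∞) : ℝ≥0∞) = 0 ↔
          N ω ∩ (Metric.closedBall 0 n ∩ Prod.mk ω ⁻¹' T) = ∅ := by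
        rw [count, ← Set.encard_eq_zero]
        simp
      rw [hz, ← ne_eq, ← Set.nonempty_iff_ne_empty]
      constructor
      · rintro ⟨z, ⟨h1, h2⟩, h3⟩
        exact ⟨z, h1, h2, h3⟩
      · rintro ⟨z, h1, h2, h3⟩
        exact ⟨z, ⟨h1, h2⟩, h3⟩
    rw [this]
    exact (hm (measurableSet_singleton 0)).compl
  have : {ω | ∃ z ∈ N ω, (ω, z) ∈ T} =
      ⋃ n : ℕ, {ω | ∃ z ∈ N ω ∩ Metric.closedBall 0 n, (ω, z) ∈ T} := by
    ext ω
    simp only [mem_iUnion, mem_ofPred_eq]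
    constructor
    · rintro ⟨z, h1, h2⟩
      obtain ⟨n, hn⟩ := exists_nat_ge (dist z 0)
      exact ⟨n, z, ⟨h1, hn⟩, h2⟩
    · rintro ⟨n, z, h1, h2⟩
      exact ⟨z, h1.1, h2⟩
  rw [this]
  exact MeasurableSet.iUnion h

/-- A random state: the positions are random variables and the history is a random Borel set. -/
structure IsRandomState {k : ℕ} (s : Ω → State k) : Prop where
  pos : Measurable fun ω => (s ω).pos
  hist : MeasurableSet {p : Ω × Plane | p.2 ∈ (s p.1).hist}

theorem IsRandomState.comp {Ω' : Type*} [MeasurableSpace Ω'] {k : ℕ} {s : Ω → State k}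
    (hs : IsRandomState s) {f : Ω' → Ω} (hf : Measurable f) :
    IsRandomState (fun ω => s (f ω)) :=
  ⟨hs.pos.comp hf, (hf.prodMap measurable_id) hs.hist⟩

namespace IsRandomState

variable {k : ℕ} {s : Ω → State k}

theorem measurable_pos (hs : IsRandomState s) (i : Fin k) : Measurable fun ω => (s ω).pos i :=
  (measurable_pi_apply i).comp hs.pos

theorem measurable_level (hs : IsRandomState s) : Measurable fun ω => (s ω).level :=
  Measurable.iInf fun i => (hs.measurable_pos i).snd

theorem measurableSet_mem_moveSet (hs : IsRandomState s) (i : Fin k) :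
    MeasurableSet {ω | (s ω).pos i ∈ (s ω).moveSet} := by
  simp_rw [State.mem_moveSet]
  exact measurableSet_eq_fun (hs.measurable_pos i).snd hs.measurable_level

theorem measurableSet_hit_visible (hs : IsRandomState s) (hN : IsRandomPoints N)
    {T : Set (Ω × Plane)} (hT : MeasurableSet T) :
    MeasurableSet {ω | ∃ z ∈ (s ω).visible (N ω), (ω, z) ∈ T} := by
  have h1 : MeasurableSet {ω | ∃ z ∈ N ω, (ω, z) ∈ T \ {p : Ω × Plane | p.2 ∈ (s p.1).hist}} :=
    hN.measurableSet_hit (hT.diff hs.hist)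
  have h2 : MeasurableSet (⋃ i, {ω | (ω, (s ω).pos i) ∈ T} ∩
      {ω | (s ω).pos i ∈ (s ω).moveSet}ᶜ) :=
    MeasurableSet.iUnion fun i => ((measurable_id.prodMk (hs.measurable_pos i)) hT).inter
      (hs.measurableSet_mem_moveSet i).compl
  convert h1.union h2 using 1
  ext ω
  simp only [State.visible, State.staySet, mem_union, mem_sdiff, mem_range, mem_ofPred_eq,
    mem_iUnion, mem_inter_iff, mem_compl_iff]
  constructor
  · rintro ⟨z, ⟨h, h'⟩ | ⟨⟨i, rfl⟩, h⟩, hz⟩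
    · exact Or.inl ⟨z, h, hz, h'⟩
    · exact Or.inr ⟨i, hz, h⟩
  · rintro (⟨z, h, hz, h'⟩ | ⟨i, hz, h⟩)
    · exact ⟨z, Or.inl ⟨h, h'⟩, hz⟩
    · exact ⟨_, Or.inr ⟨⟨i, rfl⟩, h⟩, hz⟩

/-- Minimality of the distance is tested at countably many radii: for every rational q, either no
visible point above is closer than q, or z is within q. -/
theorem measurableSet_isNearestAbove (hs : IsRandomState s) (hN : IsRandomPoints N) (i : Fin k) :
    ∃ T : Set (Ω × Plane), MeasurableSet T ∧ ∀ ω z,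
      IsNearestAbove ((s ω).visible (N ω)) ((s ω).pos i) z ↔
        z ∈ (s ω).visible (N ω) ∧ (ω, z) ∈ T := by
  have hp : Measurable fun p : Ω × Plane => (s p.1).pos i :=
    (hs.measurable_pos i).comp measurable_fst
  have hd : Measurable fun p : Ω × Plane => dist ((s p.1).pos i) p.2 := hp.dist measurable_snd
  have hab : MeasurableSet {p : Ω × Plane | ((s p.1).pos i).2 < p.2.2} :=
    measurableSet_lt hp.snd measurable_snd.snd
  set hit : ℚ → Set Ω := fun q => {ω | ∃ z ∈ (s ω).visible (N ω), (ω, z) ∈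
    {p : Ω × Plane | ((s p.1).pos i).2 < p.2.2} ∩
      {p : Ω × Plane | dist ((s p.1).pos i) p.2 < (q : ℝ)}} with hhit
  have hhitm : ∀ q, MeasurableSet (hit q) := fun q =>
    hs.measurableSet_hit_visible hN (hab.inter (measurableSet_lt hd measurable_const))
  refine ⟨{p : Ω × Plane | ((s p.1).pos i).2 < p.2.2} ∩ ⋂ q : ℚ,
    ((Prod.fst ⁻¹' hit q)ᶜ ∪ {p : Ω × Plane | dist ((s p.1).pos i) p.2 ≤ (q : ℝ)}),
    hab.inter (MeasurableSet.iInter fun q => (measurable_fst (hhitm q)).compl.union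
      (measurableSet_le hd measurable_const)), fun ω z => ?_⟩
  refine and_congr_right fun _ => ?_
  simp only [mem_inter_iff, mem_iInter, mem_union, mem_compl_iff, mem_preimage, mem_ofPred_eq,
    hhit]
  refine and_congr_right fun _ => ?_
  constructor
  · intro h q
    by_cases hq : ∃ z ∈ (s ω).visible (N ω), ((s ω).pos i).2 < z.2 ∧ dist ((s ω).pos i) z < q
    · obtain ⟨z', h1, h2, h3⟩ := hq
      exact Or.inr ((h z' h1 h2).trans h3.le)
    · exact Or.inl hq
  · intro h z' h1 h2
    refine le_of_forall_gt_imp_ge_of_dense fun a ha => ?_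
    obtain ⟨q, hq1, hq2⟩ := exists_rat_btwn ha
    rcases h q with h' | h'
    · exact absurd ⟨z', h1, h2, hq1⟩ h'
    · exact h'.trans hq2.le

/-- Uniqueness fails exactly when two disjoint sets of a countable basis both contain a nearest
point, which is a countable family of hitting events. -/
theorem measurableSet_existsUnique (hs : IsRandomState s) (hN : IsRandomPoints N) (i : Fin k) :
    MeasurableSet {ω | ∃! y, IsNearestAbove ((s ω).visible (N ω)) ((s ω).pos i) y} := by
  obtain ⟨T, hT, hiff⟩ := hs.measurableSet_isNearestAbove hN i
  have hhit : ∀ U : Set Plane, IsOpen U →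
      MeasurableSet {ω | ∃ z ∈ (s ω).visible (N ω), (ω, z) ∈ T ∩ Prod.snd ⁻¹' U} :=
    fun U hU => hs.measurableSet_hit_visible hN (hT.inter (measurable_snd hU.measurableSet))
  set 𝓑 := TopologicalSpace.countableBasis Plane with h𝓑
  have hb := TopologicalSpace.isBasis_countableBasis Plane
  have hc := TopologicalSpace.countable_countableBasis Plane
  have key : {ω | ∃! y, IsNearestAbove ((s ω).visible (N ω)) ((s ω).pos i) y} =
      {ω | ∃ z ∈ (s ω).visible (N ω), (ω, z) ∈ T} ∩ ⋂ U ∈ 𝓑, ⋂ V ∈ 𝓑,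
        {ω | Disjoint U V → ¬ ((∃ z ∈ (s ω).visible (N ω), (ω, z) ∈ T ∩ Prod.snd ⁻¹' U) ∧
          ∃ z ∈ (s ω).visible (N ω), (ω, z) ∈ T ∩ Prod.snd ⁻¹' V)} := by
    ext ω
    simp only [mem_inter_iff, mem_iInter, mem_ofPred_eq, hiff, mem_preimage]
    constructor
    · rintro ⟨y, ⟨h1, h2⟩, hu⟩
      refine ⟨⟨y, h1, h2⟩, fun U _ V _ hUV => ?_⟩
      rintro ⟨⟨z, hz, hzT, hzU⟩, z', hz', hzT', hzV⟩
      have e1 := hu z ⟨hz, hzT⟩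
      have e2 := hu z' ⟨hz', hzT'⟩
      rw [e1] at hzU
      rw [e2] at hzV
      exact Set.disjoint_left.1 hUV hzU hzV
    · rintro ⟨⟨y, h1, h2⟩, hu⟩
      refine ⟨y, ⟨h1, h2⟩, fun z hz => ?_⟩
      by_contra hne
      obtain ⟨U, V, hU, hV, hzU, hyV, hUV⟩ := t2_separation hne
      obtain ⟨U', hU', hzU', hUU'⟩ := hb.exists_subset_of_mem_open hzU hU
      obtain ⟨V', hV', hyV', hVV'⟩ := hb.exists_subset_of_mem_open hyV hV
      exact hu U' hU' V' hV' (hUV.mono hUU' hVV')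
        ⟨⟨z, hz.1, hz.2, hzU'⟩, y, h1, h2, hyV'⟩
  rw [key]
  refine (hs.measurableSet_hit_visible hN hT).inter
    (MeasurableSet.biInter hc fun U hU => MeasurableSet.biInter hc fun V hV => ?_)
  by_cases hUV : Disjoint U V
  · simp only [hUV, true_imp_iff]
    exact ((hhit U (hb.isOpen hU)).inter (hhit V (hb.isOpen hV))).compl
  · simp [hUV]

/-- Under uniqueness the ancestor lies in B iff some nearest point does, a hitting event; otherwise
the default value is the current position. -/
theorem measurable_ancestor (hs : IsRandomState s) (hN : IsRandomPoints N) (i : Fin k) :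
    Measurable fun ω => ancestor ((s ω).visible (N ω)) ((s ω).pos i) := by
  obtain ⟨T, hT, hiff⟩ := hs.measurableSet_isNearestAbove hN i
  have hU := hs.measurableSet_existsUnique hN i
  intro B hB
  have hhit : MeasurableSet {ω | ∃ z ∈ (s ω).visible (N ω), (ω, z) ∈ T ∩ Prod.snd ⁻¹' B} :=
    hs.measurableSet_hit_visible hN (hT.inter (measurable_snd hB))
  convert (hU.inter hhit).union (hU.compl.inter ((hs.measurable_pos i) hB)) using 1
  ext ω
  simp only [mem_preimage, mem_union, mem_inter_iff, mem_compl_iff, mem_ofPred_eq]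
  by_cases h : ∃! y, IsNearestAbove ((s ω).visible (N ω)) ((s ω).pos i) y
  · have hy := isNearestAbove_ancestor (ancestor_ne_iff.2 h)
    simp only [h, true_and, not_true_eq_false, false_and, or_false]
    constructor
    · intro h'
      exact ⟨_, hy.1, ((hiff ω _).1 hy).2, h'⟩
    · rintro ⟨z, hz, hzT, hzB⟩
      rwa [ancestor_eq h ((hiff ω z).2 ⟨hz, hzT⟩)]
  · have h' : ancestor ((s ω).visible (N ω)) ((s ω).pos i) = (s ω).pos i := by
      by_contra h'
      exact h (ancestor_ne_iff.1 h')
    simp [h, h']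

open Classical in
theorem measurable_next_pos (hs : IsRandomState s) (hN : IsRandomPoints N) (i : Fin k) :
    Measurable fun ω => ((s ω).next (N ω)).pos i :=
  Measurable.ite (hs.measurableSet_mem_moveSet i) (hs.measurable_ancestor hN i)
    (hs.measurable_pos i)

theorem next (hs : IsRandomState s) (hN : IsRandomPoints N) :
    IsRandomState fun ω => (s ω).next (N ω) := by
  have hpos : Measurable fun ω => ((s ω).next (N ω)).pos :=
    measurable_pi_lambda _ fun i => hs.measurable_next_pos hN i
  have hlev : Measurable fun ω => ((s ω).next (N ω)).level :=
    Measurable.iInf fun i => ((measurable_pi_apply i).comp hpos).snd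
  refine ⟨hpos, ?_⟩
  have h : {p : Ω × Plane | p.2 ∈ ((s p.1).next (N p.1)).hist} =
      ({p : Ω × Plane | p.2 ∈ (s p.1).hist} ∪ ⋃ i, (Prod.fst ⁻¹' {ω | (s ω).pos i ∈ (s ω).moveSet} ∩
        {p : Ω × Plane | p.2 ∈ upperBall ((s p.1).pos i)
          (dist ((s p.1).pos i) (((s p.1).next (N p.1)).pos i))})) ∩
        {p : Ω × Plane | ((s p.1).next (N p.1)).level < p.2.2} := by
    ext p
    simp only [mem_ofPred_eq, State.mem_next_hist, mem_inter_iff, mem_union, mem_iUnion,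
      mem_preimage]
  rw [h]
  refine (hs.hist.union (MeasurableSet.iUnion fun i => ?_)).inter
    (measurableSet_lt (hlev.comp measurable_fst) measurable_snd.snd)
  refine (measurable_fst (hs.measurableSet_mem_moveSet i)).inter ?_
  have h1 : Measurable fun p : Ω × Plane => (s p.1).pos i :=
    (hs.measurable_pos i).comp measurable_fst
  have h2 : Measurable fun p : Ω × Plane => ((s p.1).next (N p.1)).pos i :=
    (hs.measurable_next_pos hN i).comp measurable_fst
  have h3 : Measurable fun p : Ω × Plane => dist ((s p.1).pos i) (((s p.1).next (N p.1)).pos i) :=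
    h1.dist h2
  simp only [mem_upperBall]
  refine (measurableSet_lt ?_ h3).inter ((measurableSet_lt h1.snd measurable_snd.snd).inter
    (measurableSet_lt measurable_snd.snd (h1.snd.add h3)))
  exact (measurable_snd.fst.sub h1.fst).abs

end IsRandomState

/-- The number of distinct positions with a measurable property is a random variable. -/
theorem measurable_ncard_range {k : ℕ} {g : Ω → Fin k → Plane} (hg : Measurable g)
    {p : Ω → Plane → Prop} (hp : ∀ i, MeasurableSet {ω | p ω (g ω i)}) :
    Measurable fun ω => {v | v ∈ range (g ω) ∧ p ω v}.ncard := by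
  classical
  have hgi : ∀ i, Measurable fun ω => g ω i := fun i => (measurable_pi_apply i).comp hg
  -- Each distinct value is counted once, at the least index where it occurs.
  have h : ∀ ω, {v | v ∈ range (g ω) ∧ p ω v}.ncard =
      ∑ i, if (p ω (g ω i) ∧ ∀ j, j < i → g ω j ≠ g ω i) then 1 else 0 := by
    intro ω
    rw [← Finset.card_filter]
    have himg : {v | v ∈ range (g ω) ∧ p ω v} = ((Finset.univ.filter fun i =>
        p ω (g ω i) ∧ ∀ j, j < i → g ω j ≠ g ω i).image (g ω) : Finset Plane) := by
      ext v
      simp only [mem_ofPred_eq, Finset.coe_image, mem_image, Finset.coe_filter, Finset.mem_univ,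
        true_and]
      constructor
      · rintro ⟨⟨i, rfl⟩, hv⟩
        have hne : (Finset.univ.filter fun j => g ω j = g ω i).Nonempty := ⟨i, by simp⟩
        have hmin := Finset.min'_mem _ hne
        simp only [Finset.mem_filter, Finset.mem_univ, true_and] at hmin
        refine ⟨_, ⟨by rwa [hmin], fun j hj hj' => ?_⟩, hmin⟩
        exact absurd (Finset.min'_le _ j (by simp [hj', hmin])) (not_le.2 hj)
      · rintro ⟨i, ⟨hi, -⟩, rfl⟩
        exact ⟨⟨i, rfl⟩, hi⟩
    rw [himg, Set.ncard_coe_finset, Finset.card_image_of_injOn]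
    intro i hi j hj hij
    simp only [Finset.coe_filter, Finset.mem_univ, true_and, mem_ofPred_eq] at hi hj
    rcases lt_trichotomy i j with h | h | h
    · exact absurd hij (hj.2 i h)
    · exact h
    · exact absurd hij.symm (hi.2 j h)
  simp_rw [h]
  refine Finset.measurable_sum _ fun i _ => Measurable.ite ?_ measurable_const measurable_const
  have : {ω | p ω (g ω i) ∧ ∀ j, j < i → g ω j ≠ g ω i} =
      {ω | p ω (g ω i)} ∩ ⋂ j, ⋂ (_ : j < i), {ω | g ω j = g ω i}ᶜ := by
    ext ω; simp
  rw [this]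
  exact (hp i).inter (MeasurableSet.iInter fun j => MeasurableSet.iInter fun _ =>
    (measurableSet_eq_fun (hgi j) (hgi i)).compl)

theorem measurable_ncard_staySet {k : ℕ} {s : Ω → State k} (hs : Measurable fun ω => (s ω).pos) :
    Measurable fun ω => ((s ω).staySet.ncard : ℝ) := by
  have hi : ∀ i, Measurable fun ω => (s ω).pos i := fun i => (measurable_pi_apply i).comp hs
  have hl : Measurable fun ω => (s ω).level := Measurable.iInf fun i => (hi i).snd
  have h : ∀ ω, (s ω).staySet = {v | v ∈ range (s ω).pos ∧ (s ω).level < v.2} := by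
    intro ω
    ext v
    rw [State.mem_staySet]
    constructor
    · rintro ⟨i, rfl, h⟩; exact ⟨⟨i, rfl⟩, h⟩
    · rintro ⟨⟨i, rfl⟩, h⟩; exact ⟨i, rfl, h⟩
  simp_rw [h]
  exact (measurable_of_countable _).comp
    (measurable_ncard_range hs fun i => measurableSet_lt hl (hi i).snd)

theorem measurable_ncard_lowSet {k : ℕ} {s : Ω → State k} (hs : Measurable fun ω => (s ω).pos)
    {t : Ω → ℝ} (ht : Measurable t) : Measurable fun ω => ((s ω).lowSet (t ω)).ncard :=
  measurable_ncard_range hs fun i =>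
    measurableSet_le ((measurable_pi_apply i).comp hs).snd ht

theorem measurable_reach {k : ℕ} {s s' : Ω → State k} (hs : Measurable fun ω => (s ω).pos)
    (hs' : Measurable fun ω => (s' ω).pos) : Measurable fun ω => (s ω).reach (s' ω) := by
  classical
  have hi : ∀ i, Measurable fun ω => (s ω).pos i := fun i => (measurable_pi_apply i).comp hs
  have hi' : ∀ i, Measurable fun ω => (s' ω).pos i := fun i => (measurable_pi_apply i).comp hs'
  have hl : Measurable fun ω => (s ω).level := Measurable.iInf fun i => (hi i).snd
  exact Measurable.iSup fun i => Measurable.ite (measurableSet_eq_fun (hi i).snd hl)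
    ((hi i).snd.add ((hi i).dist (hi' i))) hl

theorem measurable_equalPairs {k : ℕ} {s : Ω → State k} (hs : Measurable fun ω => (s ω).pos) :
    Measurable fun ω => ((s ω).equalPairs : ℝ) := by
  classical
  have hi : ∀ i, Measurable fun ω => (s ω).pos i := fun i => (measurable_pi_apply i).comp hs
  refine (measurable_of_countable (fun n : ℕ => (n : ℝ))).comp ?_
  unfold State.equalPairs
  simp_rw [Finset.card_filter]
  exact Finset.measurable_sum _ fun p _ => Measurable.ite
    (measurableSet_eq_fun (hi _) (hi _)) measurable_const measurable_const

theorem measurable_potential {k : ℕ} {s : Ω → State k} (hs : Measurable fun ω => (s ω).pos)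
    (ht : Measurable fun ω => (s ω).top) : Measurable fun ω => (s ω).potential := by
  have hi : ∀ i, Measurable fun ω => (s ω).pos i := fun i => (measurable_pi_apply i).comp hs
  exact (Finset.measurable_sum _ fun i _ => ht.sub (hi i).snd).add
    ((measurable_const.sub (measurable_equalPairs hs)).const_mul _)

end Measurability

/-! ### Poisson processes -/

section Poisson

theorem count_eq_zero_iff {Ω : Type*} {N : Ω → Set Plane} {A : Set Plane} {ω : Ω} :
    count N A ω = 0 ↔ N ω ∩ A = ∅ := by
  rw [count, Set.encard_eq_zero]

theorem measurableSet_pointSigma_preimage {Ω : Type*} (N : Ω → Set Plane) {A : Set Plane}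
    (hA : MeasurableSet A) (S : Set ℕ∞) : MeasurableSet[pointSigma N] (count N A ⁻¹' S) :=
  (le_iSup₂ (f := fun (A : Set Plane) (_ : MeasurableSet A) =>
    MeasurableSpace.comap (count N A) inferInstance) A hA) _ ⟨S, MeasurableSet.of_discrete, rfl⟩

variable {Ω : Type*} [MeasurableSpace Ω] {P : Measure Ω} {lam : ℝ≥0}

theorem IsPoissonProcess.isRandomPoints {N : Ω → Set Plane} (hN : IsPoissonProcess P lam N) :
    IsRandomPoints N :=
  ⟨hN.locallyFinite, hN.measurable_count⟩

theorem IsPoissonProcess.measure_inter_eq_empty {N : Ω → Set Plane}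
    (hN : IsPoissonProcess P lam N) {A : Set Plane} (hA : MeasurableSet A)
    (hvol : volume A ≠ ∞) :
    P {ω | N ω ∩ A = ∅} = ENNReal.ofReal (Real.exp (-(lam * (volume A).toReal))) := by
  have h1 : {ω | N ω ∩ A = ∅} = count N A ⁻¹' {0} := by
    ext ω; simp [count_eq_zero_iff]
  rw [h1, ← Measure.map_apply (hN.measurable_count A hA) (measurableSet_singleton _),
    hN.law_count A hA hvol.lt_top, Measure.map_apply (by fun_prop) (measurableSet_singleton _)]
  have h2 : (fun m : ℕ => (m : ℕ∞)) ⁻¹' {0} = {0} := by ext m; simp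
  rw [h2, poissonMeasure_singleton]
  simp only [pow_zero, mul_one, Nat.factorial_zero, Nat.cast_one, div_one, NNReal.coe_mul]
  rfl

theorem IsPoissonProcess.measure_void_hit [IsProbabilityMeasure P] {N : Ω → Set Plane}
    (hN : IsPoissonProcess P lam N) {A B : Set Plane} (hA : MeasurableSet A)
    (hB : MeasurableSet B) (hvA : volume A ≠ ∞) (hvB : volume B ≠ ∞) (hAB : Disjoint A B) :
    P {ω | N ω ∩ A = ∅ ∧ (N ω ∩ B).Nonempty} =
      ENNReal.ofReal (Real.exp (-(lam * (volume A).toReal)) *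
        (1 - Real.exp (-(lam * (volume B).toReal)))) := by
  have hind := hN.indep_count 2 ![A, B] (by intro i; fin_cases i <;> simp [hA, hB]) (by
    intro i j hij
    fin_cases i <;> fin_cases j <;> simp_all [disjoint_comm])
  have h01 := hind.indepFun (show (0 : Fin 2) ≠ 1 by decide)
  simp only [Matrix.cons_val_zero, Matrix.cons_val_one] at h01
  have h := h01.measure_inter_preimage_eq_mul {0} {0}ᶜ (measurableSet_singleton _)
    (measurableSet_singleton _).compl
  have e1 : {ω | N ω ∩ A = ∅ ∧ (N ω ∩ B).Nonempty} = count N A ⁻¹' {0} ∩ count N B ⁻¹' {0}ᶜ := by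
    ext ω
    simp [count_eq_zero_iff, Set.nonempty_iff_ne_empty]
  have e2 : count N A ⁻¹' {0} = {ω | N ω ∩ A = ∅} := by
    ext ω; simp [count_eq_zero_iff]
  have e3 : count N B ⁻¹' {0}ᶜ = {ω | N ω ∩ B = ∅}ᶜ := by
    ext ω; simp [count_eq_zero_iff]
  have hm : MeasurableSet {ω | N ω ∩ B = ∅} := by
    have : {ω | N ω ∩ B = ∅} = count N B ⁻¹' {0} := by ext ω; simp [count_eq_zero_iff]
    rw [this]
    exact hN.measurable_count B hB (measurableSet_singleton _)
  rw [e1, h, e2, e3, prob_compl_eq_one_sub hm, hN.measure_inter_eq_empty hA hvA,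
    hN.measure_inter_eq_empty hB hvB, ENNReal.ofReal_mul (Real.exp_nonneg _),
    ENNReal.ofReal_sub _ (Real.exp_nonneg _), ENNReal.ofReal_one]

theorem lintegral_natCast_poissonMeasure_lt_top (r : ℝ≥0) :
    ∫⁻ n : ℕ, (n : ℝ≥0∞) ∂(poissonMeasure r) < ∞ := by
  have h : Integrable (fun n : ℕ => (n : ℝ)) (poissonMeasure r) := by
    rw [integrable_poissonMeasure_iff]
    refine Summable.of_nonneg_of_le (fun n => by positivity) (fun n => ?_)
      (Real.summable_pow_div_factorial (2 * (r : ℝ)))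
    have h1 : (n : ℝ) ≤ 2 ^ n := by exact_mod_cast Nat.lt_two_pow_self.le
    have h2 : Real.exp (-(r : ℝ)) ≤ 1 := Real.exp_le_one_iff.2 (by simp)
    rw [Real.norm_natCast, mul_pow, div_mul_eq_mul_div]
    refine div_le_div_of_nonneg_right ?_ (by positivity)
    calc Real.exp (-(r : ℝ)) * (r : ℝ) ^ n * n ≤ 1 * (r : ℝ) ^ n * 2 ^ n := by gcongr
      _ = 2 ^ n * (r : ℝ) ^ n := by ring
  have := h.lintegral_lt_top
  simpa using this

theorem IsPoissonProcess.lintegral_count_lt_top {N : Ω → Set Plane}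
    (hN : IsPoissonProcess P lam N) {A : Set Plane} (hA : MeasurableSet A)
    (hvol : volume A ≠ ∞) : ∫⁻ ω, ((count N A ω : ℕ∞) : ℝ≥0∞) ∂P < ∞ := by
  have h : ∫⁻ n : ℕ∞, (n : ℝ≥0∞) ∂(P.map (count N A)) =
      ∫⁻ ω, ((count N A ω : ℕ∞) : ℝ≥0∞) ∂P :=
    lintegral_map (measurable_of_countable _) (hN.measurable_count A hA)
  rw [← h, hN.law_count A hA hvol.lt_top, lintegral_map (measurable_of_countable _) (by fun_prop)]
  simpa using lintegral_natCast_poissonMeasure_lt_top _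

variable {N : ℕ → Ω → Set Plane}

theorem pointSigma_le {N : Ω → Set Plane} (hN : IsRandomPoints N) :
    pointSigma N ≤ ‹MeasurableSpace Ω› :=
  iSup₂_le fun A hA => (hN.measurable_count A hA).comap_le

/-- Counts of independent Poisson processes in disjoint sets are independent. -/
theorem iIndepFun_count (hN : ∀ n, IsPoissonProcess P lam (N n))
    (hind : iIndep (fun n => pointSigma (N n)) P) {d : ℕ} (m : Fin d → ℕ) {A : Fin d → Set Plane}
    (hA : ∀ i, MeasurableSet (A i)) (hd : Pairwise fun i j => Disjoint (A i) (A j)) :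
    iIndepFun (fun i => count (N (m i)) (A i)) P := by
  rw [iIndepFun_iff_measure_inter_preimage_eq_mul]
  intro S sets _
  -- The indices are grouped by the process they refer to: groups are independent by `hind`, and
  -- within a group the sets are disjoint parts of one Poisson process.
  have h1 : (⋂ i ∈ S, count (N (m i)) (A i) ⁻¹' sets i) =
      ⋂ n ∈ S.image m, ⋂ i ∈ S.filter (fun i => m i = n), count (N n) (A i) ⁻¹' sets i := by
    ext ω
    simp only [mem_iInter, Finset.mem_image, Finset.mem_filter]
    constructor
    · rintro h n - i ⟨hi, rfl⟩
      exact h i hi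
    · intro h i hi
      exact h (m i) ⟨i, hi, rfl⟩ i ⟨hi, rfl⟩
  rw [h1, hind.meas_biInter fun n _ => Finset.measurableSet_biInter _ fun i _ =>
    measurableSet_pointSigma_preimage (N n) (hA i) (sets i)]
  rw [← Finset.prod_fiberwise_of_maps_to (g := m) (t := S.image m)
    (fun i hi => Finset.mem_image_of_mem m hi)]
  refine Finset.prod_congr rfl fun n _ => ?_
  have h2 := ((hN n).indep_count d A hA hd).measure_inter_preimage_eq_mul
    (S.filter fun i => m i = n) (sets := sets) (fun i _ => MeasurableSet.of_discrete)
  rw [h2]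
  refine Finset.prod_congr rfl fun i hi => ?_
  rw [(Finset.mem_filter.1 hi).2]

/-- Almost surely no triple of points of independent Poisson processes in disjoint bounded sets
lies in a given null set. -/
theorem ae_forall_triple_of_disjoint [IsProbabilityMeasure P]
    (hN : ∀ n, IsPoissonProcess P lam (N n))
    (hind : iIndep (fun n => pointSigma (N n)) P) {E : Set (Plane × Plane × Plane)}
    (hE : MeasurableSet E) (hE0 : volume E = 0) (m₁ m₂ m₃ : ℕ) {A B C : Set Plane}
    (hA : MeasurableSet A) (hB : MeasurableSet B) (hC : MeasurableSet C)
    (hAb : Bornology.IsBounded A) (hBb : Bornology.IsBounded B) (hCb : Bornology.IsBounded C)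
    (hAB : Disjoint A B) (hAC : Disjoint A C) (hBC : Disjoint B C) :
    ∀ᵐ ω ∂P, ∀ a ∈ N m₁ ω ∩ A, ∀ b ∈ N m₂ ω ∩ B, ∀ c ∈ N m₃ ω ∩ C, (a, b, c) ∉ E := by
  have hp := fun n => (hN n).isRandomPoints
  set K₁ := pointKernel (hp m₁) hA hAb with hK₁
  set K₂ := pointKernel (hp m₂) hB hBb with hK₂
  set K₃ := pointKernel (hp m₃) hC hCb with hK₃
  have hfin : ∀ (m : ℕ) {D : Set Plane} (hD : MeasurableSet D) (hDb : Bornology.IsBounded D),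
      IsFiniteMeasure (P.bind (pointKernel (hp m) hD hDb)) := by
    intro m D hD hDb
    refine ⟨?_⟩
    rw [Measure.bind_apply MeasurableSet.univ (Kernel.aemeasurable _)]
    simp_rw [pointKernel_apply (hp m) hD hDb _ MeasurableSet.univ, inter_univ]
    exact (hN m).lintegral_count_lt_top hD hDb.measure_lt_top.ne
  -- The intensity measure ignores null sets because a Poisson variable of mean 0 vanishes almost
  -- surely.
  have hac : ∀ (m : ℕ) {D : Set Plane} (hD : MeasurableSet D) (hDb : Bornology.IsBounded D),
      P.bind (pointKernel (hp m) hD hDb) ≪ volume := by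
    intro m D hD hDb
    refine Measure.AbsolutelyContinuous.mk fun F hF hF0 => ?_
    rw [Measure.bind_apply hF (Kernel.aemeasurable _)]
    simp_rw [pointKernel_apply (hp m) hD hDb _ hF]
    have hmeas : Measurable fun ω => ((count (N m) (D ∩ F) ω : ℕ∞) : ℝ≥0∞) :=
      (measurable_of_countable _).comp ((hp m).measurable_count _ (hD.inter hF))
    rw [lintegral_eq_zero_iff hmeas]
    have hv : volume (D ∩ F) = 0 := measure_mono_null inter_subset_right hF0
    have h1 := (hN m).measure_inter_eq_empty (hD.inter hF) (by rw [hv]; simp)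
    rw [hv] at h1
    simp only [ENNReal.toReal_zero, mul_zero, neg_zero, Real.exp_zero, ENNReal.ofReal_one] at h1
    have hm : MeasurableSet {ω | N m ω ∩ (D ∩ F) = ∅} := by
      have : {ω | N m ω ∩ (D ∩ F) = ∅} = count (N m) (D ∩ F) ⁻¹' {0} := by
        ext ω; simp [count_eq_zero_iff]
      rw [this]
      exact (hp m).measurable_count _ (hD.inter hF) (measurableSet_singleton _)
    filter_upwards [(mem_ae_iff_prob_eq_one hm).2 h1] with ω hω
    have : count (N m) (D ∩ F) ω = 0 := count_eq_zero_iff.2 hω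
    simp [this]
  have := hfin m₁ hA hAb
  have := hfin m₂ hB hBb
  have := hfin m₃ hC hCb
  -- On boxes both sides are expected counts and their products; disjointness of A, B, C makes the
  -- counts independent even if some of the processes coincide.
  have hprod : (P.bind K₁).prod ((P.bind K₂).prod (P.bind K₃)) =
      P.bind (K₁ ×ₖ (K₂ ×ₖ K₃)) := by
    refine Measure.ext_prod₃ fun {s t u} hs ht hu => ?_
    rw [Measure.prod_prod, Measure.prod_prod,
      Measure.bind_apply (hs.prod (ht.prod hu)) (Kernel.aemeasurable _),
      Measure.bind_apply hs (Kernel.aemeasurable _), Measure.bind_apply ht (Kernel.aemeasurable _),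
      Measure.bind_apply hu (Kernel.aemeasurable _)]
    simp_rw [Kernel.prod_apply_prod, hK₁, hK₂, hK₃, pointKernel_apply _ _ _ _ hs,
      pointKernel_apply _ _ _ _ ht, pointKernel_apply _ _ _ _ hu]
    have hi := iIndepFun_count hN hind ![m₁, m₂, m₃] (A := ![A ∩ s, B ∩ t, C ∩ u])
      (by intro i; fin_cases i <;> simp [hA.inter hs, hB.inter ht, hC.inter hu])
      (by
        have h1 : Disjoint (A ∩ s) (B ∩ t) := hAB.mono inter_subset_left inter_subset_left
        have h2 : Disjoint (A ∩ s) (C ∩ u) := hAC.mono inter_subset_left inter_subset_left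
        have h3 : Disjoint (B ∩ t) (C ∩ u) := hBC.mono inter_subset_left inter_subset_left
        intro i j hij
        fin_cases i <;> fin_cases j <;>
          first
          | exact absurd rfl hij
          | exact h1
          | exact h2
          | exact h3
          | exact h1.symm
          | exact h2.symm
          | exact h3.symm)
    have hi' := hi.comp (fun _ (n : ℕ∞) => (n : ℝ≥0∞)) (fun _ => measurable_of_countable _)
    have h := lintegral_prod_eq_prod_lintegral_of_indepFun Finset.univ _ hi' (fun i => by
      refine (measurable_of_countable _).comp ?_
      fin_cases i
      · exact (hp m₁).measurable_count _ (hA.inter hs)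
      · exact (hp m₂).measurable_count _ (hB.inter ht)
      · exact (hp m₃).measurable_count _ (hC.inter hu))
    simp only [Fin.prod_univ_three, Function.comp_apply, Matrix.cons_val_zero,
      Matrix.cons_val_one, Matrix.cons_val] at h
    simp_rw [← mul_assoc]
    exact h.symm
  have hnull : P.bind (K₁ ×ₖ (K₂ ×ₖ K₃)) E = 0 := by
    rw [← hprod]
    exact ((hac m₁ hA hAb).prod ((hac m₂ hB hBb).prod (hac m₃ hC hCb))) hE0
  rw [Measure.bind_apply hE (Kernel.aemeasurable _),
    lintegral_eq_zero_iff (Kernel.measurable_coe _ hE)] at hnull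
  -- A triple of points in E would be an atom of the product of the counting measures, contradicting
  -- that E has measure 0 for it.
  filter_upwards [hnull] with ω hω a ha b hb c hc habc
  have h1 : (K₁ ×ₖ (K₂ ×ₖ K₃)) ω ({a} ×ˢ ({b} ×ˢ {c})) = 0 :=
    measure_mono_null (by rintro ⟨x, y, z⟩ ⟨hx, hy, hz⟩; simp only [mem_singleton_iff] at hx hy hz
                          rw [hx, hy, hz]; exact habc) hω
  have hone : ∀ (m : ℕ) {D : Set Plane} (hD : MeasurableSet D) (hDb : Bornology.IsBounded D),
      ∀ d ∈ N m ω ∩ D, pointKernel (hp m) hD hDb ω {d} ≠ 0 := by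
    intro m D hD hDb d hd
    rw [pointKernel_apply (hp m) hD hDb ω (measurableSet_singleton d)]
    have : count (N m) (D ∩ {d}) ω ≠ 0 := by
      rw [ne_eq, count_eq_zero_iff, ← ne_eq, ← Set.nonempty_iff_ne_empty]
      exact ⟨d, hd.1, hd.2, rfl⟩
    simpa using this
  rw [Kernel.prod_apply_prod, Kernel.prod_apply_prod, mul_eq_zero, mul_eq_zero] at h1
  rcases h1 with h | h | h
  · exact hone m₁ hA hAb a ha h
  · exact hone m₂ hB hBb b hb h
  · exact hone m₃ hC hCb c hc h

/-- Almost surely no triple of distinct points of independent Poisson processes lies in a given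
null set. -/
theorem ae_forall_triple [IsProbabilityMeasure P] (hN : ∀ n, IsPoissonProcess P lam (N n))
    (hind : iIndep (fun n => pointSigma (N n)) P) {E : Set (Plane × Plane × Plane)}
    (hE : MeasurableSet E) (hE0 : volume E = 0) :
    ∀ᵐ ω ∂P, ∀ a ∈ ⋃ n, N n ω, ∀ b ∈ ⋃ n, N n ω, ∀ c ∈ ⋃ n, N n ω,
      a ≠ b → a ≠ c → b ≠ c → (a, b, c) ∉ E := by
  set 𝓑 := TopologicalSpace.countableBasis Plane with h𝓑
  have hb := TopologicalSpace.isBasis_countableBasis Plane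
  have : Countable 𝓑 := TopologicalSpace.countable_countableBasis Plane
  -- Three distinct points are separated by disjoint basic open sets, cut to a large ball; only
  -- countably many choices occur.
  have key : ∀ᵐ ω ∂P, ∀ (m₁ m₂ m₃ R : ℕ) (U V W : 𝓑), Disjoint U.1 V.1 → Disjoint U.1 W.1 →
      Disjoint V.1 W.1 → ∀ a ∈ N m₁ ω ∩ (U.1 ∩ Metric.ball 0 R),
        ∀ b ∈ N m₂ ω ∩ (V.1 ∩ Metric.ball 0 R), ∀ c ∈ N m₃ ω ∩ (W.1 ∩ Metric.ball 0 R),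
          (a, b, c) ∉ E := by
    simp only [ae_all_iff]
    intro m₁ m₂ m₃ R U V W hUV hUW hVW
    have hm : ∀ U : 𝓑, MeasurableSet (U.1 ∩ Metric.ball 0 (R : ℝ)) := fun U =>
      (hb.isOpen U.2).measurableSet.inter Metric.isOpen_ball.measurableSet
    have hbd : ∀ U : 𝓑, Bornology.IsBounded (U.1 ∩ Metric.ball 0 (R : ℝ)) := fun U =>
      Metric.isBounded_ball.subset inter_subset_right
    exact ae_forall_triple_of_disjoint hN hind hE hE0 m₁ m₂ m₃ (hm U) (hm V) (hm W) (hbd U) (hbd V)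
      (hbd W) (hUV.mono inter_subset_left inter_subset_left)
      (hUW.mono inter_subset_left inter_subset_left)
      (hVW.mono inter_subset_left inter_subset_left)
  filter_upwards [key] with ω hω a ha b hb' c hc hab hac hbc
  obtain ⟨m₁, ha⟩ := mem_iUnion.1 ha
  obtain ⟨m₂, hb'⟩ := mem_iUnion.1 hb'
  obtain ⟨m₃, hc⟩ := mem_iUnion.1 hc
  obtain ⟨U₁, V₁, hU₁, hV₁, haU₁, hbV₁, hd₁⟩ := t2_separation hab
  obtain ⟨U₂, W₂, hU₂, hW₂, haU₂, hcW₂, hd₂⟩ := t2_separation hac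
  obtain ⟨V₃, W₃, hV₃, hW₃, hbV₃, hcW₃, hd₃⟩ := t2_separation hbc
  obtain ⟨U, hU, haU, hUs⟩ := hb.exists_subset_of_mem_open (mem_inter haU₁ haU₂) (hU₁.inter hU₂)
  obtain ⟨V, hV, hbV, hVs⟩ := hb.exists_subset_of_mem_open (mem_inter hbV₁ hbV₃) (hV₁.inter hV₃)
  obtain ⟨W, hW, hcW, hWs⟩ := hb.exists_subset_of_mem_open (mem_inter hcW₂ hcW₃) (hW₂.inter hW₃)
  obtain ⟨R, hR⟩ := exists_nat_gt (max (dist a 0) (max (dist b 0) (dist c 0)))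
  rw [max_lt_iff, max_lt_iff] at hR
  exact hω m₁ m₂ m₃ R ⟨U, hU⟩ ⟨V, hV⟩ ⟨W, hW⟩
    (hd₁.mono (hUs.trans inter_subset_left) (hVs.trans inter_subset_left))
    (hd₂.mono (hUs.trans inter_subset_right) (hWs.trans inter_subset_left))
    (hd₃.mono (hVs.trans inter_subset_right) (hWs.trans inter_subset_right))
    a ⟨ha, haU, hR.1⟩ b ⟨hb', hbV, hR.2.1⟩ c ⟨hc, hcW, hR.2.2⟩

end Poisson

/-! ### Trajectories in general position -/

section GeneralPosition

variable {k : ℕ}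

/-- Point sets for which the exploration process from `x` never meets a tie. -/
structure GeneralPosition (x : Fin k → Plane) (M : ℕ → Set Plane) : Prop where
  locallyFinite : ∀ n, ∀ A : Set Plane, Bornology.IsBounded A → (M n ∩ A).Finite
  exists_high : ∀ n, ∀ r : ℝ, ∃ y ∈ M n, r < y.2
  snd_ne : ∀ a ∈ ⋃ n, M n, ∀ b ∈ ⋃ n, M n, a ≠ b → a.2 ≠ b.2
  dist_ne : ∀ a ∈ ⋃ n, M n, ∀ b ∈ ⋃ n, M n, ∀ c ∈ ⋃ n, M n, a ≠ b → a ≠ c → b ≠ c →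
    dist a b ≠ dist a c
  dist_init_ne : ∀ i, ∀ b ∈ ⋃ n, M n, ∀ c ∈ ⋃ n, M n, b ≠ c → dist (x i) b ≠ dist (x i) c

theorem existsUnique_isNearestAbove {M : Set Plane} {w z₀ : Plane}
    (hM : ∀ A : Set Plane, Bornology.IsBounded A → (M ∩ A).Finite) (hz₀ : z₀ ∈ M)
    (hwz₀ : w.2 < z₀.2) (hne : ∀ y ∈ M, ∀ z ∈ M, w.2 < y.2 → w.2 < z.2 → y ≠ z →
      dist w y ≠ dist w z) : ∃! y, IsNearestAbove M w y := by
  have hfin : {z | z ∈ M ∧ w.2 < z.2 ∧ dist w z ≤ dist w z₀}.Finite := by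
    refine (hM (Metric.closedBall w (dist w z₀)) Metric.isBounded_closedBall).subset ?_
    rintro z ⟨h1, -, h2⟩
    exact ⟨h1, by rwa [Metric.mem_closedBall, dist_comm]⟩
  obtain ⟨y, hy, hmin⟩ := Set.exists_min_image _ (fun z => dist w z) hfin
    ⟨z₀, hz₀, hwz₀, le_rfl⟩
  have hyn : IsNearestAbove M w y := by
    refine ⟨hy.1, hy.2.1, fun z hz hwz => ?_⟩
    rcases le_total (dist w z) (dist w z₀) with h | h
    · exact hmin z ⟨hz, hwz, h⟩
    · exact hy.2.2.trans h
  refine ⟨y, hyn, fun y' hy' => ?_⟩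
  by_contra h
  exact hne y' hy'.1 y hyn.1 hy'.2.1 hyn.2.1 h
    (le_antisymm (hy'.2.2 y hyn.1 hyn.2.1) (hyn.2.2 y' hy'.1 hy'.2.1))

/-- A point of N above the top of the history is outside the history, hence visible; this guarantees
existence. -/
theorem State.existsUnique_isNearestAbove_visible {s : State k} {N : Set Plane}
    (h : s.WellFormed s.top)
    (hN : ∀ A : Set Plane, Bornology.IsBounded A → (N ∩ A).Finite)
    (hhigh : ∀ r : ℝ, ∃ y ∈ N, r < y.2) {w : Plane}
    (hne : ∀ y ∈ N ∪ s.staySet, ∀ z ∈ N ∪ s.staySet, w.2 < y.2 → w.2 < z.2 → y ≠ z →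
      dist w y ≠ dist w z) : ∃! y, IsNearestAbove (s.visible N) w y := by
  have hsub : s.visible N ⊆ N ∪ s.staySet := union_subset_union_left _ sdiff_subset
  obtain ⟨z₀, hz₀, hhi⟩ := hhigh (max w.2 s.top)
  rw [max_lt_iff] at hhi
  refine existsUnique_isNearestAbove (z₀ := z₀) (fun A hA => ?_)
    (Or.inl ⟨hz₀, fun h' => not_le.2 hhi.2 (h.le_top _ h')⟩) hhi.1
    fun y hy z hz => hne y (hsub hy) z (hsub hz)
  have hst : s.staySet.Finite := (Set.finite_range s.pos).subset sdiff_subset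
  refine ((hN A hA).union hst).subset ?_
  rintro z ⟨hz, hzA⟩
  rcases hsub hz with h1 | h1
  · exact Or.inl ⟨h1, hzA⟩
  · exact Or.inr h1

variable {x : Fin k → Plane} {M : ℕ → Set Plane}

/-- Time 0 is special: all paths move at once, none stays, and the starting points are not points of
the processes, so `dist_init_ne` replaces `dist_ne`. -/
theorem GeneralPosition.zero_ne (hM : GeneralPosition x M) [NeZero k]
    (hx : ∀ i i', (x i).2 = (x i').2) (i : Fin k) :
    (explore x M 1).pos i ≠ x i ∧ (explore x M 1).pos i ∈ M 0 := by
  have hl : ∀ j, (x j).2 = (explore x M 0).level := by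
    intro j
    obtain ⟨i, hi⟩ := (explore x M 0).exists_mem_moveSet
    rw [← ((explore x M 0).mem_moveSet i).1 hi]
    exact hx j i
  have hmem : ∀ j, (explore x M 0).pos j ∈ (explore x M 0).moveSet := fun j =>
    ((explore x M 0).mem_moveSet j).2 (hl j)
  have hst : (explore x M 0).staySet = ∅ := by
    ext v
    simp only [mem_empty_iff_false, iff_false]
    rintro ⟨⟨j, rfl⟩, h⟩
    exact h (hmem j)
  have hu := State.existsUnique_isNearestAbove_visible (wellFormed_explore x hx M 0)
    (hM.locallyFinite 0) (hM.exists_high 0) (w := x i) (by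
      rw [hst, union_empty]
      intro y hy z hz _ _ hyz
      exact hM.dist_init_ne i y (mem_iUnion.2 ⟨0, hy⟩) z (mem_iUnion.2 ⟨0, hz⟩) hyz)
  have hpos : (explore x M 1).pos i = ancestor ((explore x M 0).visible (M 0)) (x i) :=
    (explore x M 0).next_pos_of_mem (M 0) (hmem i)
  have hne := ancestor_ne_iff.2 hu
  refine ⟨by rwa [hpos], ?_⟩
  have h1 := (isNearestAbove_ancestor hne).1
  rw [State.visible, hst, union_empty] at h1
  rw [hpos]
  have h2 := h1.1
  rwa [State.visible, hst, union_empty]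

theorem GeneralPosition.next_ne_of_pos_mem (hM : GeneralPosition x M) [NeZero k]
    (hx : ∀ i i', (x i).2 = (x i').2) {n : ℕ} (hn : ∀ i, (explore x M n).pos i ∈ ⋃ n, M n)
    (i : Fin k) :
    ancestor ((explore x M n).visible (M n)) ((explore x M n).pos i) ≠ (explore x M n).pos i := by
  refine ancestor_ne_iff.2 (State.existsUnique_isNearestAbove_visible (wellFormed_explore x hx M n)
    (hM.locallyFinite n) (hM.exists_high n) ?_)
  have hmem : ∀ y ∈ M n ∪ (explore x M n).staySet, y ∈ ⋃ n, M n := by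
    rintro y (hy | ⟨⟨j, rfl⟩, -⟩)
    · exact mem_iUnion.2 ⟨n, hy⟩
    · exact hn j
  intro y hy z hz hwy hwz hyz
  refine hM.dist_ne _ (hn i) y (hmem y hy) z (hmem z hz) ?_ ?_ hyz
  · intro h; rw [h] at hwy; exact lt_irrefl _ hwy
  · intro h; rw [h] at hwz; exact lt_irrefl _ hwz

/-- From time 1 on every position is a point of some process, so that the conditions on distinct
process points rule out all ties, including those with stay vertices. -/
theorem GeneralPosition.pos_mem (hM : GeneralPosition x M) [NeZero k]
    (hx : ∀ i i', (x i).2 = (x i').2) (n : ℕ) (i : Fin k) :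
    (explore x M (n + 1)).pos i ∈ ⋃ n, M n := by
  induction n generalizing i with
  | zero => exact mem_iUnion.2 ⟨0, (hM.zero_ne hx i).2⟩
  | succ n ih =>
    by_cases hi : (explore x M (n + 1)).pos i ∈ (explore x M (n + 1)).moveSet
    · have h := hM.next_ne_of_pos_mem hx ih i
      have hpos : (explore x M (n + 1 + 1)).pos i = _ :=
        (explore x M (n + 1)).next_pos_of_mem (M (n + 1)) hi
      rw [hpos]
      rcases (isNearestAbove_ancestor h).1 with h1 | ⟨⟨j, hj⟩, -⟩
      · exact mem_iUnion.2 ⟨n + 1, h1.1⟩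
      · rw [← hj]; exact ih j
    · have hpos : (explore x M (n + 1 + 1)).pos i = _ :=
        (explore x M (n + 1)).next_pos_of_notMem (M (n + 1)) hi
      rw [hpos]
      exact ih i

theorem GeneralPosition.next_ne (hM : GeneralPosition x M) [NeZero k]
    (hx : ∀ i i', (x i).2 = (x i').2) {n : ℕ} (hn : n ≠ 0) {i : Fin k}
    (hi : (explore x M n).pos i ∈ (explore x M n).moveSet) :
    (explore x M (n + 1)).pos i ≠ (explore x M n).pos i := by
  obtain ⟨n, rfl⟩ := Nat.exists_eq_succ_of_ne_zero hn
  have h := hM.next_ne_of_pos_mem hx (hM.pos_mem hx n) i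
  have hpos : (explore x M (n + 1 + 1)).pos i = _ :=
    (explore x M (n + 1)).next_pos_of_mem (M (n + 1)) hi
  exact hpos ▸ h

theorem GeneralPosition.exists_moveSet_eq (hM : GeneralPosition x M) [NeZero k]
    (hx : ∀ i i', (x i).2 = (x i').2) {n : ℕ} (hn : n ≠ 0) :
    ∃ w, (explore x M n).moveSet = {w} := by
  obtain ⟨n, rfl⟩ := Nat.exists_eq_succ_of_ne_zero hn
  obtain ⟨i, hi⟩ := (explore x M (n + 1)).exists_mem_moveSet
  refine ⟨_, Set.eq_singleton_iff_unique_mem.2 ⟨hi, ?_⟩⟩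
  rintro _ ⟨⟨j, rfl⟩, hj⟩
  by_contra hne
  refine hM.snd_ne _ (hM.pos_mem hx n j) _ (hM.pos_mem hx n i) hne ?_
  rw [hj, ← ((explore x M (n + 1)).mem_moveSet i).1 hi]

variable {Ω : Type*} [MeasurableSpace Ω] {P : Measure Ω} {lam : ℝ≥0}

/-- A strip of width 1 above height q contains rectangles of arbitrarily large area m, each empty
with probability exp(-λm). -/
theorem IsPoissonProcess.ae_exists_high [IsProbabilityMeasure P] (hlam : 0 < lam)
    {N : Ω → Set Plane} (hN : IsPoissonProcess P lam N) :
    ∀ᵐ ω ∂P, ∀ r : ℝ, ∃ y ∈ N ω, r < y.2 := by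
  have h : ∀ᵐ ω ∂P, ∀ q : ℕ, ∃ y ∈ N ω, (q : ℝ) < y.2 := by
    rw [ae_all_iff]
    intro q
    rw [ae_iff]
    have hle : ∀ m : ℕ, P {ω | ¬ ∃ y ∈ N ω, (q : ℝ) < y.2} ≤
        ENNReal.ofReal (Real.exp (-(lam * m))) := by
      intro m
      have hvol : volume (Ioo (0 : ℝ) 1 ×ˢ Ioo (q : ℝ) (q + m)) = ENNReal.ofReal m := by
        rw [Measure.volume_eq_prod, Measure.prod_prod, Real.volume_Ioo, Real.volume_Ioo]
        simp
      have h1 := hN.measure_inter_eq_empty (A := Ioo (0 : ℝ) 1 ×ˢ Ioo (q : ℝ) (q + m))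
        (measurableSet_Ioo.prod measurableSet_Ioo) (by rw [hvol]; exact ENNReal.ofReal_ne_top)
      rw [hvol, ENNReal.toReal_ofReal (Nat.cast_nonneg m)] at h1
      rw [← h1]
      refine measure_mono fun ω hω => ?_
      rw [mem_ofPred_eq]
      ext y
      simp only [mem_empty_iff_false, iff_false]
      rintro ⟨hy, -, hy'⟩
      exact hω ⟨y, hy, hy'.1⟩
    have hlim : Filter.Tendsto (fun m : ℕ => ENNReal.ofReal (Real.exp (-(lam * m)))) Filter.atTop
        (nhds 0) := by
      rw [← ENNReal.ofReal_zero]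
      refine ENNReal.tendsto_ofReal (Real.tendsto_exp_neg_atTop_nhds_zero.comp ?_)
      exact tendsto_natCast_atTop_atTop.const_mul_atTop (by exact_mod_cast hlam)
    exact le_antisymm (ge_of_tendsto' hlim hle) bot_le
  filter_upwards [h] with ω hω r
  obtain ⟨q, hq⟩ := exists_nat_gt r
  obtain ⟨y, hy, hy'⟩ := hω q
  exact ⟨y, hy, hq.trans hy'⟩

theorem ae_generalPosition [IsProbabilityMeasure P] (hlam : 0 < lam)
    {N : ℕ → Ω → Set Plane} (hN : ∀ n, IsPoissonProcess P lam (N n))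
    (hind : iIndep (fun n => pointSigma (N n)) P) (x : Fin k → Plane) :
    ∀ᵐ ω ∂P, GeneralPosition x (fun n => N n ω) := by
  have hsph : ∀ (a : Plane) (r : ℝ), r ≠ 0 → volume {c : Plane | dist a c = r} = 0 := by
    intro a r hr
    have : {c : Plane | dist a c = r} = Metric.sphere a r := by
      ext c; rw [mem_ofPred_eq, Metric.mem_sphere, dist_comm]
    rw [this]
    exact Measure.addHaar_sphere_of_ne_zero _ _ hr
  have m1 : MeasurableSet {p : Plane × Plane × Plane | p.1.2 = p.2.1.2} :=
    measurableSet_eq_fun measurable_fst.snd measurable_snd.fst.snd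
  have n1 : volume {p : Plane × Plane × Plane | p.1.2 = p.2.1.2} = 0 := by
    have hl : ∀ r : ℝ, volume {b : Plane | r = b.2} = 0 := by
      intro r
      have : {b : Plane | r = b.2} = univ ×ˢ {r} := by
        ext b; simp [eq_comm]
      rw [this, Measure.volume_eq_prod, Measure.prod_prod]
      simp
    rw [Measure.volume_eq_prod, Measure.measure_prod_null m1]
    refine Filter.Eventually.of_forall fun a => ?_
    rw [Pi.zero_apply]
    have : Prod.mk a ⁻¹' {p : Plane × Plane × Plane | p.1.2 = p.2.1.2} =
        {b : Plane | a.2 = b.2} ×ˢ univ := by ext; simp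
    change volume (Prod.mk a ⁻¹' {p : Plane × Plane × Plane | p.1.2 = p.2.1.2}) = 0
    rw [this, Measure.volume_eq_prod, Measure.prod_prod, hl, zero_mul]
  have h1 := ae_forall_triple hN hind m1 n1
  -- The clause `≠ 0` restricts the fibres to spheres of nonzero radius, which are null sets; it
  -- holds automatically for distinct points.
  have m2 : MeasurableSet {p : Plane × Plane × Plane | dist p.1 p.2.1 = dist p.1 p.2.2 ∧
      dist p.1 p.2.1 ≠ 0} :=
    (measurableSet_eq_fun (measurable_fst.dist measurable_snd.fst)
      (measurable_fst.dist measurable_snd.snd)).inter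
      ((measurable_fst.dist measurable_snd.fst) (measurableSet_singleton 0)).compl
  have n2 : volume {p : Plane × Plane × Plane | dist p.1 p.2.1 = dist p.1 p.2.2 ∧
      dist p.1 p.2.1 ≠ 0} = 0 := by
    rw [Measure.volume_eq_prod, Measure.measure_prod_null m2]
    refine Filter.Eventually.of_forall fun a => ?_
    rw [Pi.zero_apply]
    have m2' := measurable_prodMk_left (x := a) m2
    rw [Measure.volume_eq_prod, Measure.measure_prod_null m2']
    refine Filter.Eventually.of_forall fun b => ?_
    rw [Pi.zero_apply]
    by_cases hab : dist a b = 0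
    · refine measure_mono_null (t := ∅) ?_ measure_empty
      intro c hc
      exact absurd hab hc.2
    · exact measure_mono_null (fun c hc => hc.1.symm) (hsph a _ hab)
  have h2 := ae_forall_triple hN hind m2 n2
  have h3 : ∀ i, ∀ᵐ ω ∂P, ∀ a ∈ ⋃ n, N n ω, ∀ b ∈ ⋃ n, N n ω, ∀ c ∈ ⋃ n, N n ω,
      a ≠ b → a ≠ c → b ≠ c → (a, b, c) ∉ {p : Plane × Plane × Plane |
        dist (x i) p.1 = dist (x i) p.2.1 ∧ dist (x i) p.1 ≠ 0} := by
    intro i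
    have m3 : MeasurableSet {p : Plane × Plane × Plane |
        dist (x i) p.1 = dist (x i) p.2.1 ∧ dist (x i) p.1 ≠ 0} :=
      (measurableSet_eq_fun (measurable_const.dist measurable_fst)
        (measurable_const.dist measurable_snd.fst)).inter
        ((measurable_const.dist measurable_fst) (measurableSet_singleton 0)).compl
    refine ae_forall_triple hN hind m3 ?_
    rw [Measure.volume_eq_prod, Measure.measure_prod_null m3]
    refine Filter.Eventually.of_forall fun a => ?_
    rw [Pi.zero_apply]
    by_cases ha : dist (x i) a = 0
    · refine measure_mono_null (t := ∅) ?_ measure_empty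
      intro c hc
      exact absurd ha hc.2
    · refine measure_mono_null (t := {b : Plane | dist (x i) b = dist (x i) a} ×ˢ univ)
        (fun c hc => ⟨hc.1.symm, mem_univ _⟩) ?_
      rw [Measure.volume_eq_prod, Measure.prod_prod, hsph _ _ ha, zero_mul]
  have h4 : ∀ᵐ ω ∂P, ∀ n, ∀ r : ℝ, ∃ y ∈ N n ω, r < y.2 :=
    ae_all_iff.2 fun n => (hN n).ae_exists_high hlam
  filter_upwards [h1, h2, ae_all_iff.2 h3, h4] with ω h1 h2 h3 h4
  -- Statements about two points follow from the one about triples by adding a dummy third point.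
  have hthird : ∀ a b : Plane, ∃ c ∈ ⋃ n, N n ω, a ≠ c ∧ b ≠ c := by
    intro a b
    obtain ⟨c, hc, hc'⟩ := h4 0 (max a.2 b.2)
    rw [max_lt_iff] at hc'
    refine ⟨c, mem_iUnion.2 ⟨0, hc⟩, ?_, ?_⟩
    · rintro rfl; exact lt_irrefl _ hc'.1
    · rintro rfl; exact lt_irrefl _ hc'.2
  refine ⟨fun n => (hN n).locallyFinite ω, h4, ?_, ?_, ?_⟩
  · intro a ha b hb hab h
    obtain ⟨c, hc, hac, hbc⟩ := hthird a b
    exact h1 a ha b hb c hc hab hac hbc h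
  · intro a ha b hb c hc hab hac hbc h
    exact h2 a ha b hb c hc hab hac hbc ⟨h, dist_ne_zero.2 hab⟩
  · intro i a ha b hb hab h
    obtain ⟨c, hc, hac, hbc⟩ := hthird a b
    by_cases h0 : dist (x i) a = 0
    · have h0' : dist (x i) b = 0 := h ▸ h0
      exact hab ((dist_eq_zero.1 h0).symm.trans (dist_eq_zero.1 h0'))
    · exact h3 i a ha b hb c hc hab hac hbc ⟨h, h0⟩

end GeneralPosition

/-! ### Estimates for one step from a fixed state -/

section OneStep

variable {Ω : Type*} [MeasurableSpace Ω] {P : Measure Ω} {lam : ℝ≥0}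

/-- An exponential moment bound from an exponential tail. -/
theorem lintegral_exp_mul_le [IsProbabilityMeasure P] {X : Ω → ℝ} (hX : Measurable X)
    (hX0 : ∀ ω, 0 ≤ X ω) {a c : ℝ} (ha : 0 < a) (hac : a < c)
    (htail : ∀ t : ℝ, 0 < t → P {ω | t < X ω} ≤ ENNReal.ofReal (Real.exp (-(c * t)))) :
    ∫⁻ ω, ENNReal.ofReal (Real.exp (a * X ω)) ∂P ≤ ENNReal.ofReal (1 + a / (c - a)) := by
  have hint : ∀ y : ℝ, ∫ t in (0 : ℝ)..y, a * Real.exp (a * t) = Real.exp (a * y) - 1 := by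
    intro y
    have hderiv : ∀ t ∈ uIcc 0 y, HasDerivAt (fun t => Real.exp (a * t)) (a * Real.exp (a * t)) t := by
      intro t _
      have h := ((hasDerivAt_id t).const_mul a).exp
      simp only [id, mul_one] at h
      rwa [mul_comm] at h
    rw [intervalIntegral.integral_eq_sub_of_hasDerivAt hderiv
      (Continuous.intervalIntegrable (by fun_prop) _ _)]
    simp
  -- The layer-cake formula for exp(aX) - 1, the integral of a·exp(at) from 0 to X.
  have h1 := lintegral_comp_eq_lintegral_meas_lt_mul P (f := X)
    (g := fun t => a * Real.exp (a * t)) (Filter.Eventually.of_forall hX0) hX.aemeasurable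
    (fun t _ => Continuous.intervalIntegrable (by fun_prop) _ _)
    (Filter.Eventually.of_forall fun t => by positivity)
  simp_rw [hint] at h1
  have h2 : ∫⁻ t in Ioi (0 : ℝ), P {ω | t < X ω} * ENNReal.ofReal (a * Real.exp (a * t)) ≤
      ∫⁻ t in Ioi (0 : ℝ), ENNReal.ofReal (a * Real.exp (-(c - a) * t)) := by
    refine setLIntegral_mono (by fun_prop) fun t ht => ?_
    calc P {ω | t < X ω} * ENNReal.ofReal (a * Real.exp (a * t))
        ≤ ENNReal.ofReal (Real.exp (-(c * t))) * ENNReal.ofReal (a * Real.exp (a * t)) := by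
          gcongr; exact htail t ht
      _ = ENNReal.ofReal (a * Real.exp (-(c - a) * t)) := by
          rw [← ENNReal.ofReal_mul (Real.exp_nonneg _)]
          congr 1
          rw [mul_left_comm, ← Real.exp_add]
          ring_nf
  have h3 : ∫⁻ t in Ioi (0 : ℝ), ENNReal.ofReal (a * Real.exp (-(c - a) * t)) =
      ENNReal.ofReal (a / (c - a)) := by
    have hi : IntegrableOn (fun t => a * Real.exp (-(c - a) * t)) (Ioi 0) :=
      (integrableOn_exp_mul_Ioi (by linarith) 0).const_mul a
    rw [← ofReal_integral_eq_lintegral_ofReal hi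
      (Filter.Eventually.of_forall fun t => by positivity), integral_const_mul,
      integral_exp_mul_Ioi (by linarith)]
    congr 1
    rw [mul_zero, Real.exp_zero, neg_div_neg_eq, mul_one_div]
  have h4 : ∀ ω, ENNReal.ofReal (Real.exp (a * X ω)) =
      1 + ENNReal.ofReal (Real.exp (a * X ω) - 1) := by
    intro ω
    have : 1 ≤ Real.exp (a * X ω) := Real.one_le_exp (mul_nonneg ha.le (hX0 ω))
    rw [← ENNReal.ofReal_one, ← ENNReal.ofReal_add zero_le_one (by linarith)]
    congr 1; ring
  simp_rw [h4]
  rw [lintegral_add_left measurable_const, h1, lintegral_const, measure_univ, mul_one,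
    ENNReal.ofReal_add zero_le_one (div_nonneg ha.le (by linarith)), ENNReal.ofReal_one]
  gcongr
  exact h2.trans h3.le

theorem volume_Ioo_prod_Ioo (a b c d : ℝ) :
    volume (Ioo a b ×ˢ Ioo c d) = ENNReal.ofReal (b - a) * ENNReal.ofReal (d - c) := by
  rw [Measure.volume_eq_prod, Measure.prod_prod, Real.volume_Ioo, Real.volume_Ioo]

theorem upperBall_eq (x : Plane) (r : ℝ) :
    upperBall x r = Ioo (x.1 - r) (x.1 + r) ×ˢ Ioo x.2 (x.2 + r) := by
  ext z
  rw [mem_upperBall, mem_prod, mem_Ioo, mem_Ioo, abs_lt]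
  constructor
  · rintro ⟨⟨h1, h2⟩, h3, h4⟩
    exact ⟨⟨by linarith, by linarith⟩, h3, h4⟩
  · rintro ⟨⟨h1, h2⟩, h3, h4⟩
    exact ⟨⟨by linarith, by linarith⟩, h3, h4⟩

theorem measurableSet_upperBall (x : Plane) (r : ℝ) : MeasurableSet (upperBall x r) := by
  rw [upperBall_eq]; exact measurableSet_Ioo.prod measurableSet_Ioo

theorem volume_upperBall (x : Plane) {r : ℝ} (hr : 0 ≤ r) :
    volume (upperBall x r) = ENNReal.ofReal (2 * r ^ 2) := by
  rw [upperBall_eq, volume_Ioo_prod_Ioo, ← ENNReal.ofReal_mul (by linarith)]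
  congr 1; ring

theorem upperBall_subset (x : Plane) {r r' : ℝ} (h : r ≤ r') : upperBall x r ⊆ upperBall x r' :=
  inter_subset_inter_left _ (Metric.ball_subset_ball h)

variable {k : ℕ} {s : State k} {w : Plane} {N : Ω → Set Plane}

theorem measurable_ancestor_const (hs : MeasurableSet s.hist) (hN : IsRandomPoints N)
    (hw : s.moveSet = {w}) : Measurable fun ω => ancestor (s.visible (N ω)) w := by
  obtain ⟨i, rfl⟩ := State.exists_pos_eq hw
  exact IsRandomState.measurable_ancestor (s := fun _ : Ω => s)
    ⟨measurable_const, measurable_snd hs⟩ hN i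

theorem isNearestAbove_dist_le {M : Set Plane} (h : ancestor M w ≠ w) {z : Plane}
    (hz : z ∈ M) (hwz : w.2 < z.2) : dist w (ancestor M w) ≤ dist w z :=
  (isNearestAbove_ancestor h).2.2 z hz hwz

theorem ancestor_mem_upperBall {M : Set Plane} (h : ancestor M w ≠ w) {z : Plane} {r : ℝ}
    (hz : z ∈ M) (hzr : z ∈ upperBall w r) : ancestor M w ∈ upperBall w r := by
  refine ⟨?_, (isNearestAbove_ancestor h).2.1⟩
  rw [Metric.mem_ball, dist_comm]
  exact (isNearestAbove_dist_le h hz (mem_upperBall.1 hzr).2.1).trans_lt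
    (dist_lt_of_mem_upperBall hzr)

/-- The tail of the exploration radius. -/
theorem measure_lt_dist_ancestor_le (hN : IsPoissonProcess P lam N) (hs : s.WellFormed s.top)
    (hw : s.moveSet = {w}) {l z : ℝ} (hl : s.top - s.level ≤ l) (hz : 0 < z) :
    P {ω | ancestor (s.visible (N ω)) w ≠ w ∧ l + z < dist w (ancestor (s.visible (N ω)) w)} ≤
      ENNReal.ofReal (Real.exp (-(2 * lam * l * z))) := by
  have hl0 : 0 ≤ l := by linarith [hs.level_le_top]
  have hwl := State.snd_eq_level hw
  -- This rectangle lies above the history and inside the half-ball of radius `l + z`, so a point in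
  -- it would bound the radius. Its area is at least 2lz, which makes the rate grow with the height
  -- of the history.
  set A : Set Plane := Ioo (w.1 - (l + z)) (w.1 + (l + z)) ×ˢ Ioo (w.2 + l) (w.2 + l + z) with hA
  have hAm : MeasurableSet A := measurableSet_Ioo.prod measurableSet_Ioo
  have hvol : volume A = ENNReal.ofReal (2 * (l + z) * z) := by
    rw [hA, volume_Ioo_prod_Ioo, ← ENNReal.ofReal_mul (by linarith)]
    congr 1; ring
  have h1 := hN.measure_inter_eq_empty hAm (by rw [hvol]; exact ENNReal.ofReal_ne_top)
  rw [hvol, ENNReal.toReal_ofReal (by positivity)] at h1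
  refine (measure_mono (t := {ω | N ω ∩ A = ∅}) ?_).trans (h1.le.trans ?_)
  · rintro ω ⟨hne, hd⟩
    rw [mem_ofPred_eq]
    ext a
    simp only [mem_empty_iff_false, iff_false]
    rintro ⟨haN, ⟨ha1, ha2⟩, ha3, ha4⟩
    have hab : a ∈ upperBall w (l + z) :=
      mem_upperBall.2 ⟨abs_lt.2 ⟨by linarith, by linarith⟩, by linarith, by linarith⟩
    have hav : a ∈ s.visible (N ω) := Or.inl ⟨haN, fun h => by
      have := hs.le_top a h
      linarith⟩
    have := dist_lt_of_mem_upperBall (ancestor_mem_upperBall hne hav hab)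
    linarith
  · refine ENNReal.ofReal_le_ofReal (Real.exp_le_exp.2 (neg_le_neg ?_))
    have : (0 : ℝ) ≤ lam * (z * z) := by positivity
    nlinarith

theorem measurableSet_void_hit (hN : IsRandomPoints N) {A B : Set Plane} (hA : MeasurableSet A)
    (hB : MeasurableSet B) : MeasurableSet {ω | N ω ∩ A = ∅ ∧ (N ω ∩ B).Nonempty} := by
  have : {ω | N ω ∩ A = ∅ ∧ (N ω ∩ B).Nonempty} = count N A ⁻¹' {0} ∩ count N B ⁻¹' {0}ᶜ := by
    ext ω
    simp [count_eq_zero_iff, Set.nonempty_iff_ne_empty]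
  rw [this]
  exact (hN.measurable_count A hA (measurableSet_singleton _)).inter
    (hN.measurable_count B hB (measurableSet_singleton _).compl)

/-- Some half-ball around the moving vertex has free area one. -/
theorem exists_volume_upperBall_diff_eq_one (hs : s.WellFormed s.top) (hw : s.moveSet = {w}) :
    ∃ r : ℝ, 1 / 2 ≤ r ∧ volume (upperBall w r \ s.hist) = 1 := by
  have hwl := State.snd_eq_level hw
  set L := s.top - s.level with hL
  have hL0 : 0 ≤ L := by linarith [hs.level_le_top]
  set R := L + 1 with hR
  have hfin : ∀ r : ℝ, volume (upperBall w r) ≠ ∞ := by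
    intro r
    rw [upperBall_eq, volume_Ioo_prod_Ioo]
    exact ENNReal.mul_ne_top ENNReal.ofReal_ne_top ENNReal.ofReal_ne_top
  have hfin' : ∀ r : ℝ, volume (upperBall w r \ s.hist) ≠ ∞ := fun r =>
    ((measure_mono sdiff_subset).trans_lt (hfin r).lt_top).ne
  set a : ℝ → ℝ := fun r => (volume (upperBall w r \ s.hist)).toReal with ha
  have hmono : ∀ r r', r ≤ r' → a r ≤ a r' := fun r r' h =>
    ENNReal.toReal_mono (hfin' r') (measure_mono (sdiff_subset_sdiff_left (upperBall_subset w h)))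
  have hinc : ∀ r r', 0 ≤ r → r ≤ r' → a r' ≤ a r + (2 * r' ^ 2 - 2 * r ^ 2) := by
    intro r r' h0 h
    have h1 : volume (upperBall w r' \ upperBall w r) = ENNReal.ofReal (2 * r' ^ 2 - 2 * r ^ 2) := by
      rw [measure_sdiff (upperBall_subset w h) (measurableSet_upperBall w r).nullMeasurableSet
        (hfin r), volume_upperBall w h0, volume_upperBall w (h0.trans h),
        ENNReal.ofReal_sub _ (by positivity)]
    have h2 : volume (upperBall w r' \ s.hist) ≤
        volume (upperBall w r \ s.hist) + volume (upperBall w r' \ upperBall w r) := by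
      refine (measure_mono ?_).trans (measure_union_le _ _)
      rintro z ⟨hz1, hz2⟩
      by_cases hz : z ∈ upperBall w r
      · exact Or.inl ⟨hz, hz2⟩
      · exact Or.inr ⟨hz1, hz⟩
    rw [h1] at h2
    have h3 := ENNReal.toReal_mono (ENNReal.add_ne_top.2 ⟨hfin' r, ENNReal.ofReal_ne_top⟩) h2
    rw [ENNReal.toReal_add (hfin' r) ENNReal.ofReal_ne_top, ENNReal.toReal_ofReal (by nlinarith)]
      at h3
    exact h3
  -- The intermediate value theorem is applied to the free area: it is at most 1/2 at radius 1/2,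
  -- and at radius `L + 1` the topmost strip of height 1 is free and has area at least 2.
  have hlip : LipschitzOnWith (Real.toNNReal (4 * R)) a (Icc (1 / 2) R) := by
    have key : ∀ r r', 1 / 2 ≤ r → r ≤ r' → r' ≤ R → |a r - a r'| ≤ 4 * R * |r - r'| := by
      intro r r' h1 h2 h3
      rw [abs_of_nonpos (by linarith [hmono r r' h2]), abs_of_nonpos (by linarith)]
      have := hinc r r' (by linarith) h2
      nlinarith
    refine LipschitzOnWith.of_dist_le_mul fun r hr r' hr' => ?_
    rw [Real.dist_eq, Real.dist_eq, Real.coe_toNNReal _ (by linarith)]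
    rcases le_total r r' with h | h
    · exact key r r' hr.1 h hr'.2
    · rw [abs_sub_comm, abs_sub_comm r]
      exact key r' r hr'.1 h hr.2
  have hlow : a (1 / 2) ≤ 1 := by
    have h1 : a (1 / 2) ≤ (volume (upperBall w (1 / 2))).toReal :=
      ENNReal.toReal_mono (hfin _) (measure_mono sdiff_subset)
    rw [volume_upperBall w (by norm_num), ENNReal.toReal_ofReal (by norm_num)] at h1
    linarith
  have hhigh : 1 ≤ a R := by
    have hsub : Ioo (w.1 - R) (w.1 + R) ×ˢ Ioo (w.2 + L) (w.2 + R) ⊆ upperBall w R \ s.hist := by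
      rintro z ⟨⟨h1, h2⟩, h3, h4⟩
      refine ⟨mem_upperBall.2 ⟨abs_lt.2 ⟨by linarith, by linarith⟩, by linarith, h4⟩, fun h => ?_⟩
      have := hs.le_top z h
      linarith
    have h1 := ENNReal.toReal_mono (hfin' R) (measure_mono hsub)
    rw [volume_Ioo_prod_Ioo, ENNReal.toReal_mul, ENNReal.toReal_ofReal (by linarith),
      ENNReal.toReal_ofReal (by linarith)] at h1
    refine le_trans ?_ h1
    nlinarith
  obtain ⟨r, hr, har⟩ := intermediate_value_Icc (by linarith) hlip.continuousOn ⟨hlow, hhigh⟩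
  refine ⟨r, hr.1, ?_⟩
  have : a r = 1 := har
  rw [← ENNReal.ofReal_toReal (hfin' r)]
  change ENNReal.ofReal (a r) = 1
  rw [this, ENNReal.ofReal_one]

/-- With a probability bounded below the moving vertex moves up by `1 / 4` or meets another path. -/
theorem exists_progress_event [IsProbabilityMeasure P] (hN : IsPoissonProcess P lam N)
    (hs : s.WellFormed s.top) (hsm : MeasurableSet s.hist) (hw : s.moveSet = {w}) :
    ∃ E : Set Ω, MeasurableSet E ∧
      ENNReal.ofReal (Real.exp (-(lam / 2)) * (1 - Real.exp (-(lam / 2)))) ≤ P E ∧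
      ∀ ω ∈ E, ancestor (s.visible (N ω)) w ≠ w →
        ancestor (s.visible (N ω)) w ∈ s.staySet ∨
          s.level + 1 / 4 ≤ (ancestor (s.visible (N ω)) w).2 := by
  obtain ⟨r, hr, hvol⟩ := exists_volume_upperBall_diff_eq_one hs hw
  have hwl := State.snd_eq_level hw
  set F := upperBall w r \ s.hist with hF
  have hFm : MeasurableSet F := (measurableSet_upperBall w r).diff hsm
  set S : Set Plane := {z | z.2 < s.level + 1 / 4} with hS
  have hSm : MeasurableSet S := measurableSet_lt measurable_snd measurable_const
  have hsum : volume (F ∩ S) + volume (F \ S) = 1 := by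
    rw [measure_inter_add_sdiff _ hSm, hvol]
  -- Shifting up by 1/4 maps the low part of F into the rest: the shifted point is still free
  -- because the history is closed downwards, and still in the half-ball because r ≥ 1/2. Hence the
  -- low part has area at most 1/2 and the rest at least 1/2.
  have hle : volume (F ∩ S) ≤ volume (F \ S) := by
    have h1 : F ∩ S ⊆ (fun z : Plane => ((0 : ℝ), (1 / 4 : ℝ)) + z) ⁻¹' (F \ S) := by
      rintro z ⟨⟨hz1, hz2⟩, hz3⟩
      rw [mem_upperBall] at hz1
      have hz4 : z.2 < s.level + 1 / 4 := hz3
      refine ⟨⟨?_, fun h => hz2 ?_⟩, ?_⟩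
      · rw [mem_upperBall]
        simp only [Prod.fst_add, Prod.snd_add, zero_add]
        exact ⟨hz1.1, by linarith, by linarith⟩
      · have := hs.down _ h z.2 (by rw [← hwl]; exact hz1.2.1) (by simp)
        simpa using this
      · simp only [hS, mem_ofPred_eq, Prod.snd_add, not_lt]
        linarith [hz1.2.1]
    refine (measure_mono h1).trans ?_
    rw [measure_preimage_add]
  have hne1 : volume (F ∩ S) ≠ ∞ := fun h => by rw [h] at hsum; simp at hsum
  have hne2 : volume (F \ S) ≠ ∞ := fun h => by rw [h] at hsum; simp at hsum
  have hsum' : (volume (F ∩ S)).toReal + (volume (F \ S)).toReal = 1 := by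
    rw [← ENNReal.toReal_add hne1 hne2, hsum, ENNReal.toReal_one]
  have hle' : (volume (F ∩ S)).toReal ≤ (volume (F \ S)).toReal := ENNReal.toReal_mono hne2 hle
  refine ⟨{ω | N ω ∩ (F ∩ S) = ∅ ∧ (N ω ∩ (F \ S)).Nonempty},
    measurableSet_void_hit hN.isRandomPoints (hFm.inter hSm) (hFm.diff hSm), ?_, ?_⟩
  · rw [hN.measure_void_hit (hFm.inter hSm) (hFm.diff hSm) hne1 hne2
      (disjoint_sdiff_right.mono_left inter_subset_right)]
    have hlam : (0 : ℝ) ≤ lam := lam.2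
    refine ENNReal.ofReal_le_ofReal (mul_le_mul (Real.exp_le_exp.2 ?_)
      (sub_le_sub_left (Real.exp_le_exp.2 ?_) 1) ?_ (Real.exp_nonneg _))
    · nlinarith
    · nlinarith
    · rw [sub_nonneg, Real.exp_le_one_iff]; linarith
  · rintro ω ⟨hvoid, z, hzN, hzF, hzS⟩ hne
    have hzv : z ∈ s.visible (N ω) := Or.inl ⟨hzN, hzF.2⟩
    have hY := ancestor_mem_upperBall hne hzv hzF.1
    rcases (isNearestAbove_ancestor hne).1 with h | h
    · right
      by_contra hlt
      have : ancestor (s.visible (N ω)) w ∈ N ω ∩ (F ∩ S) := ⟨h.1, ⟨hY, h.2⟩, not_le.1 hlt⟩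
      rw [hvoid] at this
      exact this
    · exact Or.inl h

/-- With a probability bounded below the moving vertex jumps into a given strip above the history
or meets another path before. -/
theorem exists_jump_event [IsProbabilityMeasure P] (hN : IsPoissonProcess P lam N)
    (hs : s.WellFormed s.top) (hw : s.moveSet = {w}) {u h R : ℝ}
    (hu : s.top ≤ u) (hh : 0 < h) (hR : u + h - s.level ≤ R) :
    ∃ E : Set Ω, MeasurableSet E ∧
      ENNReal.ofReal (Real.exp (-(lam * (2 * R ^ 2))) * (1 - Real.exp (-(lam * (2 * h ^ 2))))) ≤
        P E ∧
      ∀ ω ∈ E, ancestor (s.visible (N ω)) w ≠ w →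
        (ancestor (s.visible (N ω)) w ∈ s.staySet ∨ u < (ancestor (s.visible (N ω)) w).2) ∧
          s.level + dist w (ancestor (s.visible (N ω)) w) ≤ u + h := by
  have hwl := State.snd_eq_level hw
  have hlt := hs.level_le_top
  set r := u + h - s.level with hr
  have hrh : h ≤ r := by linarith
  set F := upperBall w r with hF
  have hFm : MeasurableSet F := measurableSet_upperBall w r
  -- The half-ball of radius r is cut at height u. B is free of history since u ≥ `top`; a point in
  -- B and none in A leave only stay vertices or points above u as ancestors.
  set A : Set Plane := Ioo (w.1 - r) (w.1 + r) ×ˢ Ioc s.level u with hA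
  set B : Set Plane := Ioo (w.1 - r) (w.1 + r) ×ˢ Ioo u (u + h) with hB
  have hAm : MeasurableSet A := measurableSet_Ioo.prod measurableSet_Ioc
  have hBm : MeasurableSet B := measurableSet_Ioo.prod measurableSet_Ioo
  have hvA : volume A = ENNReal.ofReal (2 * r * (u - s.level)) := by
    rw [hA, Measure.volume_eq_prod, Measure.prod_prod, Real.volume_Ioo, Real.volume_Ioc,
      ← ENNReal.ofReal_mul (by linarith)]
    congr 1; ring
  have hvB : volume B = ENNReal.ofReal (2 * r * h) := by
    rw [hB, volume_Ioo_prod_Ioo, ← ENNReal.ofReal_mul (by linarith)]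
    congr 1; ring
  have hAB : Disjoint A B := by
    rw [Set.disjoint_left]
    rintro z ⟨-, hz⟩ ⟨-, hz'⟩
    exact absurd hz.2 (not_le.2 hz'.1)
  refine ⟨{ω | N ω ∩ A = ∅ ∧ (N ω ∩ B).Nonempty},
    measurableSet_void_hit hN.isRandomPoints hAm hBm, ?_, ?_⟩
  · rw [hN.measure_void_hit hAm hBm (by rw [hvA]; exact ENNReal.ofReal_ne_top)
      (by rw [hvB]; exact ENNReal.ofReal_ne_top) hAB, hvA, hvB,
      ENNReal.toReal_ofReal (by nlinarith), ENNReal.toReal_ofReal (by nlinarith)]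
    have hlam : (0 : ℝ) ≤ lam := lam.2
    refine ENNReal.ofReal_le_ofReal (mul_le_mul (Real.exp_le_exp.2 (neg_le_neg ?_))
      (sub_le_sub_left (Real.exp_le_exp.2 (neg_le_neg ?_)) 1) ?_ (Real.exp_nonneg _))
    · refine mul_le_mul_of_nonneg_left ?_ hlam
      nlinarith
    · refine mul_le_mul_of_nonneg_left ?_ hlam
      nlinarith
    · rw [sub_nonneg, Real.exp_le_one_iff, neg_nonpos]
      positivity
  · rintro ω ⟨hvoid, z, hzN, hzB⟩ hne
    have hzb : z ∈ upperBall w r := by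
      rw [upperBall_eq, hwl]
      exact ⟨hzB.1, by linarith [hzB.2.1], by linarith [hzB.2.2]⟩
    have hzv : z ∈ s.visible (N ω) := Or.inl ⟨hzN, fun h' => by
      linarith [hs.le_top z h', hzB.2.1]⟩
    have hY := ancestor_mem_upperBall hne hzv hzb
    refine ⟨?_, by linarith [dist_lt_of_mem_upperBall hY]⟩
    rcases (isNearestAbove_ancestor hne).1 with h' | h'
    · right
      by_contra hlt'
      rw [upperBall_eq, hwl] at hY
      have : ancestor (s.visible (N ω)) w ∈ N ω ∩ A := ⟨h'.1, hY.1, hY.2.1, not_lt.1 hlt'⟩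
      rw [hvoid] at this
      exact this
    · exact Or.inl h'

/-- The lower bound for the probability of progress. -/
def progressProb (lam : ℝ≥0) : ℝ := Real.exp (-(lam / 2)) * (1 - Real.exp (-(lam / 2)))

/-- The contraction defect of the Lyapunov function. -/
def driftRate (lam : ℝ≥0) : ℝ := progressProb lam * (1 - Real.exp (-(1 / 4))) / 2

theorem progressProb_pos (hlam : 0 < lam) : 0 < progressProb lam := by
  have h : (0 : ℝ) < lam := hlam
  refine mul_pos (Real.exp_pos _) (sub_pos.2 ?_)
  rw [Real.exp_lt_one_iff]
  linarith

theorem progressProb_lt_one (lam : ℝ≥0) : progressProb lam < 1 := by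
  have h : (0 : ℝ) ≤ lam := lam.2
  have h1 : Real.exp (-((lam : ℝ) / 2)) ≤ 1 := Real.exp_le_one_iff.2 (by linarith)
  have h2 := Real.exp_pos (-((lam : ℝ) / 2))
  unfold progressProb
  nlinarith

theorem driftRate_pos (hlam : 0 < lam) : 0 < driftRate lam := by
  have h1 : Real.exp (-(1 / 4)) < 1 := Real.exp_lt_one_iff.2 (by norm_num)
  have := mul_pos (progressProb_pos hlam) (sub_pos.2 h1)
  unfold driftRate
  linarith

theorem driftRate_lt_one (hlam : 0 < lam) : driftRate lam < 1 := by
  have h0 := progressProb_pos hlam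
  have h1 := progressProb_lt_one lam
  have h2 := Real.exp_pos (-(1 / 4))
  unfold driftRate
  nlinarith

/-- The additive constant in the drift inequality. -/
def driftConst (lam : ℝ≥0) (k : ℕ) : ℝ :=
  Real.exp (k * ((k + k / driftRate lam) / (2 * lam)) + (k : ℝ) ^ 2 / 4)

open Classical in
/-- The drift inequality for the Lyapunov function, on the event that the moving vertex moves. -/
theorem lintegral_exp_potential_next_le [NeZero k] [IsProbabilityMeasure P] (hlam : 0 < lam)
    (hN : IsPoissonProcess P lam N) (hs : s.WellFormed s.top) (hsm : MeasurableSet s.hist)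
    (hw : s.moveSet = {w}) :
    ∫⁻ ω, (if ancestor (s.visible (N ω)) w ≠ w then
      ENNReal.ofReal (Real.exp (s.next (N ω)).potential) else 0) ∂P ≤
      ENNReal.ofReal ((1 - driftRate lam) * Real.exp s.potential + driftConst lam k) := by
  set ε := driftRate lam with hε
  have hε0 : 0 < ε := driftRate_pos hlam
  have hε1 : ε < 1 := driftRate_lt_one hlam
  have hlam' : (0 : ℝ) < lam := hlam
  have hk : (0 : ℝ) < k := by exact_mod_cast Nat.pos_of_ne_zero (NeZero.ne k)
  -- From l ≥ l₀ on, the rate 2λl makes the moment bound 1 + k/(2λl - k) at most 1 + ε.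
  set l₀ : ℝ := (k + k / ε) / (2 * lam) with hl₀
  set L := s.top - s.level with hL
  set l := max L l₀ with hl
  -- X is the excess of the radius over l, so the top rises by at most X + (l - L).
  set X : Ω → ℝ := fun ω => if ancestor (s.visible (N ω)) w ≠ w then
    max 0 (dist w (ancestor (s.visible (N ω)) w) - l) else 0 with hX
  have hYm := measurable_ancestor_const hsm hN.isRandomPoints hw
  have hXm : Measurable X :=
    Measurable.ite (hYm (measurableSet_singleton w)).compl
      (measurable_const.max ((measurable_const.dist hYm).sub measurable_const)) measurable_const
  have hX0 : ∀ ω, 0 ≤ X ω := by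
    intro ω
    simp only [hX]
    split_ifs
    · exact le_max_left _ _
    · exact le_rfl
  have htail : ∀ t : ℝ, 0 < t →
      P {ω | t < X ω} ≤ ENNReal.ofReal (Real.exp (-(2 * lam * l * t))) := by
    intro t ht
    refine (measure_mono ?_).trans (measure_lt_dist_ancestor_le hN hs hw (le_max_left L l₀) ht)
    intro ω hω
    simp only [hX, mem_ofPred_eq] at hω
    split_ifs at hω with h
    · refine ⟨h, ?_⟩
      rcases lt_max_iff.1 hω with h' | h'
      · linarith
      · linarith
    · linarith
  have hc : (k : ℝ) + k / ε ≤ 2 * lam * l := by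
    have h1 : l₀ ≤ l := le_max_right _ _
    have h2 : 2 * lam * l₀ = k + k / ε := by rw [hl₀]; field_simp
    have h3 : 2 * lam * l₀ ≤ 2 * lam * l := by gcongr
    linarith
  have hkε : 0 < k / ε := by positivity
  have hmom := lintegral_exp_mul_le hXm hX0 hk (by linarith : (k : ℝ) < 2 * lam * l) htail
  have hmom' : ∫⁻ ω, ENNReal.ofReal (Real.exp (k * X ω)) ∂P ≤ ENNReal.ofReal (1 + ε) := by
    refine hmom.trans (ENNReal.ofReal_le_ofReal (add_le_add_right ?_ 1))
    rw [div_le_iff₀ (by linarith)]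
    have h1 : k / ε ≤ 2 * lam * l - k := by linarith
    calc (k : ℝ) = ε * (k / ε) := by field_simp
      _ ≤ ε * (2 * lam * l - k) := by gcongr
  obtain ⟨E, hE, hPE, hEY⟩ := exists_progress_event hN hs hsm hw
  set D := Real.exp (s.potential + k * (l - L)) with hD
  set c := 1 - Real.exp (-(1 / 4)) with hcdef
  have hc0 : 0 < c := sub_pos.2 (Real.exp_lt_one_iff.2 (by norm_num))
  have hc1 : c ≤ 1 := by linarith [Real.exp_pos (-(1 / 4))]
  have hD0 : 0 < D := Real.exp_pos _
  have hlL : 0 ≤ l - L := sub_nonneg.2 (le_max_left _ _)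
  -- On the progress event E the new V carries a factor exp(-1/4) = 1 - c, and exp(kX) ≥ 1, so the
  -- amount Dc is saved there. After integration the saving is at least 2εD, against the gain εD
  -- from the moment bound.
  have hpt : ∀ ω, (if ancestor (s.visible (N ω)) w ≠ w then
      ENNReal.ofReal (Real.exp (s.next (N ω)).potential) else 0) +
      E.indicator (fun _ => ENNReal.ofReal (D * c)) ω ≤
      ENNReal.ofReal D * ENNReal.ofReal (Real.exp (k * X ω)) := by
    intro ω
    have hX1 : 1 ≤ Real.exp (k * X ω) := Real.one_le_exp (mul_nonneg hk.le (hX0 ω))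
    rw [← ENNReal.ofReal_mul hD0.le]
    by_cases hne : ancestor (s.visible (N ω)) w ≠ w
    · rw [if_pos hne]
      have hXω : X ω = max 0 (dist w (ancestor (s.visible (N ω)) w) - l) := if_pos hne
      have hZ : (s.next (N ω)).top ≤ s.top + (X ω + (l - L)) := by
        rw [(hs.next (N ω)).top_eq, State.reach_next_eq hw]
        refine max_le (by linarith [hX0 ω]) ?_
        have := le_max_right 0 (dist w (ancestor (s.visible (N ω)) w) - l)
        rw [← hXω] at this
        linarith
      by_cases hωE : ω ∈ E
      · rw [indicator_of_mem hωE, ← ENNReal.ofReal_add (Real.exp_nonneg _) (by positivity)]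
        refine ENNReal.ofReal_le_ofReal ?_
        have h1 := State.potential_next_le_sub hw hZ (hEY ω hωE hne)
        have h2 : Real.exp (s.next (N ω)).potential ≤ D * Real.exp (k * X ω) * (1 - c) := by
          have : 1 - c = Real.exp (-(1 / 4)) := by rw [hcdef]; ring
          rw [this, hD, ← Real.exp_add, ← Real.exp_add, Real.exp_le_exp]
          linarith
        nlinarith [mul_nonneg hD0.le hc0.le]
      · rw [indicator_of_notMem hωE, add_zero]
        refine ENNReal.ofReal_le_ofReal ?_
        have h1 := State.potential_next_le hZ
        rw [hD, ← Real.exp_add, Real.exp_le_exp]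
        linarith
    · rw [if_neg hne, zero_add]
      by_cases hωE : ω ∈ E
      · rw [indicator_of_mem hωE]
        refine ENNReal.ofReal_le_ofReal ?_
        nlinarith
      · rw [indicator_of_notMem hωE]; exact bot_le
  have hint := lintegral_mono (μ := P) hpt
  rw [lintegral_add_right _ (measurable_const.indicator hE), lintegral_indicator_const hE,
    lintegral_const_mul _ (by fun_prop)] at hint
  have h2 : ENNReal.ofReal (2 * ε * D) ≤ ENNReal.ofReal (D * c) * P E := by
    have : 2 * ε * D = D * c * (Real.exp (-(lam / 2)) * (1 - Real.exp (-(lam / 2)))) := by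
      rw [hε, driftRate, progressProb]; ring
    rw [this, ENNReal.ofReal_mul (by positivity)]
    gcongr
  have h3 : ENNReal.ofReal D * ∫⁻ ω, ENNReal.ofReal (Real.exp (k * X ω)) ∂P ≤
      ENNReal.ofReal (D * (1 + ε)) := by
    rw [ENNReal.ofReal_mul hD0.le]
    gcongr
  have h4 : ENNReal.ofReal (D * (1 + ε)) = ENNReal.ofReal (D * (1 - ε)) +
      ENNReal.ofReal (2 * ε * D) := by
    rw [← ENNReal.ofReal_add (mul_nonneg hD0.le (by linarith)) (by positivity)]
    congr 1; ring
  have h5 := (add_le_add_right h2 _).trans (hint.trans h3)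
  rw [h4, ENNReal.add_le_add_iff_right ENNReal.ofReal_ne_top] at h5
  refine h5.trans (ENNReal.ofReal_le_ofReal ?_)
  -- For a high history l = L and D is V itself; for a low one D is bounded by the additive
  -- constant.
  rcases le_total l₀ L with h | h
  · have : D = Real.exp s.potential := by
      rw [hD, hl, max_eq_left h, sub_self, mul_zero, add_zero]
    rw [this]
    have : 0 ≤ driftConst lam k := (Real.exp_pos _).le
    linarith
  · have hDle : D ≤ driftConst lam k := by
      rw [hD, driftConst, Real.exp_le_exp, hl, max_eq_right h]
      have := s.potential_le
      change _ ≤ k * l₀ + _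
      linarith
    have : 0 ≤ (1 - ε) * Real.exp s.potential := mul_nonneg (by linarith) (Real.exp_nonneg _)
    nlinarith

end OneStep

/-! ### The Markov property -/

section Freezing

theorem lintegral_of_indepFun {Ω Ω₁ Ω₂ : Type*} {mΩ : MeasurableSpace Ω} {m₁ : MeasurableSpace Ω₁}
    {m₂ : MeasurableSpace Ω₂} {P : Measure Ω} [IsProbabilityMeasure P] {X : Ω → Ω₁} {Y : Ω → Ω₂}
    (hX : Measurable X) (hY : Measurable Y) (hXY : IndepFun X Y P) {f : Ω₁ × Ω₂ → ℝ≥0∞}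
    (hf : Measurable f) :
    ∫⁻ ω, f (X ω, Y ω) ∂P = ∫⁻ ω, ∫⁻ ω', f (X ω, Y ω') ∂P ∂P := by
  have h1 := hXY.map_prod_eq_prod_map_map hX.aemeasurable hY.aemeasurable
  have : IsProbabilityMeasure (P.map Y) := Measure.isProbabilityMeasure_map hY.aemeasurable
  rw [← lintegral_map hf (hX.prodMk hY), h1, lintegral_prod _ hf.aemeasurable,
    lintegral_map hf.lintegral_prod_right' hX]
  refine lintegral_congr fun ω => ?_
  exact lintegral_map (hf.comp measurable_prodMk_left) hY

/-- Independence of the two σ-algebras says that the diagonal map, read in the product m₁ ⊗ m₂, has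
law P ⊗ P. -/
theorem lintegral_of_indep {Ω : Type*} {m₁ m₂ mΩ : MeasurableSpace Ω} {P : Measure Ω}
    [IsProbabilityMeasure P] (h₁ : m₁ ≤ mΩ) (h₂ : m₂ ≤ mΩ) (hind : Indep m₁ m₂ P)
    {f : Ω × Ω → ℝ≥0∞} (hf : Measurable[m₁.prod m₂] f) :
    ∫⁻ ω, f (ω, ω) ∂P = ∫⁻ ω, ∫⁻ ω', f (ω, ω') ∂P ∂P := by
  refine @lintegral_of_indepFun Ω Ω Ω mΩ m₁ m₂ P _ id id (measurable_id'' h₁) (measurable_id'' h₂)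
    ?_ f hf
  refine (IndepFun_iff_Indep (mβ := m₁) (mγ := m₂) id id P).2 ?_
  rw [MeasurableSpace.comap_id, MeasurableSpace.comap_id]
  exact hind

end Freezing

theorem IsRandomState.mono {Ω : Type*} {m₁ m₂ : MeasurableSpace Ω} {k : ℕ} {s : Ω → State k}
    (hs : @IsRandomState Ω m₁ k s) (h : m₁ ≤ m₂) : @IsRandomState Ω m₂ k s :=
  @IsRandomState.comp Ω m₁ Ω m₂ k s hs id (measurable_id'' h)

theorem IsRandomPoints.mono {Ω : Type*} {m₁ m₂ : MeasurableSpace Ω} {N : Ω → Set Plane}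
    (hN : @IsRandomPoints Ω m₁ N) (h : m₁ ≤ m₂) : @IsRandomPoints Ω m₂ N :=
  @IsRandomPoints.comp Ω m₁ Ω m₂ N hN id (measurable_id'' h)

/-- The σ-algebra generated by the point sets used in the first `n` steps. -/
@[reducible] def past {Ω : Type*} (N : ℕ → Ω → Set Plane) (n : ℕ) : MeasurableSpace Ω :=
  ⨆ m ∈ {m : ℕ | m < n}, pointSigma (N m)

theorem past_mono {Ω : Type*} (N : ℕ → Ω → Set Plane) : Monotone (past N) := by
  intro n n' h
  exact biSup_mono fun m (hm : m < n) => lt_of_lt_of_le hm h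

theorem pointSigma_le_past {Ω : Type*} (N : ℕ → Ω → Set Plane) {m n : ℕ} (h : m < n) :
    pointSigma (N m) ≤ past N n :=
  le_biSup (fun m => pointSigma (N m)) (show m ∈ {m : ℕ | m < n} from h)

/-! ### Adaptedness of the trajectory and the frozen-state argument. -/

section History

variable {Ω : Type*} {k : ℕ} {N : ℕ → Ω → Set Plane} {x : Fin k → Plane}

theorem isRandomPoints_pointSigma {N : Ω → Set Plane}
    (hN : ∀ ω, ∀ A : Set Plane, Bornology.IsBounded A → (N ω ∩ A).Finite) :
    @IsRandomPoints Ω (pointSigma N) N :=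
  @IsRandomPoints.mk Ω (pointSigma N) N hN fun _ hA S _ =>
    measurableSet_pointSigma_preimage N hA S

theorem isRandomState_explore
    (hN : ∀ n ω, ∀ A : Set Plane, Bornology.IsBounded A → (N n ω ∩ A).Finite) (n : ℕ) :
    @IsRandomState Ω (past N n) k (fun ω => explore x (fun m => N m ω) n) := by
  induction n with
  | zero =>
    refine @IsRandomState.mk Ω (past N 0) k _ ?_ ?_
    · exact @measurable_const _ _ _ (past N 0) x
    · have : {p : Ω × Plane | p.2 ∈ (explore x (fun m => N m p.1) 0).hist} = ∅ := by
        ext p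
        simp [explore]
      rw [this]
      exact @MeasurableSet.empty _ ((past N 0).prod _)
  | succ n ih =>
    exact @IsRandomState.next Ω (past N (n + 1)) (N n) k _
      (ih.mono (past_mono N n.le_succ))
      ((isRandomPoints_pointSigma (hN n)).mono (pointSigma_le_past N n.lt_succ_self))

/-- The σ-algebra is arbitrary, subject only to measurability of the positions, so that this serves
both `past` and the natural filtration of the positions. -/
theorem measurable_top_explore [NeZero k] (hx : ∀ i i', (x i).2 = (x i').2)
    {m : MeasurableSpace Ω} (n : ℕ)
    (hpos : ∀ l ≤ n, Measurable fun ω => (explore x (fun m => N m ω) l).pos) :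
    Measurable fun ω => (explore x (fun m => N m ω) n).top := by
  induction n with
  | zero =>
    simp_rw [top_explore_zero x hx]
    exact measurable_const
  | succ n ih =>
    simp_rw [top_explore_succ x hx]
    exact (ih fun l hl => hpos l (hl.trans n.le_succ)).max
      (measurable_reach (hpos n n.le_succ) (hpos (n + 1) le_rfl))

theorem measurable_level_explore {m : MeasurableSpace Ω} (n : ℕ)
    (hpos : Measurable fun ω => (explore x (fun m => N m ω) n).pos) :
    Measurable fun ω => (explore x (fun m => N m ω) n).level :=
  Measurable.iInf fun i => ((measurable_pi_apply i).comp hpos).snd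

theorem measurable_G_explore [NeZero k] (hx : ∀ i i', (x i).2 = (x i').2)
    {m : MeasurableSpace Ω} (n : ℕ)
    (hpos : ∀ l ≤ n, Measurable fun ω => (explore x (fun m => N m ω) l).pos) :
    Measurable fun ω => (explore x (fun m => N m ω) n).G := by
  have h : ∀ ω, (explore x (fun m => N m ω) n).G = (explore x (fun m => N m ω) n).top -
      (explore x (fun m => N m ω) n).level +
        2 * ((explore x (fun m => N m ω) n).staySet.ncard : ℝ) := by
    intro ω
    rw [State.G, State.top]
    ring
  simp_rw [h]
  exact ((measurable_top_explore hx n hpos).sub (measurable_level_explore n (hpos n le_rfl))).add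
    ((measurable_ncard_staySet (hpos n le_rfl)).const_mul 2)

theorem measurable_pos_explore
    (hN : ∀ n ω, ∀ A : Set Plane, Bornology.IsBounded A → (N n ω ∩ A).Finite) {l n : ℕ}
    (h : l ≤ n) : Measurable[past N n] fun ω => (explore x (fun m => N m ω) l).pos :=
  (@IsRandomState.pos Ω (past N n) k _ ((isRandomState_explore hN l).mono (past_mono N h)))

/-- All moving vertices change their position. -/
def State.Moves (s : State k) (N : Set Plane) : Prop :=
  ∀ i, s.pos i ∈ s.moveSet → (s.next N).pos i ≠ s.pos i

theorem State.moves_iff {s : State k} {M : Set Plane} {w : Plane} (hw : s.moveSet = {w}) :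
    s.Moves M ↔ ancestor (s.visible M) w ≠ w := by
  constructor
  · intro h
    obtain ⟨i, hi⟩ := State.exists_pos_eq hw
    have hi' : s.pos i ∈ s.moveSet := by rw [hw, hi]; rfl
    have := h i hi'
    rwa [s.next_pos_of_mem M hi', hi] at this
  · intro h i hi
    rw [s.next_pos_of_mem M hi, State.pos_eq_of_mem hw hi]
    exact h

variable [MeasurableSpace Ω] {P : Measure Ω} {lam : ℝ≥0}

theorem past_le (hN : ∀ n, IsPoissonProcess P lam (N n)) (n : ℕ) :
    past N n ≤ ‹MeasurableSpace Ω› :=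
  iSup₂_le fun m _ => pointSigma_le (hN m).isRandomPoints

theorem indep_past (hN : ∀ n, IsPoissonProcess P lam (N n))
    (hind : iIndep (fun n => pointSigma (N n)) P) (n : ℕ) :
    Indep (past N n) (pointSigma (N n)) P := by
  have h := indep_iSup_of_disjoint (fun m => pointSigma_le (hN m).isRandomPoints) hind
    (S := {m : ℕ | m < n}) (T := {n}) (by simp)
  rwa [iSup_singleton] at h

open Classical in
/-- The Markov property: a bound for one step from all fixed states gives a bound for the
process. -/
theorem setLIntegral_next_le [IsProbabilityMeasure P] [NeZero k] (hlam : 0 < lam)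
    (hN : ∀ n, IsPoissonProcess P lam (N n))
    (hind : iIndep (fun n => pointSigma (N n)) P) (hx : ∀ i i', (x i).2 = (x i').2)
    {n : ℕ} (hn : n ≠ 0) {B : Set Ω} (hB : MeasurableSet[past N n] B)
    {φ : Ω → State k → ℝ≥0∞} {g : Ω → ℝ≥0∞}
    (hφ : Measurable[(past N n).prod (pointSigma (N n))] fun p : Ω × Ω =>
      φ p.1 ((explore x (fun m => N m p.1) n).next (N n p.2)))
    (hg : ∀ ω ∈ B, (explore x (fun m => N m ω) n).WellFormed (explore x (fun m => N m ω) n).top →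
      MeasurableSet (explore x (fun m => N m ω) n).hist → ∀ w : Plane,
      (explore x (fun m => N m ω) n).moveSet = {w} →
      ∫⁻ ω', (if ancestor ((explore x (fun m => N m ω) n).visible (N n ω')) w ≠ w then
        φ ω ((explore x (fun m => N m ω) n).next (N n ω')) else 0) ∂P ≤ g ω) :
    ∫⁻ ω in B, φ ω (explore x (fun m => N m ω) (n + 1)) ∂P ≤ ∫⁻ ω in B, g ω ∂P := by
  set s : Ω → State k := fun ω => explore x (fun m => N m ω) n with hs
  have hlf : ∀ n ω, ∀ A : Set Plane, Bornology.IsBounded A → (N n ω ∩ A).Finite :=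
    fun n => (hN n).locallyFinite
  have hsm : @IsRandomState Ω (past N n) k s := isRandomState_explore hlf n
  have hle := past_le hN n
  have hBm : MeasurableSet B := hle B hB
  have hgp := ae_generalPosition hlam hN hind x
  -- Ties are excluded for the actual trajectory, not for a frozen state, whose stay vertices may be
  -- equidistant. The restriction to `Moves` costs nothing on the diagonal and is what the frozen
  -- bound `hg` assumes.
  set f : Ω × Ω → ℝ≥0∞ := fun p => if p.1 ∈ B ∧ (s p.1).Moves (N n p.2) then
    φ p.1 ((s p.1).next (N n p.2)) else 0 with hf
  have hfm : Measurable[(past N n).prod (pointSigma (N n))] f := by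
    let m₁ : MeasurableSpace Ω := past N n
    let m₂ : MeasurableSpace Ω := pointSigma (N n)
    have hst : @IsRandomState (Ω × Ω) (m₁.prod m₂) k (fun p => s p.1) :=
      @IsRandomState.comp Ω m₁ (Ω × Ω) (m₁.prod m₂) k s hsm Prod.fst (@measurable_fst Ω Ω m₁ m₂)
    have hNp : @IsRandomPoints (Ω × Ω) (m₁.prod m₂) (fun p => N n p.2) :=
      @IsRandomPoints.comp Ω m₂ (Ω × Ω) (m₁.prod m₂) (N n) (isRandomPoints_pointSigma (hlf n))
        Prod.snd (@measurable_snd Ω Ω m₁ m₂)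
    have hmoves : MeasurableSet[m₁.prod m₂] {p : Ω × Ω | (s p.1).Moves (N n p.2)} := by
      have : {p : Ω × Ω | (s p.1).Moves (N n p.2)} =
          ⋂ i, ({p : Ω × Ω | (s p.1).pos i ∈ (s p.1).moveSet}ᶜ ∪
            {p : Ω × Ω | ((s p.1).next (N n p.2)).pos i = (s p.1).pos i}ᶜ) := by
        ext p
        simp only [State.Moves, mem_ofPred_eq, mem_iInter, mem_union, mem_compl_iff]
        exact forall_congr' fun i => imp_iff_not_or
      rw [this]
      refine @MeasurableSet.iInter _ _ (m₁.prod m₂) _ _ fun i => ?_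
      refine @MeasurableSet.union _ (m₁.prod m₂) _ _
        (@MeasurableSet.compl _ _ (m₁.prod m₂) ?_) (@MeasurableSet.compl _ _ (m₁.prod m₂) ?_)
      · exact @IsRandomState.measurableSet_mem_moveSet (Ω × Ω) (m₁.prod m₂) k _ hst i
      · exact measurableSet_eq_fun (m := m₁.prod m₂)
          (@IsRandomState.measurable_next_pos (Ω × Ω) (m₁.prod m₂) _ k _ hst hNp i)
          (@IsRandomState.measurable_pos (Ω × Ω) (m₁.prod m₂) k _ hst i)
    have hBp : MeasurableSet[m₁.prod m₂] {p : Ω × Ω | p.1 ∈ B} := (@measurable_fst Ω Ω m₁ m₂) hB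
    exact @Measurable.ite (Ω × Ω) ℝ≥0∞ _ _ (m₁.prod m₂) _ _ _
      (@MeasurableSet.inter _ (m₁.prod m₂) _ _ hBp hmoves) hφ
      (@measurable_const _ _ _ (m₁.prod m₂) 0)
  have hfreeze := lintegral_of_indep hle (pointSigma_le (hN n).isRandomPoints)
    (indep_past hN hind n) hfm
  calc ∫⁻ ω in B, φ ω (explore x (fun m => N m ω) (n + 1)) ∂P = ∫⁻ ω, f (ω, ω) ∂P := by
        rw [← lintegral_indicator hBm]
        refine lintegral_congr_ae ?_
        filter_upwards [hgp] with ω hω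
        have hmv : (s ω).Moves (N n ω) := fun i hi => hω.next_ne hx hn hi
        by_cases hωB : ω ∈ B
        · rw [indicator_of_mem hωB]
          exact (if_pos ⟨hωB, hmv⟩).symm
        · rw [indicator_of_notMem hωB]
          exact (if_neg fun h => hωB h.1).symm
    _ = ∫⁻ ω, ∫⁻ ω', f (ω, ω') ∂P ∂P := hfreeze
    _ ≤ ∫⁻ ω, B.indicator g ω ∂P := by
        refine lintegral_mono_ae ?_
        filter_upwards [hgp] with ω hω
        by_cases hωB : ω ∈ B
        · rw [indicator_of_mem hωB]
          obtain ⟨w, hw⟩ := hω.exists_moveSet_eq hx hn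
          refine le_trans (le_of_eq ?_) (hg ω hωB (wellFormed_explore x hx _ n) ?_ w hw)
          · refine lintegral_congr fun ω' => ?_
            have hiff : (s ω).Moves (N n ω') ↔
                ancestor ((explore x (fun m => N m ω) n).visible (N n ω')) w ≠ w :=
              State.moves_iff hw
            simp only [hf, hωB, true_and, hiff]
            rfl
          · exact @measurable_prodMk_left Ω Plane (past N n) _ ω _
              (@IsRandomState.hist Ω (past N n) k s hsm)
        · rw [indicator_of_notMem hωB]
          have : ∀ ω', f (ω, ω') = 0 := fun ω' => if_neg fun h => hωB h.1
          simp [this]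
    _ = ∫⁻ ω in B, g ω ∂P := lintegral_indicator hBm _

end History

/-! ### The drift inequality along the trajectory. -/

section Drift

variable {Ω : Type*} {k : ℕ} {N : ℕ → Ω → Set Plane} {x : Fin k → Plane}

/-- The state of the exploration process at time `n`. -/
abbrev traj (x : Fin k → Plane) (N : ℕ → Ω → Set Plane) (n : ℕ) (ω : Ω) : State k :=
  explore x (fun m => N m ω) n

theorem measurable_pos_next_prod
    (hN : ∀ n ω, ∀ A : Set Plane, Bornology.IsBounded A → (N n ω ∩ A).Finite) (n : ℕ) :
    Measurable[(past N n).prod (pointSigma (N n))] fun p : Ω × Ω =>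
      ((traj x N n p.1).next (N n p.2)).pos := by
  let m₁ : MeasurableSpace Ω := past N n
  let m₂ : MeasurableSpace Ω := pointSigma (N n)
  have hst : @IsRandomState (Ω × Ω) (m₁.prod m₂) k (fun p => traj x N n p.1) :=
    @IsRandomState.comp Ω m₁ (Ω × Ω) (m₁.prod m₂) k _ (isRandomState_explore hN n) Prod.fst
      (@measurable_fst Ω Ω m₁ m₂)
  have hNp : @IsRandomPoints (Ω × Ω) (m₁.prod m₂) (fun p => N n p.2) :=
    @IsRandomPoints.comp Ω m₂ (Ω × Ω) (m₁.prod m₂) (N n) (isRandomPoints_pointSigma (hN n))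
      Prod.snd (@measurable_snd Ω Ω m₁ m₂)
  exact @IsRandomState.pos _ (m₁.prod m₂) k _
    (@IsRandomState.next (Ω × Ω) (m₁.prod m₂) _ k _ hst hNp)

theorem measurable_fst_past {β : Type*} [MeasurableSpace β] {n : ℕ} {f : Ω → β}
    (hf : Measurable[past N n] f) :
    Measurable[(past N n).prod (pointSigma (N n))] fun p : Ω × Ω => f p.1 :=
  hf.comp (@measurable_fst Ω Ω (past N n) (pointSigma (N n)))

theorem measurable_top_past [NeZero k] (hx : ∀ i i', (x i).2 = (x i').2)
    (hN : ∀ n ω, ∀ A : Set Plane, Bornology.IsBounded A → (N n ω ∩ A).Finite) (n : ℕ) :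
    Measurable[past N n] fun ω => (traj x N n ω).top :=
  measurable_top_explore (m := past N n) hx n fun _ hl => measurable_pos_explore hN hl

theorem measurable_level_past
    (hN : ∀ n ω, ∀ A : Set Plane, Bornology.IsBounded A → (N n ω ∩ A).Finite) (n : ℕ) :
    Measurable[past N n] fun ω => (traj x N n ω).level :=
  measurable_level_explore (m := past N n) n (measurable_pos_explore hN le_rfl)

theorem measurable_potential_past [NeZero k] (hx : ∀ i i', (x i).2 = (x i').2)
    (hN : ∀ n ω, ∀ A : Set Plane, Bornology.IsBounded A → (N n ω ∩ A).Finite) (n : ℕ) :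
    Measurable[past N n] fun ω => (traj x N n ω).potential :=
  @measurable_potential Ω (past N n) k _ (measurable_pos_explore hN le_rfl)
    (measurable_top_past hx hN n)

theorem measurable_max_reach {Ω : Type*} [MeasurableSpace Ω] {s s' : Ω → State k}
    (hs : Measurable fun ω => (s ω).pos) (hs' : Measurable fun ω => (s' ω).pos)
    (ht : Measurable fun ω => (s ω).top) :
    Measurable fun ω => max (s ω).top ((s ω).reach (s' ω)) :=
  ht.max (measurable_reach hs hs')

theorem measurable_top_next_prod [NeZero k] (hx : ∀ i i', (x i).2 = (x i').2)
    (hN : ∀ n ω, ∀ A : Set Plane, Bornology.IsBounded A → (N n ω ∩ A).Finite) (n : ℕ) :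
    Measurable[(past N n).prod (pointSigma (N n))] fun p : Ω × Ω =>
      ((traj x N n p.1).next (N n p.2)).top := by
  have h : ∀ p : Ω × Ω, ((traj x N n p.1).next (N n p.2)).top = max (traj x N n p.1).top
      ((traj x N n p.1).reach ((traj x N n p.1).next (N n p.2))) := fun p =>
    ((wellFormed_explore x hx _ n).next (N n p.2)).top_eq
  simp_rw [h]
  exact @measurable_max_reach k (Ω × Ω) ((past N n).prod (pointSigma (N n))) _ _
    (measurable_fst_past (measurable_pos_explore hN le_rfl)) (measurable_pos_next_prod hN n)
    (measurable_fst_past (measurable_top_past hx hN n))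

variable [MeasurableSpace Ω] {P : Measure Ω} {lam : ℝ≥0}

theorem driftConst_nonneg (lam : ℝ≥0) (k : ℕ) : 0 ≤ driftConst lam k := (Real.exp_pos _).le

theorem setLIntegral_ofReal_mul_add_const {B : Set Ω} {f : Ω → ℝ} (hf : Measurable f)
    (hf0 : ∀ ω, 0 ≤ f ω) {a b : ℝ} (ha : 0 ≤ a) (hb : 0 ≤ b) :
    ∫⁻ ω in B, ENNReal.ofReal (a * f ω + b) ∂P =
      ENNReal.ofReal a * ∫⁻ ω in B, ENNReal.ofReal (f ω) ∂P + ENNReal.ofReal b * P B := by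
  have h : ∀ ω, ENNReal.ofReal (a * f ω + b) =
      ENNReal.ofReal a * ENNReal.ofReal (f ω) + ENNReal.ofReal b := fun ω => by
    rw [ENNReal.ofReal_add (mul_nonneg ha (hf0 ω)) hb, ENNReal.ofReal_mul ha]
  simp_rw [h]
  rw [lintegral_add_right _ measurable_const, lintegral_const_mul _ (by fun_prop),
    setLIntegral_const]

/-- The drift inequality for the exploration process. -/
theorem setLIntegral_exp_potential_succ_le [IsProbabilityMeasure P] [NeZero k] (hlam : 0 < lam)
    (hN : ∀ n, IsPoissonProcess P lam (N n))
    (hind : iIndep (fun n => pointSigma (N n)) P) (hx : ∀ i i', (x i).2 = (x i').2)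
    {n : ℕ} (hn : n ≠ 0) {B : Set Ω} (hB : MeasurableSet[past N n] B) :
    ∫⁻ ω in B, ENNReal.ofReal (Real.exp (traj x N (n + 1) ω).potential) ∂P ≤
      ENNReal.ofReal (1 - driftRate lam) *
        ∫⁻ ω in B, ENNReal.ofReal (Real.exp (traj x N n ω).potential) ∂P +
      ENNReal.ofReal (driftConst lam k) * P B := by
  have hlf : ∀ n ω, ∀ A : Set Plane, Bornology.IsBounded A → (N n ω ∩ A).Finite :=
    fun n => (hN n).locallyFinite
  have hm := (measurable_potential_past hx hlf n).mono (past_le hN n) le_rfl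
  rw [← setLIntegral_ofReal_mul_add_const (by fun_prop) (fun ω => Real.exp_nonneg _)
    (by linarith [driftRate_lt_one hlam]) (driftConst_nonneg lam k)]
  refine setLIntegral_next_le hlam hN hind hx hn hB
    (φ := fun _ s => ENNReal.ofReal (Real.exp s.potential)) ?_ ?_
  · exact ENNReal.measurable_ofReal.comp (Real.measurable_exp.comp
      (@measurable_potential (Ω × Ω) ((past N n).prod (pointSigma (N n))) k _
        (measurable_pos_next_prod hlf n) (measurable_top_next_prod hx hlf n)))
  · intro ω _ hs hsm w hw
    exact lintegral_exp_potential_next_le hlam (hN n) hs hsm hw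

/-- The contraction factor is kept for the first step only and bounded by 1 afterwards, so the
additive constants simply add up. -/
theorem setLIntegral_exp_potential_add_le [IsProbabilityMeasure P] [NeZero k] (hlam : 0 < lam)
    (hN : ∀ n, IsPoissonProcess P lam (N n))
    (hind : iIndep (fun n => pointSigma (N n)) P) (hx : ∀ i i', (x i).2 = (x i').2)
    {n : ℕ} (hn : n ≠ 0) {B : Set Ω} (hB : MeasurableSet[past N n] B) (j : ℕ) :
    ∫⁻ ω in B, ENNReal.ofReal (Real.exp (traj x N (n + (j + 1)) ω).potential) ∂P ≤
      ENNReal.ofReal (1 - driftRate lam) *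
        ∫⁻ ω in B, ENNReal.ofReal (Real.exp (traj x N n ω).potential) ∂P +
      ENNReal.ofReal ((j + 1 : ℕ) * driftConst lam k) * P B := by
  induction j with
  | zero => simpa using setLIntegral_exp_potential_succ_le hlam hN hind hx hn hB
  | succ j ih =>
    have h1 := setLIntegral_exp_potential_succ_le hlam hN hind hx
      (n := n + (j + 1)) (by omega) (past_mono N (Nat.le_add_right n (j + 1)) B hB)
    have h2 : ENNReal.ofReal (1 - driftRate lam) ≤ 1 := by
      rw [← ENNReal.ofReal_one]
      exact ENNReal.ofReal_le_ofReal (by linarith [driftRate_pos hlam])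
    calc ∫⁻ ω in B, ENNReal.ofReal (Real.exp (traj x N (n + (j + 1 + 1)) ω).potential) ∂P
        ≤ ENNReal.ofReal (1 - driftRate lam) *
            ∫⁻ ω in B, ENNReal.ofReal (Real.exp (traj x N (n + (j + 1)) ω).potential) ∂P +
          ENNReal.ofReal (driftConst lam k) * P B := h1
      _ ≤ 1 * ∫⁻ ω in B, ENNReal.ofReal (Real.exp (traj x N (n + (j + 1)) ω).potential) ∂P +
          ENNReal.ofReal (driftConst lam k) * P B := by gcongr
      _ ≤ (ENNReal.ofReal (1 - driftRate lam) *
            ∫⁻ ω in B, ENNReal.ofReal (Real.exp (traj x N n ω).potential) ∂P +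
            ENNReal.ofReal ((j + 1 : ℕ) * driftConst lam k) * P B) +
          ENNReal.ofReal (driftConst lam k) * P B := by
          rw [one_mul]; gcongr
      _ = _ := by
          rw [add_assoc, ← add_mul, ← ENNReal.ofReal_add
            (mul_nonneg (Nat.cast_nonneg _) (driftConst_nonneg lam k)) (driftConst_nonneg lam k)]
          congr 4
          push_cast
          ring

end Drift

/-! ### Successful blocks have probability bounded below. -/

section Success

variable {Ω : Type*} {k : ℕ} {N : ℕ → Ω → Set Plane} {x : Fin k → Plane}

/-- After `j` favourable steps towards the height `u`: the history reaches at most `j` strips of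
height `1 / k` above `u`, and at most `k - j` positions are not above `u`. -/
def State.Climbed (u R : ℝ) (j : ℕ) (s : State k) : Prop :=
  s.top ≤ u + j * (1 / (k : ℝ)) ∧ (s.lowSet u).ncard ≤ k - j ∧ u - s.level ≤ R

/-- The lower bound for the probability of one favourable step. -/
def climbProb (lam : ℝ≥0) (k : ℕ) (R : ℝ) : ℝ :=
  Real.exp (-(lam * (2 * (R + 1 + 1) ^ 2))) * (1 - Real.exp (-(lam * (2 * (1 / (k : ℝ)) ^ 2))))

theorem climbProb_pos (lam : ℝ≥0) (hlam : 0 < lam) (k : ℕ) [NeZero k] (R : ℝ) :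
    0 < climbProb lam k R := by
  have h : (0 : ℝ) < lam := hlam
  have hk : (0 : ℝ) < k := by exact_mod_cast Nat.pos_of_ne_zero (NeZero.ne k)
  refine mul_pos (Real.exp_pos _) (sub_pos.2 ?_)
  rw [Real.exp_lt_one_iff, neg_lt_zero]
  positivity

theorem climbProb_le_one (lam : ℝ≥0) (k : ℕ) (R : ℝ) : climbProb lam k R ≤ 1 := by
  have h : (0 : ℝ) ≤ lam := lam.2
  have h1 : Real.exp (-(lam * (2 * (R + 1 + 1) ^ 2))) ≤ 1 :=
    Real.exp_le_one_iff.2 (by rw [neg_nonpos]; positivity)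
  have h2 : Real.exp (-(lam * (2 * (1 / (k : ℝ)) ^ 2))) ≤ 1 :=
    Real.exp_le_one_iff.2 (by rw [neg_nonpos]; positivity)
  have h3 := Real.exp_pos (-(lam * (2 * (1 / (k : ℝ)) ^ 2)))
  exact mul_le_one₀ h1 (sub_nonneg.2 h2) (by linarith)

/-- A successful block: at its end the history is low and the level has risen sufficiently. -/
def Success (κ : ℝ) (s s' : State k) : Prop := s'.G ≤ κ ∧ s.level + κ + 1 < s'.level

theorem measurableSet_climbed {Ω : Type*} [MeasurableSpace Ω] {s : Ω → State k}
    (hs : Measurable fun ω => (s ω).pos) (ht : Measurable fun ω => (s ω).top) {u : Ω → ℝ}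
    (hu : Measurable u) (R : ℝ) (j : ℕ) : MeasurableSet {ω | (s ω).Climbed (u ω) R j} := by
  have hl : Measurable fun ω => (s ω).level :=
    Measurable.iInf fun i => ((measurable_pi_apply i).comp hs).snd
  exact (measurableSet_le ht (hu.add_const _)).inter
    ((measurable_ncard_lowSet hs hu measurableSet_Iic).inter
      (measurableSet_le (hu.sub hl) measurable_const))

theorem measurableSet_success {Ω : Type*} [MeasurableSpace Ω] {s s' : Ω → State k}
    (hs : Measurable fun ω => (s ω).level) (hs' : Measurable fun ω => (s' ω).level)
    (hG : Measurable fun ω => (s' ω).G) (κ : ℝ) : MeasurableSet {ω | Success κ (s ω) (s' ω)} :=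
  (measurableSet_le hG measurable_const).inter
    (measurableSet_lt ((hs.add_const κ).add_const 1) hs')

theorem measurableSet_climbed_past [NeZero k] (hx : ∀ i i', (x i).2 = (x i').2)
    (hN : ∀ n ω, ∀ A : Set Plane, Bornology.IsBounded A → (N n ω ∩ A).Finite) {n : ℕ}
    {u : Ω → ℝ} (hu : Measurable[past N n] u) (R : ℝ) (j : ℕ) :
    MeasurableSet[past N n] {ω | (traj x N n ω).Climbed (u ω) R j} :=
  @measurableSet_climbed k Ω (past N n) _ (measurable_pos_explore hN le_rfl)
    (measurable_top_past hx hN n) u hu R j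

theorem measurableSet_climbed_next_prod [NeZero k] (hx : ∀ i i', (x i).2 = (x i').2)
    (hN : ∀ n ω, ∀ A : Set Plane, Bornology.IsBounded A → (N n ω ∩ A).Finite) {n : ℕ}
    {u : Ω → ℝ} (hu : Measurable[past N n] u) (R : ℝ) (j : ℕ) :
    MeasurableSet[(past N n).prod (pointSigma (N n))]
      {p : Ω × Ω | ((traj x N n p.1).next (N n p.2)).Climbed (u p.1) R j} :=
  @measurableSet_climbed k (Ω × Ω) ((past N n).prod (pointSigma (N n))) _
    (measurable_pos_next_prod hN n) (measurable_top_next_prod hx hN n) _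
    (measurable_fst_past hu) R j

theorem measurableSet_success_past [NeZero k] (hx : ∀ i i', (x i).2 = (x i').2)
    (hN : ∀ n ω, ∀ A : Set Plane, Bornology.IsBounded A → (N n ω ∩ A).Finite) (κ : ℝ) {n n' : ℕ}
    (h : n ≤ n') :
    MeasurableSet[past N n'] {ω | Success κ (traj x N n ω) (traj x N n' ω)} := by
  exact @measurableSet_success k Ω (past N n') _ _
    ((measurable_level_past hN n).mono (past_mono N h) le_rfl) (measurable_level_past hN n')
    (measurable_G_explore (m := past N n') hx n' fun l hl => measurable_pos_explore hN hl) κ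

variable [MeasurableSpace Ω] {P : Measure Ω} [IsProbabilityMeasure P] {lam : ℝ≥0}

/-- The j-th jump aims at the strip of height 1/k on top of the previous ones, which is clear of
history; all k strips fit between u and u + 1. -/
theorem exists_climb_event [NeZero k] {N : Ω → Set Plane} (hN : IsPoissonProcess P lam N)
    {s : State k} {w : Plane} (hs : s.WellFormed s.top) (hw : s.moveSet = {w}) {u R : ℝ} {j : ℕ}
    (hj : j < k) (h : s.Climbed u R j) :
    ∃ E : Set Ω, MeasurableSet E ∧ ENNReal.ofReal (climbProb lam k R) ≤ P E ∧
      ∀ ω ∈ E, ancestor (s.visible (N ω)) w ≠ w → (s.next (N ω)).Climbed u R (j + 1) := by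
  obtain ⟨h1, h2, h3⟩ := h
  have hk : (0 : ℝ) < k := by exact_mod_cast Nat.pos_of_ne_zero (NeZero.ne k)
  have hj' : ((j : ℝ) + 1) * (1 / (k : ℝ)) ≤ 1 := by
    rw [mul_one_div, div_le_one hk]
    exact_mod_cast hj
  have hj0 : 0 ≤ (j : ℝ) * (1 / (k : ℝ)) := by positivity
  obtain ⟨E, hE, hPE, hEY⟩ := exists_jump_event hN hs hw (u := u + j * (1 / (k : ℝ)))
    (h := 1 / (k : ℝ)) (R := R + 1 + 1) h1 (by positivity) (by linarith)
  refine ⟨E, hE, hPE, fun ω hω hne => ?_⟩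
  obtain ⟨h4, h5⟩ := hEY ω hω hne
  refine ⟨?_, ?_, by linarith [s.level_le_next (N ω)]⟩
  · rw [(hs.next (N ω)).top_eq, State.reach_next_eq hw]
    push_cast
    refine max_le ?_ ?_
    · have : 0 ≤ 1 / (k : ℝ) := by positivity
      linarith
    · linarith
  · rw [Nat.sub_add_eq]
    exact State.ncard_lowSet_next_le hw h2 (h4.imp_right fun h => by linarith)

theorem measure_climbed_succ_ge [NeZero k] (hlam : 0 < lam)
    (hN : ∀ n, IsPoissonProcess P lam (N n))
    (hind : iIndep (fun n => pointSigma (N n)) P) (hx : ∀ i i', (x i).2 = (x i').2)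
    {n : ℕ} (hn : n ≠ 0) {u : Ω → ℝ} (hu : Measurable[past N n] u) {R : ℝ} {j : ℕ} (hj : j < k)
    {B : Set Ω} (hB : MeasurableSet[past N n] B)
    (hBc : ∀ ω ∈ B, (traj x N n ω).Climbed (u ω) R j) :
    ENNReal.ofReal (climbProb lam k R) * P B ≤
      P (B ∩ {ω | (traj x N (n + 1) ω).Climbed (u ω) R (j + 1)}) := by
  classical
  have hlf : ∀ n ω, ∀ A : Set Plane, Bornology.IsBounded A → (N n ω ∩ A).Finite :=
    fun n => (hN n).locallyFinite
  have hBm : MeasurableSet B := past_le hN n B hB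
  set Q : Set Ω := {ω | (traj x N (n + 1) ω).Climbed (u ω) R (j + 1)} with hQ
  have hQm : MeasurableSet Q := past_le hN (n + 1) Q (measurableSet_climbed_past hx hlf
    (hu.mono (past_mono N n.le_succ) le_rfl) R (j + 1))
  -- The Markov step yields upper bounds only, so it is applied to the indicator of failure.
  have h := setLIntegral_next_le hlam hN hind hx hn hB
    (φ := fun ω s => if s.Climbed (u ω) R (j + 1) then 0 else 1)
    (g := fun _ => ENNReal.ofReal (1 - climbProb lam k R)) ?_ ?_
  · have h1 : ∫⁻ ω in B, (if (traj x N (n + 1) ω).Climbed (u ω) R (j + 1) then 0 else 1 : ℝ≥0∞) ∂P =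
        P (B \ Q) := by
      have : (fun ω => (if (traj x N (n + 1) ω).Climbed (u ω) R (j + 1) then 0 else 1 : ℝ≥0∞)) =
          Qᶜ.indicator 1 := by
        ext ω
        by_cases hω : ω ∈ Q
        · rw [indicator_of_notMem (by simpa using hω)]
          exact if_pos hω
        · rw [indicator_of_mem (by simpa using hω)]
          exact if_neg hω
      rw [this, lintegral_indicator_one hQm.compl, Measure.restrict_apply hQm.compl, sdiff_eq,
        inter_comm]
    have h' : P (B \ Q) ≤ ENNReal.ofReal (1 - climbProb lam k R) * P B := by
      rw [← h1, ← setLIntegral_const]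
      exact h
    have hp0 : 0 ≤ climbProb lam k R := (climbProb_pos lam hlam k R).le
    have hp1 := climbProb_le_one lam k R
    have h2 : ENNReal.ofReal (climbProb lam k R) * P B +
        ENNReal.ofReal (1 - climbProb lam k R) * P B = P B := by
      rw [← add_mul, ← ENNReal.ofReal_add hp0 (by linarith)]
      simp
    have h3 : ENNReal.ofReal (1 - climbProb lam k R) * P B ≠ ∞ :=
      ENNReal.mul_ne_top ENNReal.ofReal_ne_top (measure_ne_top _ _)
    rw [← ENNReal.add_le_add_iff_right h3, h2]
    exact (measure_inter_add_sdiff B hQm).symm.le.trans (by gcongr)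
  · exact @Measurable.ite (Ω × Ω) ℝ≥0∞ _ _ ((past N n).prod (pointSigma (N n))) _ _ _
      (measurableSet_climbed_next_prod hx hlf hu R (j + 1))
      (@measurable_const _ _ _ ((past N n).prod (pointSigma (N n))) 0)
      (@measurable_const _ _ _ ((past N n).prod (pointSigma (N n))) 1)
  · intro ω hω hs _ w hw
    obtain ⟨E, hE, hPE, hEY⟩ := exists_climb_event (hN n) hs hw hj (hBc ω hω)
    calc ∫⁻ ω', (if ancestor ((explore x (fun m => N m ω) n).visible (N n ω')) w ≠ w then
          (if ((explore x (fun m => N m ω) n).next (N n ω')).Climbed (u ω) R (j + 1) then 0 else 1)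
          else 0 : ℝ≥0∞) ∂P
        ≤ ∫⁻ ω', Eᶜ.indicator 1 ω' ∂P := by
          refine lintegral_mono fun ω' => ?_
          by_cases hωE : ω' ∈ E
          · rw [indicator_of_notMem (by simpa using hωE)]
            split_ifs with h1 h2
            · exact le_rfl
            · exact absurd (hEY ω' hωE h1) h2
            · exact le_rfl
          · rw [indicator_of_mem (by simpa using hωE)]
            split_ifs
            · exact zero_le_one
            · exact le_rfl
            · exact zero_le_one
      _ = 1 - P E := by
          rw [lintegral_indicator_one hE.compl, prob_compl_eq_one_sub hE]
      _ ≤ ENNReal.ofReal (1 - climbProb lam k R) := by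
          rw [ENNReal.ofReal_sub _ (climbProb_pos lam hlam k R).le, ENNReal.ofReal_one]
          exact tsub_le_tsub_left hPE 1

theorem measure_climbed_ge [NeZero k] (hlam : 0 < lam)
    (hN : ∀ n, IsPoissonProcess P lam (N n))
    (hind : iIndep (fun n => pointSigma (N n)) P) (hx : ∀ i i', (x i).2 = (x i').2)
    {n : ℕ} (hn : n ≠ 0) {u : Ω → ℝ} (hu : Measurable[past N n] u) {R : ℝ}
    {B : Set Ω} (hB : MeasurableSet[past N n] B)
    (hBc : ∀ ω ∈ B, (traj x N n ω).Climbed (u ω) R 0) {j : ℕ} (hj : j ≤ k) :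
    ENNReal.ofReal (climbProb lam k R ^ j) * P B ≤
      P (B ∩ {ω | (traj x N (n + j) ω).Climbed (u ω) R j}) := by
  have hlf : ∀ n ω, ∀ A : Set Plane, Bornology.IsBounded A → (N n ω ∩ A).Finite :=
    fun n => (hN n).locallyFinite
  have hp0 : 0 ≤ climbProb lam k R := (climbProb_pos lam hlam k R).le
  induction j with
  | zero =>
    rw [pow_zero, ENNReal.ofReal_one, one_mul]
    exact measure_mono fun ω hω => ⟨hω, hBc ω hω⟩
  | succ j ih =>
    have hpm := past_mono N (Nat.le_add_right n j)
    have hu' : Measurable[past N (n + j)] u := hu.mono hpm le_rfl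
    have h := measure_climbed_succ_ge hlam hN hind hx (n := n + j) (by omega) hu'
      (R := R) (j := j) (by omega)
      (@MeasurableSet.inter _ (past N (n + j)) _ _ (hpm B hB)
        (measurableSet_climbed_past hx hlf hu' R j)) (fun ω hω => hω.2)
    calc ENNReal.ofReal (climbProb lam k R ^ (j + 1)) * P B
        = ENNReal.ofReal (climbProb lam k R) * (ENNReal.ofReal (climbProb lam k R ^ j) * P B) := by
          rw [pow_succ', ENNReal.ofReal_mul hp0, mul_assoc]
      _ ≤ ENNReal.ofReal (climbProb lam k R) *
          P (B ∩ {ω | (traj x N (n + j) ω).Climbed (u ω) R j}) := by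
          gcongr
          exact ih (by omega)
      _ ≤ _ := h
      _ ≤ _ := by
          refine measure_mono ?_
          rintro ω ⟨⟨h1, -⟩, h2⟩
          exact ⟨h1, h2⟩

/-- From states with bounded history a block is successful with a probability bounded below. -/
theorem measure_success_ge [NeZero k] (hlam : 0 < lam)
    (hN : ∀ n, IsPoissonProcess P lam (N n))
    (hind : iIndep (fun n => pointSigma (N n)) P) (hx : ∀ i i', (x i).2 = (x i').2)
    {κ : ℝ} (hκ : 2 * ((k : ℝ) - 1) + 1 < κ) {n : ℕ} (hn : n ≠ 0) {l : ℝ}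
    {B : Set Ω} (hB : MeasurableSet[past N n] B)
    (hBl : ∀ ω ∈ B, (traj x N n ω).top - (traj x N n ω).level ≤ l) :
    ENNReal.ofReal (climbProb lam k (l + κ + 2) ^ k) * P B ≤
      P (B ∩ {ω | Success κ (traj x N n ω) (traj x N (n + k) ω)}) := by
  have hlf : ∀ n ω, ∀ A : Set Plane, Bornology.IsBounded A → (N n ω ∩ A).Finite :=
    fun n => (hN n).locallyFinite
  have hk1 : (1 : ℝ) ≤ k := by exact_mod_cast Nat.one_le_iff_ne_zero.2 (NeZero.ne k)
  -- With u = `top + κ + 2`, after k favourable steps no position is at or below u, so the level has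
  -- risen by more than κ + 1; the top is at most u + 1, so the history has height below 1 and
  -- `G_le` gives G ≤ κ.
  have hu : Measurable[past N n] fun ω => (traj x N n ω).top + (κ + 2) :=
    (measurable_id.add_const (κ + 2)).comp (measurable_top_past hx hlf n)
  have h := measure_climbed_ge hlam hN hind hx hn hu (R := l + κ + 2) hB (fun ω hω => by
    refine ⟨?_, ?_, ?_⟩
    · rw [Nat.cast_zero, zero_mul, add_zero]
      linarith
    · exact State.ncard_lowSet_le _ _
    · linarith [hBl ω hω]) le_rfl
  refine h.trans (measure_mono fun ω hω => ⟨hω.1, ?_⟩)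
  obtain ⟨h1, h2, -⟩ := hω.2
  have h3 := State.lt_level_of_ncard_lowSet (Nat.le_zero.1 (by simpa using h2))
  have h4 := (traj x N (n + k) ω).G_le
  have h5 := (wellFormed_explore x hx (fun m => N m ω) n).level_le_top
  rw [mul_one_div_cancel (by linarith)] at h1
  exact ⟨by linarith, by linarith⟩

end Success

/-! ### Contraction on failure and the geometric tail. -/

section Contraction

variable {Ω : Type*} {k : ℕ} {N : ℕ → Ω → Set Plane} {x : Fin k → Plane}

/-- None of the `M` blocks of length `k` after time `n` is successful. -/
def failSet (κ : ℝ) (x : Fin k → Plane) (N : ℕ → Ω → Set Plane) (n M : ℕ) : Set Ω :=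
  {ω | ∀ i < M, ¬ Success κ (traj x N (n + i * k) ω) (traj x N (n + i * k + k) ω)}

theorem measurableSet_failSet [NeZero k] (hx : ∀ i i', (x i).2 = (x i').2)
    (hN : ∀ n ω, ∀ A : Set Plane, Bornology.IsBounded A → (N n ω ∩ A).Finite) (κ : ℝ) (n M : ℕ) :
    MeasurableSet[past N (n + M * k)] (failSet κ x N n M) := by
  have : failSet κ x N n M = ⋂ i, ⋂ (_ : i < M),
      {ω | Success κ (traj x N (n + i * k) ω) (traj x N (n + i * k + k) ω)}ᶜ := by
    ext ω
    simp [failSet]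
  rw [this]
  refine @MeasurableSet.iInter _ _ (past N (n + M * k)) _ _ fun i =>
    @MeasurableSet.iInter _ _ (past N (n + M * k)) _ _ fun hi =>
      @MeasurableSet.compl _ _ (past N (n + M * k)) ?_
  have hle : n + i * k + k ≤ n + M * k := by
    have := Nat.mul_le_mul_right k (Nat.succ_le_of_lt hi)
    rw [Nat.succ_mul] at this
    omega
  exact past_mono N hle _ (measurableSet_success_past hx hN κ (Nat.le_add_right _ _))

theorem failSet_succ (κ : ℝ) (n M : ℕ) : failSet κ x N n (M + 1) = failSet κ x N n M ∩
    {ω | Success κ (traj x N (n + M * k) ω) (traj x N (n + M * k + k) ω)}ᶜ := by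
  ext ω
  simp only [failSet, mem_ofPred_eq, mem_inter_iff, mem_compl_iff]
  constructor
  · intro h
    exact ⟨fun i hi => h i (by omega), h M (by omega)⟩
  · rintro ⟨h1, h2⟩ i hi
    rcases Nat.lt_succ_iff_lt_or_eq.1 hi with h | rfl
    · exact h1 i h
    · exact h2

variable [MeasurableSpace Ω] {P : Measure Ω} [IsProbabilityMeasure P] {lam : ℝ≥0}

/-- V is estimated by the drift without using F; only the constant A profits from the failure
probability q. -/
theorem setLIntegral_fail_le_of_prob_le [NeZero k] (hlam : 0 < lam)
    (hN : ∀ n, IsPoissonProcess P lam (N n))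
    (hind : iIndep (fun n => pointSigma (N n)) P) (hx : ∀ i i', (x i).2 = (x i').2)
    {n : ℕ} (hn : n ≠ 0) {A ρ q : ℝ} (hA : 0 ≤ A) (hρ : 0 ≤ ρ) (hq : 0 ≤ q) {F B : Set Ω}
    (hB : MeasurableSet[past N n] B) (hF : P (B ∩ F) ≤ ENNReal.ofReal q * P B)
    (h : ∀ ω ∈ B, (1 - driftRate lam) * Real.exp (traj x N n ω).potential +
      (k * driftConst lam k + A * q) ≤ ρ * (Real.exp (traj x N n ω).potential + A)) :
    ∫⁻ ω in B ∩ F, ENNReal.ofReal (Real.exp (traj x N (n + k) ω).potential + A) ∂P ≤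
      ENNReal.ofReal ρ * ∫⁻ ω in B, ENNReal.ofReal (Real.exp (traj x N n ω).potential + A) ∂P := by
  have hlf : ∀ n ω, ∀ A : Set Plane, Bornology.IsBounded A → (N n ω ∩ A).Finite :=
    fun n => (hN n).locallyFinite
  have hm : ∀ n, Measurable fun ω => (traj x N n ω).potential := fun n =>
    (measurable_potential_past hx hlf n).mono (past_le hN n) le_rfl
  have hmn := hm n
  have hmk := hm (n + k)
  have hBm : MeasurableSet B := past_le hN n B hB
  have hε : 0 ≤ 1 - driftRate lam := by linarith [driftRate_lt_one hlam]
  have hb : 0 ≤ k * driftConst lam k := mul_nonneg (Nat.cast_nonneg _) (driftConst_nonneg lam k)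
  obtain ⟨k', hk'⟩ := Nat.exists_eq_succ_of_ne_zero (NeZero.ne k)
  have hdrift : ∫⁻ ω in B, ENNReal.ofReal (Real.exp (traj x N (n + k) ω).potential) ∂P ≤
      ENNReal.ofReal (1 - driftRate lam) *
        ∫⁻ ω in B, ENNReal.ofReal (Real.exp (traj x N n ω).potential) ∂P +
      ENNReal.ofReal (k * driftConst lam k) * P B := by
    have := setLIntegral_exp_potential_add_le hlam hN hind hx hn hB k'
    rwa [show k' + 1 = k from hk'.symm] at this
  have h1 : ∫⁻ ω in B ∩ F, ENNReal.ofReal (Real.exp (traj x N (n + k) ω).potential + A) ∂P =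
      ∫⁻ ω in B ∩ F, ENNReal.ofReal (Real.exp (traj x N (n + k) ω).potential) ∂P +
        ENNReal.ofReal A * P (B ∩ F) := by
    have := setLIntegral_ofReal_mul_add_const (P := P) (B := B ∩ F)
      (f := fun ω => Real.exp (traj x N (n + k) ω).potential) (by fun_prop)
      (fun ω => Real.exp_nonneg _) zero_le_one hA
    simpa using this
  calc ∫⁻ ω in B ∩ F, ENNReal.ofReal (Real.exp (traj x N (n + k) ω).potential + A) ∂P
      ≤ (ENNReal.ofReal (1 - driftRate lam) *
          ∫⁻ ω in B, ENNReal.ofReal (Real.exp (traj x N n ω).potential) ∂P +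
        ENNReal.ofReal (k * driftConst lam k) * P B) +
        ENNReal.ofReal A * (ENNReal.ofReal q * P B) := by
        rw [h1]
        gcongr
        exact (lintegral_mono_set inter_subset_left).trans hdrift
    _ = ∫⁻ ω in B, ENNReal.ofReal ((1 - driftRate lam) * Real.exp (traj x N n ω).potential +
          (k * driftConst lam k + A * q)) ∂P := by
        rw [setLIntegral_ofReal_mul_add_const (by fun_prop) (fun ω => Real.exp_nonneg _) hε
          (add_nonneg hb (mul_nonneg hA hq)), ENNReal.ofReal_add hb (mul_nonneg hA hq),
          ENNReal.ofReal_mul hA]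
        ring
    _ ≤ ∫⁻ ω in B, ENNReal.ofReal (ρ * (Real.exp (traj x N n ω).potential + A)) ∂P :=
        setLIntegral_mono' hBm fun ω hω => ENNReal.ofReal_le_ofReal (h ω hω)
    _ = _ := by
        simp_rw [ENNReal.ofReal_mul hρ]
        rw [lintegral_const_mul _ (by fun_prop)]

/-- The contraction of the Lyapunov function on the event that a block is not successful. -/
theorem setLIntegral_fail_le [NeZero k] (hlam : 0 < lam)
    (hN : ∀ n, IsPoissonProcess P lam (N n))
    (hind : iIndep (fun n => pointSigma (N n)) P) (hx : ∀ i i', (x i).2 = (x i').2)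
    {κ : ℝ} (hκ : 2 * ((k : ℝ) - 1) + 1 < κ)
    {n : ℕ} (hn : n ≠ 0) {A ρ v : ℝ} (hA : 0 ≤ A) (hρ : 0 ≤ ρ) (hv : 0 < v) {B : Set Ω}
    (hB : MeasurableSet[past N n] B)
    (hlow : ∀ y : ℝ, 0 ≤ y → (1 - driftRate lam) * y + (k * driftConst lam k +
      A * (1 - climbProb lam k (Real.log v + κ + 2) ^ k)) ≤ ρ * (y + A))
    (hhigh : ∀ y : ℝ, v < y → (1 - driftRate lam) * y + (k * driftConst lam k + A * 1) ≤
      ρ * (y + A)) :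
    ∫⁻ ω in B ∩ {ω | Success κ (traj x N n ω) (traj x N (n + k) ω)}ᶜ,
      ENNReal.ofReal (Real.exp (traj x N (n + k) ω).potential + A) ∂P ≤
      ENNReal.ofReal ρ * ∫⁻ ω in B, ENNReal.ofReal (Real.exp (traj x N n ω).potential + A) ∂P := by
  have hlf : ∀ n ω, ∀ A : Set Plane, Bornology.IsBounded A → (N n ω ∩ A).Finite :=
    fun n => (hN n).locallyFinite
  set S : Set Ω := {ω | Success κ (traj x N n ω) (traj x N (n + k) ω)} with hS
  have hSm : MeasurableSet S := past_le hN (n + k) S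
    (measurableSet_success_past hx hlf κ (Nat.le_add_right n k))
  -- On D the history has height at most log v and success has probability at least `climbProb ^ k`.
  -- Off D the trivial bound q = 1 is enough, since the drift contracts.
  set D : Set Ω := {ω | Real.exp (traj x N n ω).potential ≤ v} with hD
  have hDm : MeasurableSet[past N n] D :=
    (Real.measurable_exp.comp (measurable_potential_past hx hlf n)) (measurableSet_Iic (a := v))
  have hDm' : MeasurableSet D := past_le hN n D hDm
  set R := Real.log v + κ + 2 with hR
  have hp0 : 0 ≤ climbProb lam k R ^ k := pow_nonneg (climbProb_pos lam hlam k R).le k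
  have hp1 : climbProb lam k R ^ k ≤ 1 :=
    pow_le_one₀ (climbProb_pos lam hlam k R).le (climbProb_le_one lam k R)
  have hBD : MeasurableSet[past N n] (B ∩ D) := @MeasurableSet.inter _ (past N n) _ _ hB hDm
  have hBD' : MeasurableSet[past N n] (B \ D) := @MeasurableSet.diff _ (past N n) _ _ hB hDm
  have hsucc := measure_success_ge hlam hN hind hx hκ hn (l := Real.log v) hBD (by
    intro ω hω
    refine (wellFormed_explore x hx (fun m => N m ω) n).top_sub_level_le_potential.trans ?_
    exact (Real.le_log_iff_exp_le hv).2 hω.2)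
  have hfail : P (B ∩ D ∩ Sᶜ) ≤ ENNReal.ofReal (1 - climbProb lam k R ^ k) * P (B ∩ D) := by
    have h2 : ENNReal.ofReal (climbProb lam k R ^ k) * P (B ∩ D) +
        ENNReal.ofReal (1 - climbProb lam k R ^ k) * P (B ∩ D) = P (B ∩ D) := by
      rw [← add_mul, ← ENNReal.ofReal_add hp0 (by linarith)]
      simp
    have h3 : ENNReal.ofReal (climbProb lam k R ^ k) * P (B ∩ D) ≠ ∞ :=
      ENNReal.mul_ne_top ENNReal.ofReal_ne_top (measure_ne_top _ _)
    rw [← ENNReal.add_le_add_iff_left h3, h2]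
    refine (add_le_add_left hsucc _).trans ?_
    rw [← sdiff_eq, measure_inter_add_sdiff _ hSm]
  have e1 := setLIntegral_fail_le_of_prob_le hlam hN hind hx hn hA hρ
    (sub_nonneg.2 hp1) hBD hfail (fun ω _ => hlow _ (Real.exp_nonneg _))
  have e2 := setLIntegral_fail_le_of_prob_le hlam hN hind hx hn hA hρ zero_le_one hBD'
    (F := Sᶜ) (by rw [ENNReal.ofReal_one, one_mul]; exact measure_mono inter_subset_left)
    (fun ω hω => hhigh _ (not_le.1 hω.2))
  have e3 := lintegral_inter_add_sdiff (μ := P)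
    (fun ω => ENNReal.ofReal (Real.exp (traj x N n ω).potential + A)) B hDm'
  have e4 := lintegral_inter_add_sdiff (μ := P)
    (fun ω => ENNReal.ofReal (Real.exp (traj x N (n + k) ω).potential + A)) (B ∩ Sᶜ) hDm'
  rw [← e4, ← e3, mul_add, inter_right_comm, inter_sdiff_right_comm]
  exact add_le_add e1 e2

/-- The contraction is iterated over the blocks; then V + A is bounded below by A at the end and
above by v' + A at the start. -/
theorem measure_failSet_le [NeZero k] (hlam : 0 < lam)
    (hN : ∀ n, IsPoissonProcess P lam (N n))
    (hind : iIndep (fun n => pointSigma (N n)) P) (hx : ∀ i i', (x i).2 = (x i').2)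
    {κ : ℝ} (hκ : 2 * ((k : ℝ) - 1) + 1 < κ)
    {n : ℕ} (hn : n ≠ 0) {A ρ v : ℝ} (hA : 0 < A) (hρ : 0 ≤ ρ) (hv : 0 < v) {B : Set Ω}
    (hB : MeasurableSet[past N n] B)
    (hlow : ∀ y : ℝ, 0 ≤ y → (1 - driftRate lam) * y + (k * driftConst lam k +
      A * (1 - climbProb lam k (Real.log v + κ + 2) ^ k)) ≤ ρ * (y + A))
    (hhigh : ∀ y : ℝ, v < y → (1 - driftRate lam) * y + (k * driftConst lam k + A * 1) ≤
      ρ * (y + A)) {v' : ℝ} (hBv : ∀ ω ∈ B, Real.exp (traj x N n ω).potential ≤ v') (M : ℕ) :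
    P (B ∩ failSet κ x N n M) ≤ ENNReal.ofReal ((v' + A) / A * ρ ^ M) * P B := by
  have hlf : ∀ n ω, ∀ A : Set Plane, Bornology.IsBounded A → (N n ω ∩ A).Finite :=
    fun n => (hN n).locallyFinite
  have hBm : MeasurableSet B := past_le hN n B hB
  have key : ∫⁻ ω in B ∩ failSet κ x N n M,
      ENNReal.ofReal (Real.exp (traj x N (n + M * k) ω).potential + A) ∂P ≤
      ENNReal.ofReal (ρ ^ M) *
        ∫⁻ ω in B, ENNReal.ofReal (Real.exp (traj x N n ω).potential + A) ∂P := by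
    induction M with
    | zero => simpa using lintegral_mono_set inter_subset_left
    | succ M ih =>
      have hpm := past_mono N (Nat.le_add_right n (M * k))
      have h := setLIntegral_fail_le hlam hN hind hx hκ (n := n + M * k) (by omega) hA.le hρ hv
        (@MeasurableSet.inter _ (past N (n + M * k)) _ _ (hpm B hB)
          (measurableSet_failSet hx hlf κ n M)) hlow hhigh
      rw [failSet_succ, ← inter_assoc, show n + (M + 1) * k = n + M * k + k by ring]
      refine h.trans ?_
      rw [pow_succ', ENNReal.ofReal_mul hρ, mul_assoc]
      gcongr
  have h1 : ENNReal.ofReal A * P (B ∩ failSet κ x N n M) ≤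
      ENNReal.ofReal (ρ ^ M) * (ENNReal.ofReal (v' + A) * P B) := by
    rw [← setLIntegral_const, ← setLIntegral_const B]
    refine (lintegral_mono fun ω => ENNReal.ofReal_le_ofReal ?_).trans (key.trans ?_)
    · linarith [Real.exp_pos (traj x N (n + M * k) ω).potential]
    · gcongr 1
      exact setLIntegral_mono' hBm fun ω hω => ENNReal.ofReal_le_ofReal (by linarith [hBv ω hω])
  have hA0 : ENNReal.ofReal A ≠ 0 := by simpa using hA
  rw [← ENNReal.mul_le_mul_iff_right hA0 ENNReal.ofReal_ne_top]
  refine h1.trans (le_of_eq ?_)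
  by_cases hv' : 0 ≤ v' + A
  · rw [← mul_assoc, ← mul_assoc, ← ENNReal.ofReal_mul (pow_nonneg hρ M), ← ENNReal.ofReal_mul hA.le]
    congr 2
    field_simp
  -- A negative v' + A is incompatible with V ≤ v' on a nonempty B.
  · have hB0 : B = ∅ := by
      ext ω
      simp only [mem_empty_iff_false, iff_false]
      intro hω
      linarith [hBv ω hω, Real.exp_pos (traj x N n ω).potential]
    simp [hB0]

/-- The constants in the contraction inequality. -/
theorem exists_contraction_constants (hlam : 0 < lam) (k : ℕ) [NeZero k] (κ : ℝ) :
    ∃ A ρ v : ℝ, 0 < A ∧ 0 < ρ ∧ ρ < 1 ∧ 0 < v ∧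
      (∀ y : ℝ, 0 ≤ y → (1 - driftRate lam) * y + (k * driftConst lam k +
        A * (1 - climbProb lam k (Real.log v + κ + 2) ^ k)) ≤ ρ * (y + A)) ∧
      ∀ y : ℝ, v < y → (1 - driftRate lam) * y + (k * driftConst lam k + A * 1) ≤
        ρ * (y + A) := by
  set ε := driftRate lam with hε
  have hε0 : 0 < ε := driftRate_pos hlam
  have hε1 : ε < 1 := driftRate_lt_one hlam
  set b := k * driftConst lam k with hb
  have hk : (0 : ℝ) < k := by exact_mod_cast Nat.pos_of_ne_zero (NeZero.ne k)
  have hb0 : 0 < b := mul_pos hk (Real.exp_pos _)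
  -- v comes first, as p depends on it and A on p. For small y, A = 2b/p gives b + A(1 - p) = (1 -
  -- p/2)A. For y > v, half of the drift εy pays for b + 1, and the spare 1 covers (1 - ρ)A because
  -- ρ ≥ 1 - 1/A.
  set v := 2 * (b + 1) / ε with hv
  set p := climbProb lam k (Real.log v + κ + 2) ^ k with hp
  have hp0 : 0 < p := pow_pos (climbProb_pos lam hlam k _) k
  set A := 2 * b / p with hA
  have hA0 : 0 < A := by positivity
  have hpA : p * A = 2 * b := by rw [hA]; field_simp
  set ρ := max (1 - ε / 2) (max (1 - p / 2) (1 - 1 / A)) with hρ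
  have h1 : 1 - ε / 2 ≤ ρ := le_max_left _ _
  have h2 : 1 - p / 2 ≤ ρ := (le_max_left _ _).trans (le_max_right _ _)
  have h3 : 1 - 1 / A ≤ ρ := (le_max_right _ _).trans (le_max_right _ _)
  have h3' : (1 - ρ) * A ≤ 1 := by
    have : (1 - ρ) * A ≤ 1 / A * A := by gcongr; linarith
    rwa [one_div_mul_cancel hA0.ne'] at this
  refine ⟨A, ρ, v, hA0, by linarith, ?_, by positivity, fun y hy => ?_, fun y hy => ?_⟩
  · refine max_lt (by linarith) (max_lt (by linarith) ?_)
    have : 0 < 1 / A := by positivity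
    linarith
  · have e1 : (1 - ε) * y ≤ ρ * y := by gcongr; linarith
    have e2 : (1 - p / 2) * A ≤ ρ * A := by gcongr
    nlinarith
  · have hy' : 2 * (b + 1) ≤ ε * y := by
      have := mul_lt_mul_of_pos_left hy hε0
      rw [hv, mul_div_cancel₀ _ hε0.ne'] at this
      exact this.le
    have hy0 : 0 ≤ y := (by positivity : (0 : ℝ) ≤ v).trans hy.le
    have e1 : (1 - ε / 2) * y ≤ ρ * y := by gcongr
    nlinarith

end Contraction

/-! ### Good steps along a fixed trajectory. -/

section GoodSteps

variable {k : ℕ} {κ : ℝ} {s : ℕ → State k}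

/-- Time `v` is a candidate for the first good step after time `u`. -/
def IsGood (κ : ℝ) (s : ℕ → State k) (u v : ℕ) : Prop :=
  k ∣ v ∧ u < v ∧ Success κ (s u) (s v)

theorem nextGood_eq_sInf_image (κ : ℝ) (s : ℕ → State k) (u : ℕ) :
    nextGood κ s u = sInf ((fun v : ℕ => (v : WithTop ℕ)) '' {v | IsGood κ s u v}) := by
  rw [nextGood]
  congr 1
  ext m
  constructor
  · rintro ⟨n, rfl, h⟩
    exact ⟨n * k, ⟨dvd_mul_left k n, h.1, h.2.1, h.2.2⟩, rfl⟩
  · rintro ⟨v, ⟨⟨n, rfl⟩, h1, h2, h3⟩, rfl⟩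
    rw [mul_comm] at h1 h2 h3
    exact ⟨n, by rw [mul_comm], h1, h2, h3⟩

theorem nextGood_le {u v : ℕ} (h : IsGood κ s u v) : nextGood κ s u ≤ v := by
  rw [nextGood_eq_sInf_image]
  exact csInf_le (OrderBot.bddBelow _) ⟨v, h, rfl⟩

theorem nextGood_eq_natCast_iff {u v : ℕ} :
    nextGood κ s u = v ↔ IsGood κ s u v ∧ ∀ w < v, ¬ IsGood κ s u w := by
  have aux : ∀ v : ℕ, nextGood κ s u = v → IsGood κ s u v := by
    intro v h
    have hne : ((fun v : ℕ => (v : WithTop ℕ)) '' {v | IsGood κ s u v}).Nonempty := by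
      by_contra h0
      rw [not_nonempty_iff_eq_empty] at h0
      rw [nextGood_eq_sInf_image, h0, WithTop.sInf_empty] at h
      exact WithTop.top_ne_coe h
    obtain ⟨w, hw, hwv⟩ := csInf_mem hne
    rw [← nextGood_eq_sInf_image, h] at hwv
    obtain rfl : w = v := WithTop.coe_injective hwv
    exact hw
  constructor
  · refine fun h => ⟨aux v h, fun w hw hg => ?_⟩
    have := nextGood_le hg
    rw [h] at this
    exact absurd (WithTop.coe_le_coe.1 this) (not_le.2 hw)
  · rintro ⟨h1, h2⟩
    obtain ⟨w, hw⟩ := WithTop.ne_top_iff_exists.1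
      (ne_top_of_le_ne_top WithTop.coe_ne_top (nextGood_le h1))
    have hwv : w ≤ v := WithTop.coe_le_coe.1 (hw.symm ▸ nextGood_le h1)
    rcases hwv.lt_or_eq with h | rfl
    · exact absurd (aux w hw.symm) (h2 w h)
    · exact hw.symm

theorem goodStep_succ_of_eq {j u : ℕ} (h : goodStep κ s j = u) :
    goodStep κ s (j + 1) = nextGood κ s u := by
  rw [goodStep, h]
  rfl

theorem goodStep_succ_eq_natCast_iff {j v : ℕ} : goodStep κ s (j + 1) = v ↔
    ∃ u < v, goodStep κ s j = u ∧ IsGood κ s u v ∧ ∀ w < v, ¬ IsGood κ s u w := by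
  constructor
  · intro h
    have hne : goodStep κ s j ≠ ⊤ := by
      intro h0
      rw [goodStep, h0] at h
      exact WithTop.top_ne_coe h
    obtain ⟨u, hu⟩ := WithTop.ne_top_iff_exists.1 hne
    rw [goodStep_succ_of_eq hu.symm, nextGood_eq_natCast_iff] at h
    exact ⟨u, h.1.2.1, hu.symm, h⟩
  · rintro ⟨u, -, hu, h⟩
    rw [goodStep_succ_of_eq hu, nextGood_eq_natCast_iff]
    exact h

/-- The level is monotone, so a rise measured from the start of a block is at least as large
measured from an earlier time. -/
theorem IsGood.of_success [NeZero k] (hs : Monotone fun n => (s n).level) {u n : ℕ}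
    (hn : k ∣ n) (hun : u ≤ n) (h : Success κ (s n) (s (n + k))) : IsGood κ s u (n + k) := by
  have := Nat.pos_of_ne_zero (NeZero.ne k)
  have h1 : (s u).level ≤ (s n).level := hs hun
  exact ⟨hn.add (dvd_refl k), by omega, h.1, by linarith [h.2]⟩

end GoodSteps

/-! ### Good steps as stopping times, their finiteness and gaps. -/

section GoodTimes

variable {Ω : Type*} {k : ℕ} {κ : ℝ} {N : ℕ → Ω → Set Plane} {x : Fin k → Plane}

theorem stronglyMeasurable_position [MeasurableSpace Ω] {P : Measure Ω} {lam : ℝ≥0}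
    (hN : ∀ n, IsPoissonProcess P lam (N n)) (n : ℕ) : StronglyMeasurable (position x N n) :=
  Measurable.stronglyMeasurable
    ((measurable_pos_explore (x := x) (fun n => (hN n).locallyFinite) le_rfl).mono
      (past_le hN n) le_rfl)

theorem measurable_position_natural [MeasurableSpace Ω]
    (hg : ∀ n, StronglyMeasurable (position x N n)) {l n : ℕ} (h : l ≤ n) :
    Measurable[Filtration.natural (position x N) hg n] (position x N l) :=
  Measurable.of_comap_le (le_iSup₂_of_le l h le_rfl)

theorem natural_le_past [MeasurableSpace Ω] (hg : ∀ n, StronglyMeasurable (position x N n))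
    (hN : ∀ n ω, ∀ A : Set Plane, Bornology.IsBounded A → (N n ω ∩ A).Finite) (n : ℕ) :
    (Filtration.natural (position x N) hg n : MeasurableSpace Ω) ≤ past N n :=
  iSup₂_le fun _ hl => (measurable_pos_explore hN hl).comap_le

theorem measurableSet_isGood [NeZero k] (hx : ∀ i i', (x i).2 = (x i').2)
    {m : MeasurableSpace Ω} {u v : ℕ} (huv : u ≤ v)
    (hpos : ∀ l ≤ v, Measurable fun ω => (traj x N l ω).pos) :
    MeasurableSet {ω | IsGood κ (explore x fun m => N m ω) u v} := by
  refine (MeasurableSet.const (k ∣ v)).inter ((MeasurableSet.const (u < v)).inter ?_)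
  exact measurableSet_success (measurable_level_explore u (hpos u huv))
    (measurable_level_explore v (hpos v le_rfl)) (measurable_G_explore hx v hpos) κ

theorem measurableSet_isFirstGood [NeZero k] (hx : ∀ i i', (x i).2 = (x i').2)
    {m : MeasurableSpace Ω} {u v : ℕ} (huv : u ≤ v)
    (hpos : ∀ l ≤ v, Measurable fun ω => (traj x N l ω).pos) :
    MeasurableSet {ω | IsGood κ (explore x fun m => N m ω) u v ∧
      ∀ w < v, ¬ IsGood κ (explore x fun m => N m ω) u w} := by
  have h : MeasurableSet {ω | ∀ w < v, ¬ IsGood κ (explore x fun m => N m ω) u w} := ?_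
  · exact (measurableSet_isGood hx huv hpos).inter h
  rw [show {ω | ∀ w < v, ¬ IsGood κ (explore x fun m => N m ω) u w} =
    ⋂ w, ⋂ (_ : w < v), {ω | IsGood κ (explore x fun m => N m ω) u w}ᶜ by ext; simp]
  refine MeasurableSet.iInter fun w => MeasurableSet.iInter fun hw => MeasurableSet.compl ?_
  by_cases huw : u ≤ w
  · exact measurableSet_isGood hx huw fun l hl => hpos l (hl.trans hw.le)
  · rw [show {ω | IsGood κ (explore x fun m => N m ω) u w} = ∅ from
      eq_empty_of_forall_notMem fun ω h => huw h.2.1.le]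
    exact MeasurableSet.empty

/-- The event is split by the value u < v of the previous good step; being the first candidate after
u depends only on positions up to time v. -/
theorem measurableSet_goodTime_eq [NeZero k] [MeasurableSpace Ω]
    (hx : ∀ i i', (x i).2 = (x i').2) (hg : ∀ n, StronglyMeasurable (position x N n)) (j v : ℕ) :
    MeasurableSet[Filtration.natural (position x N) hg v] {ω | goodTime κ x N j ω = v} := by
  induction j generalizing v with
  | zero =>
    exact @MeasurableSet.const Ω (Filtration.natural (position x N) hg v) ((0 : WithTop ℕ) = v)
  | succ j ih =>
    have h : {ω | goodTime κ x N (j + 1) ω = v} = ⋃ u, ⋃ (_ : u < v),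
        {ω | goodTime κ x N j ω = u} ∩ {ω | IsGood κ (explore x fun m => N m ω) u v ∧
          ∀ w < v, ¬ IsGood κ (explore x fun m => N m ω) u w} := by
      ext ω
      simp only [mem_iUnion, mem_inter_iff, mem_ofPred_eq, goodTime, exists_prop]
      exact goodStep_succ_eq_natCast_iff
    rw [h]
    refine @MeasurableSet.iUnion _ _ (Filtration.natural (position x N) hg v) _ _ fun u =>
      @MeasurableSet.iUnion _ _ (Filtration.natural (position x N) hg v) _ _ fun hu =>
      @MeasurableSet.inter _ (Filtration.natural (position x N) hg v) _ _
        ((Filtration.natural (position x N) hg).mono hu.le _ (ih u)) ?_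
    exact @measurableSet_isFirstGood Ω k κ N x _ hx
      (Filtration.natural (position x N) hg v) u v hu.le
      fun l hl => measurable_position_natural hg hl

theorem isStoppingTime_goodTime [NeZero k] [MeasurableSpace Ω]
    (hx : ∀ i i', (x i).2 = (x i').2) (hg : ∀ n, StronglyMeasurable (position x N n)) (j : ℕ) :
    IsStoppingTime (Filtration.natural (position x N) hg) (goodTime κ x N j) :=
  isStoppingTime_of_measurableSet_eq fun v => measurableSet_goodTime_eq hx hg j v

/-- If the next good step is more than `n` steps away, then all blocks up to there fail. -/
theorem mem_failSet_of_lt [NeZero k] {j t n : ℕ} (ht : k ∣ t) {ω : Ω}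
    (h : goodTime κ x N j ω = t)
    (hlt : goodTime κ x N j ω + (n : WithTop ℕ) < goodTime κ x N (j + 1) ω) :
    ω ∈ failSet κ x N t (n / k) := by
  intro i hi hS
  have h1 := nextGood_le (IsGood.of_success (level_explore_mono x fun m => N m ω)
    (ht.add (dvd_mul_left k i)) (Nat.le_add_right t (i * k)) hS)
  rw [h, goodTime, goodStep_succ_of_eq h] at hlt
  have h2 := hlt.trans_le h1
  have h3 : t + n < t + i * k + k := by exact_mod_cast h2
  have h4 := Nat.mul_le_mul_right k (Nat.succ_le_of_lt hi)
  have h5 := Nat.div_mul_le_self n k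
  rw [Nat.succ_mul] at h4
  omega

variable [MeasurableSpace Ω] {P : Measure Ω} [IsProbabilityMeasure P] {lam : ℝ≥0}

/-- V is finite but unbounded at time n, so the geometric bound is applied on each of the sets V ≤
a, which exhaust Ω. -/
theorem ae_exists_notMem_failSet [NeZero k] (hlam : 0 < lam)
    (hN : ∀ n, IsPoissonProcess P lam (N n))
    (hind : iIndep (fun n => pointSigma (N n)) P) (hx : ∀ i i', (x i).2 = (x i').2)
    (hκ : 2 * ((k : ℝ) - 1) + 1 < κ) {n : ℕ} (hn : n ≠ 0) :
    ∀ᵐ ω ∂P, ∃ M, ω ∉ failSet κ x N n M := by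
  obtain ⟨A, ρ, v, hA, hρ, hρ1, hv, hlow, hhigh⟩ := exists_contraction_constants hlam k κ
  have hm := measurable_potential_past hx (fun n => (hN n).locallyFinite) n
  have hzero : ∀ a : ℕ, P ({ω | Real.exp (traj x N n ω).potential ≤ a} ∩
      ⋂ M, failSet κ x N n M) = 0 := by
    intro a
    have hB : MeasurableSet[past N n] {ω | Real.exp (traj x N n ω).potential ≤ a} :=
      (Real.measurable_exp.comp hm) measurableSet_Iic
    have hb : ∀ M, P ({ω | Real.exp (traj x N n ω).potential ≤ a} ∩ ⋂ M, failSet κ x N n M) ≤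
        ENNReal.ofReal ((a + A) / A * ρ ^ M) := fun M =>
      (measure_mono (inter_subset_inter_right _ (iInter_subset _ M))).trans
        ((measure_failSet_le hlam hN hind hx hκ hn hA hρ.le hv hB hlow hhigh
          (fun _ h => h) M).trans (mul_le_of_le_one_right' prob_le_one))
    have hlim : Filter.Tendsto (fun M : ℕ => ENNReal.ofReal ((a + A) / A * ρ ^ M)) Filter.atTop
        (nhds 0) := by
      have := ENNReal.tendsto_ofReal
        ((tendsto_pow_atTop_nhds_zero_of_lt_one hρ.le hρ1).const_mul ((a + A) / A))
      simpa using this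
    exact le_antisymm (ge_of_tendsto' hlim hb) zero_le
  have hall : ∀ᵐ ω ∂P, ∀ a : ℕ, ω ∉ {ω | Real.exp (traj x N n ω).potential ≤ a} ∩
      ⋂ M, failSet κ x N n M :=
    ae_all_iff.2 fun a => measure_eq_zero_iff_ae_notMem.1 (hzero a)
  filter_upwards [hall] with ω hω
  obtain ⟨a, ha⟩ := exists_nat_ge (Real.exp (traj x N n ω).potential)
  have : ω ∉ ⋂ M, failSet κ x N n M := fun h => hω a ⟨ha, h⟩
  simpa using this

theorem ae_goodTime_lt_top [NeZero k] (hlam : 0 < lam)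
    (hN : ∀ n, IsPoissonProcess P lam (N n))
    (hind : iIndep (fun n => pointSigma (N n)) P) (hx : ∀ i i', (x i).2 = (x i').2)
    (hκ : 2 * ((k : ℝ) - 1) + 1 < κ) :
    ∀ᵐ ω ∂P, ∀ j, goodTime κ x N j ω < ⊤ := by
  have hk := Nat.pos_of_ne_zero (NeZero.ne k)
  -- The time (t + 1)k is a multiple of k, at least t, and nonzero even for t = 0, where the Markov
  -- step is not available.
  have hall : ∀ᵐ ω ∂P, ∀ t, ∃ M, ω ∉ failSet κ x N ((t + 1) * k) M :=
    ae_all_iff.2 fun t => ae_exists_notMem_failSet hlam hN hind hx hκ (by positivity)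
  filter_upwards [hall] with ω hω j
  induction j with
  | zero => exact WithTop.coe_lt_top 0
  | succ j ih =>
    obtain ⟨t, ht⟩ := WithTop.ne_top_iff_exists.1 ih.ne
    obtain ⟨M, hM⟩ := hω t
    simp only [failSet, mem_ofPred_eq, not_forall, not_not] at hM
    obtain ⟨i, -, hS⟩ := hM
    have h1 := nextGood_le (IsGood.of_success (u := t) (level_explore_mono x fun m => N m ω)
      ((dvd_mul_left k (t + 1)).add (dvd_mul_left k i))
      (by nlinarith [Nat.zero_le (i * k)]) hS)
    rw [goodTime, goodStep_succ_of_eq (show goodStep κ _ j = t from ht.symm)]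
    exact h1.trans_lt (WithTop.coe_lt_top _)

/-- The restricted tail bound for the gap between consecutive good times. -/
theorem measure_inter_goodTime_gap_le [NeZero k] (hlam : 0 < lam)
    (hN : ∀ n, IsPoissonProcess P lam (N n))
    (hind : iIndep (fun n => pointSigma (N n)) P) (hx : ∀ i i', (x i).2 = (x i').2)
    (hκ : 2 * ((k : ℝ) - 1) + 1 < κ) {A ρ v : ℝ} (hA : 0 < A) (hρ : 0 ≤ ρ) (hv : 0 < v)
    (hlow : ∀ y : ℝ, 0 ≤ y → (1 - driftRate lam) * y + (k * driftConst lam k +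
      A * (1 - climbProb lam k (Real.log v + κ + 2) ^ k)) ≤ ρ * (y + A))
    (hhigh : ∀ y : ℝ, v < y → (1 - driftRate lam) * y + (k * driftConst lam k + A * 1) ≤
      ρ * (y + A))
    (hg : ∀ n, StronglyMeasurable (position x N n)) {j : ℕ} (hj : 1 ≤ j) (n : ℕ) {S : Set Ω}
    (hS : MeasurableSet[(isStoppingTime_goodTime (κ := κ) hx hg j).measurableSpace] S) :
    P (S ∩ {ω | goodTime κ x N j ω + (n : WithTop ℕ) < goodTime κ x N (j + 1) ω}) ≤
      ENNReal.ofReal ((Real.exp (k * κ + (k : ℝ) ^ 2 / 4) + A) / A * ρ ^ (n / k)) * P S := by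
  set T : Set Ω := {ω | goodTime κ x N j ω + (n : WithTop ℕ) < goodTime κ x N (j + 1) ω} with hT
  set τ := isStoppingTime_goodTime (κ := κ) hx hg j with hτ
  set c := ENNReal.ofReal ((Real.exp (k * κ + (k : ℝ) ^ 2 / 4) + A) / A * ρ ^ (n / k)) with hc
  have hlf : ∀ n ω, ∀ A : Set Plane, Bornology.IsBounded A → (N n ω ∩ A).Finite :=
    fun n => (hN n).locallyFinite
  -- The strong Markov property is obtained by splitting over the values t of the stopping time and
  -- using the bound at each fixed time.
  have hm : ∀ t : ℕ, MeasurableSet[past N t] (S ∩ {ω | goodTime κ x N j ω = t}) := fun t =>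
    natural_le_past hg hlf t _ ((τ.measurableSet_inter_eq_iff S t).1
      (@MeasurableSet.inter _ τ.measurableSpace _ _ hS (τ.measurableSet_eq_of_countable' t)))
  have hpiece : ∀ t : ℕ, P ((S ∩ {ω | goodTime κ x N j ω = t}) ∩ T) ≤
      c * P (S ∩ {ω | goodTime κ x N j ω = t}) := by
    intro t
    -- Here j ≥ 1 is needed: such a good step is positive and has G ≤ κ, which bounds the potential
    -- by kκ + k²/4.
    have hgood : ∀ ω ∈ S ∩ {ω | goodTime κ x N j ω = t}, k ∣ t ∧ t ≠ 0 ∧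
        (traj x N t ω).G ≤ κ := by
      rintro ω ⟨-, h⟩
      obtain ⟨i, rfl⟩ : ∃ i, j = i + 1 := ⟨j - 1, by omega⟩
      obtain ⟨u, hu, -, hu', -⟩ := goodStep_succ_eq_natCast_iff.1 h
      exact ⟨hu'.1, by omega, hu'.2.2.1⟩
    rcases eq_empty_or_nonempty (S ∩ {ω | goodTime κ x N j ω = t}) with h0 | ⟨ω₀, h₀⟩
    · simp [h0]
    have hsub : (S ∩ {ω | goodTime κ x N j ω = t}) ∩ T ⊆
        (S ∩ {ω | goodTime κ x N j ω = t}) ∩ failSet κ x N t (n / k) := fun ω hω =>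
      ⟨hω.1, mem_failSet_of_lt (hgood ω₀ h₀).1 hω.1.2 hω.2⟩
    refine (measure_mono hsub).trans
      (measure_failSet_le hlam hN hind hx hκ (hgood ω₀ h₀).2.1 hA hρ hv (hm t) hlow hhigh
        (fun ω hω => Real.exp_le_exp.2 ?_) (n / k))
    refine (traj x N t ω).potential_le.trans ?_
    gcongr
    exact (traj x N t ω).height_le_G.trans (hgood ω hω).2.2
  have hcover : S ∩ T ⊆ ⋃ t : ℕ, (S ∩ {ω | goodTime κ x N j ω = t}) ∩ T := by
    rintro ω ⟨h1, h2⟩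
    have hne : goodTime κ x N j ω ≠ ⊤ := by
      intro h0
      rw [hT, mem_ofPred_eq, h0, WithTop.top_add] at h2
      exact not_top_lt h2
    obtain ⟨t, ht⟩ := WithTop.ne_top_iff_exists.1 hne
    exact mem_iUnion.2 ⟨t, ⟨h1, ht.symm⟩, h2⟩
  calc P (S ∩ T) ≤ ∑' t : ℕ, P ((S ∩ {ω | goodTime κ x N j ω = t}) ∩ T) :=
        (measure_mono hcover).trans (measure_iUnion_le _)
    _ ≤ ∑' t : ℕ, c * P (S ∩ {ω | goodTime κ x N j ω = t}) := ENNReal.tsum_le_tsum hpiece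
    _ = c * P (⋃ t : ℕ, S ∩ {ω | goodTime κ x N j ω = t}) := by
        rw [ENNReal.tsum_mul_left, measure_iUnion _ fun t => past_le hN t _ (hm t)]
        intro t t' htt
        refine disjoint_left.2 fun ω h h' => htt ?_
        exact WithTop.coe_injective (h.2.symm.trans h'.2)
    _ ≤ c * P S := by
        gcongr
        exact iUnion_subset fun t => inter_subset_left

end GoodTimes

/-! ### Conditional probabilities and the final exponential bound. -/

/-- A conditional probability is at most `c` if this holds in the integrated form. -/
theorem condExp_indicator_le {Ω : Type*} {m m₀ : MeasurableSpace Ω} {P : Measure Ω}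
    [IsProbabilityMeasure P] (hm : m ≤ m₀) {T : Set Ω} (hT : MeasurableSet[m₀] T) {c : ℝ} (hc : 0 ≤ c)
    (h : ∀ S, MeasurableSet[m] S → P (S ∩ T) ≤ ENNReal.ofReal c * P S) :
    P⟦T | m⟧ ≤ᵐ[P] fun _ => c := by
  have hint : Integrable (T.indicator fun _ => (1 : ℝ)) P :=
    (integrable_const 1).indicator hT
  refine ae_le_of_ae_le_trim (hm := hm) ?_
  refine ae_le_of_forall_setIntegral_le
    (integrable_condExp.trim hm stronglyMeasurable_condExp) (integrable_const c) fun S hS _ => ?_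
  rw [← setIntegral_trim hm stronglyMeasurable_condExp hS, setIntegral_condExp hm hint hS,
    setIntegral_indicator hT, setIntegral_const, setIntegral_const, smul_eq_mul, smul_eq_mul,
    mul_one, measureReal_def, measureReal_def, trim_measurableSet_eq hm hS, mul_comm,
    ← ENNReal.toReal_ofReal hc, ← ENNReal.toReal_mul]
  exact ENNReal.toReal_mono (by finiteness) (h S hS)

/-- The integer quotient is at least n/k - 1, and the lost unit costs a factor ρ⁻¹. -/
theorem pow_div_le_exp {ρ : ℝ} (hρ : 0 < ρ) (hρ1 : ρ < 1) (k n : ℕ) [NeZero k] :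
    ρ ^ (n / k) ≤ ρ⁻¹ * Real.exp (-(-Real.log ρ / k) * n) := by
  have hk : (0 : ℝ) < k := by exact_mod_cast Nat.pos_of_ne_zero (NeZero.ne k)
  have h1 : (n : ℝ) / k - 1 ≤ (n / k : ℕ) := by
    rw [sub_le_iff_le_add, div_le_iff₀ hk]
    have := Nat.lt_div_mul_add (Nat.pos_of_ne_zero (NeZero.ne k)) (a := n)
    have h2 : (n : ℝ) < (n / k : ℕ) * k + k := by exact_mod_cast this
    linarith
  have hlog := Real.log_neg hρ hρ1
  rw [← Real.exp_log (inv_pos.2 hρ), ← Real.exp_add, Real.log_inv,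
    ← Real.rpow_natCast, Real.rpow_def_of_pos hρ]
  refine Real.exp_le_exp.2 ?_
  have h3 : -(-Real.log ρ / k) * n = Real.log ρ * (n / k) := by ring
  rw [h3]
  nlinarith

end DSF

end

theorem proposition4p1 (lam : ℝ≥0) (hlam : 0 < lam) (k : ℕ) (hk : 2 ≤ k)
    (κ : ℝ) (hκ : 2 * ((k : ℝ) - 1) + 1 < κ) :
    ∃ c₀ c₁ : ℝ, 0 < c₀ ∧ 0 < c₁ ∧
      ∀ (Ω : Type*) [MeasurableSpace Ω] (P : Measure Ω) [IsProbabilityMeasure P]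
        (N : ℕ → Ω → Set DSF.Plane),
        (∀ n, DSF.IsPoissonProcess P lam (N n)) →
        iIndep (fun n => DSF.pointSigma (N n)) P →
        ∀ x : Fin k → DSF.Plane, (∀ i i', (x i).2 = (x i').2) →
          ∃ (hg : ∀ n, StronglyMeasurable (DSF.position x N n))
            (hτ : ∀ j, IsStoppingTime (Filtration.natural (DSF.position x N) hg)
              (DSF.goodTime κ x N j)),
            (∀ᵐ ω ∂P, ∀ j, DSF.goodTime κ x N j ω < ⊤) ∧
            ∀ j : ℕ, 1 ≤ j → ∀ n : ℕ,
              P⟦{ω | DSF.goodTime κ x N j ω + (n : WithTop ℕ) < DSF.goodTime κ x N (j + 1) ω} |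
                (hτ j).measurableSpace⟧
              ≤ᵐ[P] fun _ => c₀ * Real.exp (-c₁ * n) := by
  have : NeZero k := ⟨by omega⟩
  obtain ⟨A, ρ, v, hA, hρ, hρ1, hv, hlow, hhigh⟩ :=
    DSF.exists_contraction_constants hlam k κ
  have hk' : (0 : ℝ) < k := by exact_mod_cast Nat.pos_of_ne_zero (NeZero.ne k)
  have hlog := Real.log_neg hρ hρ1
  set C := (Real.exp (k * κ + (k : ℝ) ^ 2 / 4) + A) / A with hC
  have hC0 : 0 < C := by positivity
  -- The constants are fixed before the probability space and the starting points: C bounds (V +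
  -- A)/A at a good step, and ρ is the contraction factor per block of k steps.
  refine ⟨C * ρ⁻¹, -Real.log ρ / k, by positivity, div_pos (neg_pos.2 hlog) hk', ?_⟩
  intro Ω _ P _ N hN hind x hx
  have hg := DSF.stronglyMeasurable_position (x := x) hN
  refine ⟨hg, DSF.isStoppingTime_goodTime hx hg, DSF.ae_goodTime_lt_top hlam hN hind hx hκ, ?_⟩
  intro j hj n
  have hmeas : ∀ j, Measurable (DSF.goodTime κ x N j) := fun j =>
    (DSF.isStoppingTime_goodTime hx hg j).measurable'
  have hT : MeasurableSet {ω | DSF.goodTime κ x N j ω + (n : WithTop ℕ) <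
      DSF.goodTime κ x N (j + 1) ω} := by
    have h : MeasurableSet {p : WithTop ℕ × WithTop ℕ | p.1 + (n : WithTop ℕ) < p.2} :=
      (Set.to_countable _).measurableSet
    exact ((hmeas j).prodMk (hmeas (j + 1))) h
  refine DSF.condExp_indicator_le (IsStoppingTime.measurableSpace_le _) hT (by positivity)
    fun S hS => ?_
  refine (DSF.measure_inter_goodTime_gap_le hlam hN hind hx hκ hA hρ.le hv hlow hhigh hg hj n
    hS).trans ?_
  refine mul_le_mul_left (ENNReal.ofReal_le_ofReal ?_) (P S)
  rw [← hC, mul_assoc]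
  exact mul_le_mul_of_nonneg_left (DSF.pow_div_le_exp hρ hρ1 k n) hC0.le
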